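/- Let $n\ge 2$, $k\ge 1$ be integers, let $\Sigma$ be a closed oriented surface of genus $1$, let $\mathcal M$ be the smooth part of the moduli space of flat $SU(n)$-connections on $\Sigma$ with its Chern--Simons line bundle $\mathcal L\to\mathcal M$ (curvature $-i\omega$), and let $\mathcal T$ (the upper half-plane) be the Teichmüller space of $\Sigma$, which parametrises Kähler structures on $(\mathcal M,\omega)$ with metrics $g_\sigma$. Let $\mathcal D$ be the algebra of finite-order differential operators on smooth sections of $\mathcal L^k$, and $\Delta=\Delta_\sigma$ the Laplace--Beltrami operator. For a tangent vector $V$ of $\mathcal T$ write $-V[g_\sigma^{-1}]=G(V)+\overline G(V)$ (parts of type $(2,0)$ and $(0,2)$), $b(V)=\nabla^2_{G(V)}$ and $\overline b(V)=\nabla^2_{\overline G(V)}$. For $t=k+is$ the Hitchin--Witten connection is $d+\frac1{2t}b-\frac1{2\overline t}\overline b$, and the formal Hitchin--Witten connection on $\mathcal D[[s^{-1}]]\times\mathcal T$ is $$\tilde\nabla=d-\frac1{2k}\sum_{l\ge1}(ik)^l\,[\,b-(-1)^l\overline b,\cdot\,]\,s^{-l}.$$ A trivialisation is a family of linear maps $S^{(l)}_\sigma:\mathcal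 D\to\mathcal D$ $(l\ge 0,\ \sigma\in\mathcal T)$, smooth in $\sigma$, with $S^{(0)}(D)=D$ and $\tilde\nabla\big(\sum_l S^{(l)}(D)s^{-l}\big)=0$ for every $\sigma$-independent $D\in\mathcal D$. Put $a=-\frac i2\Delta$, $P^{(l)}=\mathrm{ad}_a^l/l!$, and consider the ansatz $$S^{(l)}=\sum_{r=0}^l c_{r,l}P^{(l-r)},\qquad \mathcal R_c(D)=\sum_{l\ge0}S^{(l)}(D)s^{-l},$$ with constants $c_{r,l}\in\mathbb C$ ($0\le r\le l$) independent of $D$ and $\sigma$. The numeric recursion is the system $$\sum_{r=0}^{m-1}\Big(\frac{(\pm2ik)^{m-r}}{2(m-r)!}c_{r,l}-(\pm ik)^{m-r}c_{r,l-m+r}\Big)=0\qquad(1\le m\le l,\ \text{both signs}).$$ 1. Every sequence $(c_{l,l})_{l\ge0}$ of complex numbers extends uniquely to a solution $(c_{r,l})_{r\le l}$ of the numeric recursion. The recursion is equivalent to $$(c_{0,l},\dots,c_{l-1,l})^T=\Big(\frac{\tanh(ikN)}{ikN}\Big)^{-1}(c_{0,l-1},\dots,c_{l-1,l-1})^T\qquad(l\ge1),$$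 where $N$ is the nilpotent $l\times l$ matrix with ones just below the diagonal and $\tanh(ikN)/(ikN)$, the value at $ikN$ of the Taylor series of $\tanh z/z$, is an invertible lower-triangular matrix. 2. The ansatz is a trivialisation of $\tilde\nabla$ if and only if $c_{0,0}=1$ and the numeric recursion holds. It is always invariant under the mapping class group $SL(2,\mathbb Z)$ of $\Sigma$, and there are infinitely many mapping-class-group-invariant trivialisations of this form. 3. For any two trivialisations of this form, $\mathcal R_c=p\cdot\mathcal R_{c'}$ for a power series $p$ in $s^{-1}$ with constant coefficients and constant term $1$. If $\mathcal R_0$ is the one with $c_{l,l}=0$ for all $l>0$, then $\mathcal R_c=\big(\sum_l c_{l,l}s^{-l}\big)\mathcal R_0$. 4. $\mathcal R_0(D)=\exp(-r\Delta)\,D\,\exp(r\Delta)$ in $\mathcal D[[s^{-1}]]$, where $r=\frac1{2k}\sum_{m\ge0}\frac{(ik)^{2m+1}}{2m+1}s^{-2m-1}$ is the expansion, convergent for real $|s|>k$, of $r=\frac1{4k}\log(-\overline t/t)$ (principal branch), so that $e^{4rk}=-\overline t/t$; and $\exp(r\Delta)$ is the formal expansion of Witten's explicit trivialisation of the Hitchin--Witten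 connection: in $\mathcal D[[s^{-1}]]$, with $1/t$ and $1/\overline t$ expanded in powers of $1/s$, one has $d\exp(r\Delta)=\exp(r\Delta)\big(\frac1{2t}b-\frac1{2\overline t}\overline b\big)$. -/

import Mathlib

open scoped ContDiff MatrixGroups

noncomputable section

namespace HitchinWitten

/-! ## Differential operators in the sense of Grothendieck -/

section DiffOps

variable {E : Type*} [AddCommGroup E] [Module ℂ E]

/-- `OrderLT mults m D`: the endomorphism `D` is a differential operator of order `< m`
with respect to the multiplication operators `mults`, i.e. all its `m`-fold iterated
commutators with multiplication operators vanish. -/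
def OrderLT (mults : Set (Module.End ℂ E)) : ℕ → Module.End ℂ E → Prop
  | 0, D => D = 0
  | m + 1, D => ∀ f ∈ mults, OrderLT mults m (D * f - f * D)

variable {mults : Set (Module.End ℂ E)}

theorem OrderLT.zero (m : ℕ) : OrderLT mults m 0 := by
  induction m with
  | zero => rfl
  | succ m ih => intro f _; simpa using ih

theorem OrderLT.succ {m : ℕ} {D : Module.End ℂ E} (h : OrderLT mults m D) :
    OrderLT mults (m + 1) D := by
  induction m generalizing D with
  | zero =>
    have h0 : D = 0 := h
    subst h0
    exact OrderLT.zero _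
  | succ m ih => intro f hf; exact ih (h f hf)

theorem OrderLT.mono {m m' : ℕ} (hm : m ≤ m') {D : Module.End ℂ E} (h : OrderLT mults m D) :
    OrderLT mults m' D := by
  induction hm with
  | refl => exact h
  | step _ ih => exact ih.succ

theorem OrderLT.add {m : ℕ} {D D' : Module.End ℂ E} (h : OrderLT mults m D)
    (h' : OrderLT mults m D') : OrderLT mults m (D + D') := by
  induction m generalizing D D' with
  | zero =>
    have h0 : D = 0 := h
    have h0' : D' = 0 := h'
    subst h0 h0'
    exact add_zero _
  | succ m ih =>
    intro f hf
    have := ih (h f hf) (h' f hf)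
    convert this using 1
    noncomm_ring

theorem OrderLT.mul {m m' : ℕ} {D D' : Module.End ℂ E} (h : OrderLT mults m D)
    (h' : OrderLT mults m' D') : OrderLT mults (m + m') (D * D') := by
  obtain ⟨N, hN⟩ : ∃ N, N = m + m' := ⟨_, rfl⟩
  rw [← hN]
  induction N generalizing m m' D D' with
  | zero =>
    have hm : m = 0 := by omega
    subst hm
    have h0 : D = 0 := h
    subst h0
    simpa using OrderLT.zero (mults := mults) 0
  | succ N ih =>
    cases m with
    | zero =>
      have h0 : D = 0 := h
      subst h0
      simpa using OrderLT.zero (mults := mults) (N + 1)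
    | succ m =>
      cases m' with
      | zero =>
        have h0 : D' = 0 := h'
        subst h0
        simpa using OrderLT.zero (mults := mults) (N + 1)
      | succ m' =>
        intro f hf
        have h1 := ih h (h' f hf) (by omega)
        have h2 := ih (h f hf) h' (by omega)
        convert h1.add h2 using 1
        noncomm_ring

theorem OrderLT.algebraMap (c : ℂ) :
    OrderLT mults 1 (algebraMap ℂ (Module.End ℂ E) c) := by
  intro f _
  change _ = (0 : Module.End ℂ E)
  rw [Algebra.commutes, sub_self]

/-- The algebra of differential operators of finite order. -/
def diffOps (mults : Set (Module.End ℂ E)) : Subalgebra ℂ (Module.End ℂ E) where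
  carrier := {D | ∃ m, OrderLT mults m D}
  mul_mem' := by
    rintro D D' ⟨m, h⟩ ⟨m', h'⟩
    exact ⟨_, h.mul h'⟩
  add_mem' := by
    rintro D D' ⟨m, h⟩ ⟨m', h'⟩
    exact ⟨max m m', (h.mono (le_max_left _ _)).add (h'.mono (le_max_right _ _))⟩
  algebraMap_mem' c := ⟨1, OrderLT.algebraMap c⟩

end DiffOps

/-! ## The moduli space of flat `SU(n)`-connections on a torus

Every flat `SU(n)`-connection on `Σ = ℝ²/ℤ²` (coordinates `u, v`) is gauge equivalent to
`2πi (x du + y dv)` with `x, y` in the Cartan subalgebra of trace-free diagonal matrices.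
The remaining gauge freedom is the translation of `(x, y)` by pairs of integral elements and the
simultaneous permutation of the entries of `x` and `y`. Functions and sections over the smooth
part of the moduli space are described as (quasi-)invariant functions of `(x, y)`. -/

/-- Trace-free real diagonal matrices. -/
def cartan (n : ℕ) : Submodule ℝ (Fin n → ℝ) where
  carrier := {x | ∑ j, x j = 0}
  add_mem' := by
    intro a b ha hb
    simp only [Set.mem_ofPred_eq] at *
    simp [Finset.sum_add_distrib, ha, hb]
  zero_mem' := by simp
  smul_mem' := by
    intro c x hx
    simp only [Set.mem_ofPred_eq] at *
    simp [← Finset.mul_sum, hx]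

/-- Pairs `(x, y)`. -/
abbrev Cover (n : ℕ) : Type := cartan n × cartan n

/-- The invariant inner product on the Cartan subalgebra. -/
def pair {n : ℕ} (x y : cartan n) : ℝ := ∑ j, x.1 j * y.1 j

/-- The pairs `(x, y)` with trivial stabiliser under permutations modulo integral translations,
i.e. those lying over the smooth part of the moduli space: the `n` points `(xⱼ, yⱼ)` of `ℝ²/ℤ²`
are pairwise distinct. -/
def regular (n : ℕ) : Set (Cover n) :=
  {v | ∀ i j, i ≠ j →
    ¬ ((∃ m : ℤ, v.1.1 i - v.1.1 j = m) ∧ ∃ m : ℤ, v.2.1 i - v.2.1 j = m)}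

/-- The symplectic form `2π ∑ⱼ dxⱼ ∧ dyⱼ`. -/
def omega {n : ℕ} (v w : Cover n) : ℝ := 2 * Real.pi * (pair v.1 w.2 - pair v.2 w.1)

/-- The lattice of integral translations. -/
def IsLattice {n : ℕ} (γ : Cover n) : Prop :=
  ∀ j, (∃ m : ℤ, γ.1.1 j = m) ∧ ∃ m : ℤ, γ.2.1 j = m

/-- The multiplier of the `k`-th power of the Chern–Simons line bundle. -/
def multiplier {n : ℕ} (k : ℕ) (γ v : Cover n) : ℂ :=
  Complex.exp (Complex.I * k * ((Real.pi * pair γ.1 γ.2 + omega γ v / 2 : ℝ) : ℂ))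

/-- Permutations of the diagonal entries. -/
def perm {n : ℕ} (w : Equiv.Perm (Fin n)) : cartan n ≃ₗ[ℝ] cartan n where
  toFun x := ⟨fun j => x.1 (w j), by
    have := x.2
    change ∑ j, x.1 (w j) = 0
    rw [Equiv.sum_comp w]; exact this⟩
  invFun x := ⟨fun j => x.1 (w.symm j), by
    have := x.2
    change ∑ j, x.1 (w.symm j) = 0
    rw [Equiv.sum_comp w.symm]; exact this⟩
  map_add' _ _ := rfl
  map_smul' _ _ := rfl
  left_inv x := by ext j; simp
  right_inv x := by ext j; simp

/-- The diagonal action of permutations on pairs. -/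
def weyl {n : ℕ} (w : Equiv.Perm (Fin n)) : Cover n ≃ₗ[ℝ] Cover n :=
  (perm w).prodCongr (perm w)

/-- The vectors `eⱼ - (1/n) ∑ᵢ eᵢ`, orthogonal projections of the standard basis. -/
def frame {n : ℕ} (j : Fin n) : cartan n :=
  ⟨fun i => (if i = j then 1 else 0) - 1 / n, by
    have hn : (n : ℝ) ≠ 0 := by
      have := j.pos
      positivity
    change ∑ i, ((if i = j then (1 : ℝ) else 0) - 1 / n) = 0
    rw [Finset.sum_sub_distrib]
    simp [hn]⟩

/-- `∑ⱼ frame j ⊗ frame j` is the inverse of the inner product. -/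
theorem sum_frame {n : ℕ} (x y : cartan n) :
    ∑ j, pair (frame j) x * pair (frame j) y = pair x y := by
  have h : ∀ (z : cartan n) (j : Fin n), pair (frame j) z = z.1 j := by
    intro z j
    have hz : ∑ i, z.1 i = 0 := z.2
    simp only [pair, frame, sub_mul, Finset.sum_sub_distrib, ← Finset.mul_sum, hz]
    simp
  simp only [h]
  rfl

theorem isOpen_regular (n : ℕ) : IsOpen (regular n) := by
  have hset : regular n = ⋂ i, ⋂ j, {v : Cover n | i ≠ j →
      ¬ ((∃ m : ℤ, v.1.1 i - v.1.1 j = m) ∧ ∃ m : ℤ, v.2.1 i - v.2.1 j = m)} := by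
    ext v; simp only [regular, Set.mem_iInter, Set.mem_ofPred_eq]
  rw [hset]
  refine isOpen_iInter_of_finite fun i => isOpen_iInter_of_finite fun j => ?_
  by_cases hij : i = j
  · simp [hij]
  have hc : IsClosed (Set.range ((↑) : ℤ → ℝ)) := Int.isClosedEmbedding_coe_real.isClosed_range
  have h1 : Continuous fun v : Cover n => v.1.1 i - v.1.1 j :=
    ((continuous_apply i).comp (continuous_subtype_val.comp continuous_fst)).sub
      ((continuous_apply j).comp (continuous_subtype_val.comp continuous_fst))
  have h2 : Continuous fun v : Cover n => v.2.1 i - v.2.1 j :=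
    ((continuous_apply i).comp (continuous_subtype_val.comp continuous_snd)).sub
      ((continuous_apply j).comp (continuous_subtype_val.comp continuous_snd))
  have := ((hc.preimage h1).inter (hc.preimage h2)).isOpen_compl
  convert this using 1
  ext v
  simp [hij, eq_comm]

/-! ### Functions and sections -/

/-- Smooth functions on the regular set (extended by zero). -/
def smoothSub (n : ℕ) : Submodule ℂ (Cover n → ℂ) where
  carrier := {ψ | ContDiffOn ℝ ∞ ψ (regular n) ∧ ∀ v ∉ regular n, ψ v = 0}
  add_mem' := by
    rintro a b ⟨ha, ha'⟩ ⟨hb, hb'⟩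
    exact ⟨ha.add hb, fun v hv => by simp [ha' v hv, hb' v hv]⟩
  zero_mem' := ⟨contDiffOn_const, fun _ _ => rfl⟩
  smul_mem' := by
    rintro c a ⟨ha, ha'⟩
    exact ⟨ha.const_smul c, fun v hv => by simp [ha' v hv]⟩

/-- The space of smooth functions on the regular set. -/
def SmoothFn (n : ℕ) : Type := smoothSub n

instance (n : ℕ) : AddCommGroup (SmoothFn n) := inferInstanceAs (AddCommGroup (smoothSub n))

instance (n : ℕ) : Module ℂ (SmoothFn n) := inferInstanceAs (Module ℂ (smoothSub n))

/-- The underlying function. -/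
def SmoothFn.fn {n : ℕ} (ψ : SmoothFn n) : Cover n → ℂ := Subtype.val ψ

/-- The smooth function on the regular set given by a function. -/
def SmoothFn.mk {n : ℕ} (f : Cover n → ℂ) (hf : ContDiffOn ℝ ∞ f (regular n))
    (h0 : ∀ v ∉ regular n, f v = 0) : SmoothFn n :=
  (⟨f, hf, h0⟩ : smoothSub n)

@[simp]
theorem SmoothFn.mk_fn {n : ℕ} (f : Cover n → ℂ) (hf : ContDiffOn ℝ ∞ f (regular n))
    (h0 : ∀ v ∉ regular n, f v = 0) : (SmoothFn.mk f hf h0).fn = f := rfl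

theorem SmoothFn.contDiffOn {n : ℕ} (ψ : SmoothFn n) : ContDiffOn ℝ ∞ ψ.fn (regular n) :=
  (Subtype.prop ψ).1

theorem SmoothFn.eq_zero {n : ℕ} (ψ : SmoothFn n) {v : Cover n} (hv : v ∉ regular n) :
    ψ.fn v = 0 :=
  (Subtype.prop ψ).2 v hv

@[ext]
theorem SmoothFn.ext {n : ℕ} {ψ φ : SmoothFn n} (h : ∀ v, ψ.fn v = φ.fn v) : ψ = φ :=
  Subtype.ext (funext h)

@[simp]
theorem SmoothFn.zero_fn {n : ℕ} : (0 : SmoothFn n).fn = 0 := rfl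

@[simp]
theorem SmoothFn.add_fn {n : ℕ} (ψ φ : SmoothFn n) : (ψ + φ).fn = ψ.fn + φ.fn := rfl

@[simp]
theorem SmoothFn.smul_fn {n : ℕ} (c : ℂ) (ψ : SmoothFn n) : (c • ψ).fn = c • ψ.fn := rfl

@[simp]
theorem SmoothFn.sum_fn {n : ℕ} {ι : Type*} (s : Finset ι) (ψ : ι → SmoothFn n) :
    (∑ j ∈ s, ψ j).fn = ∑ j ∈ s, (ψ j).fn :=
  map_sum (smoothSub n).subtype ψ s

/-- Smooth sections of `𝓛ᵏ` over the smooth part of the moduli space: smooth functions on the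
regular set that are quasi-periodic under integral translations and permutation invariant.
For `k = 0` these are the smooth functions on the smooth part of the moduli space. -/
def Sections (n k : ℕ) : Submodule ℂ (SmoothFn n) where
  carrier := {ψ | (∀ γ, IsLattice γ → ∀ v ∈ regular n, ψ.fn (v + γ) = multiplier k γ v * ψ.fn v) ∧
    ∀ w v, v ∈ regular n → ψ.fn (weyl w v) = ψ.fn v}
  add_mem' := by
    rintro a b ⟨ha, ha'⟩ ⟨hb, hb'⟩
    refine ⟨fun γ hγ v hv => ?_, fun w v hv => ?_⟩
    · simp [ha γ hγ v hv, hb γ hγ v hv, mul_add]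
    · simp [ha' w v hv, hb' w v hv]
  zero_mem' := ⟨fun _ _ _ _ => by simp, fun _ _ _ => by simp⟩
  smul_mem' := by
    rintro c a ⟨ha, ha'⟩
    refine ⟨fun γ hγ v hv => ?_, fun w v hv => ?_⟩
    · simp [ha γ hγ v hv, mul_left_comm]
    · simp [ha' w v hv]

/-- The space of smooth sections of `𝓛ᵏ` over the smooth part of the moduli space. -/
def Sec (n k : ℕ) : Type := Sections n k

instance (n k : ℕ) : AddCommGroup (Sec n k) := inferInstanceAs (AddCommGroup (Sections n k))

instance (n k : ℕ) : Module ℂ (Sec n k) := inferInstanceAs (Module ℂ (Sections n k))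

/-- The underlying function on the regular set. -/
def Sec.toFn {n k : ℕ} (ψ : Sec n k) : SmoothFn n := Subtype.val ψ

@[ext]
theorem Sec.ext {n k : ℕ} {ψ φ : Sec n k} (h : ∀ v, ψ.toFn.fn v = φ.toFn.fn v) : ψ = φ :=
  Subtype.ext (SmoothFn.ext h)

theorem Sec.translate {n k : ℕ} (ψ : Sec n k) {γ v : Cover n} (hγ : IsLattice γ)
    (hv : v ∈ regular n) : ψ.toFn.fn (v + γ) = multiplier k γ v * ψ.toFn.fn v :=
  (Subtype.prop ψ).1 γ hγ v hv

theorem Sec.weyl {n k : ℕ} (ψ : Sec n k) (w : Equiv.Perm (Fin n)) {v : Cover n}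
    (hv : v ∈ regular n) : ψ.toFn.fn (HitchinWitten.weyl w v) = ψ.toFn.fn v :=
  (Subtype.prop ψ).2 w v hv

/-- Restriction to sections of an endomorphism preserving them. -/
def restrictEnd {n k : ℕ} (T : Module.End ℂ (SmoothFn n))
    (h : ∀ ψ ∈ Sections n k, T ψ ∈ Sections n k) : Module.End ℂ (Sec n k) where
  toFun ψ := ⟨T ψ.toFn, h ψ.toFn ψ.2⟩
  map_add' a b := Subtype.ext (T.map_add a.toFn b.toFn)
  map_smul' c a := Subtype.ext (T.map_smul c a.toFn)

theorem smoothFn_differentiableAt {n : ℕ} (ψ : SmoothFn n) {v : Cover n} (hv : v ∈ regular n) :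
    DifferentiableAt ℝ ψ.fn v :=
  ((ψ.contDiffOn.contDiffAt ((isOpen_regular n).mem_nhds hv)).differentiableAt (by simp))

/-- Multiplication by a smooth function on the regular set. -/
def mulFn {n : ℕ} (f : SmoothFn n) : Module.End ℂ (SmoothFn n) where
  toFun ψ := SmoothFn.mk (fun v => f.fn v * ψ.fn v) (f.contDiffOn.mul ψ.contDiffOn)
    fun v hv => by simp [f.eq_zero hv]
  map_add' a b := by ext v; simp [mul_add]
  map_smul' c a := by ext v; simp [mul_left_comm]

theorem multiplier_zero {n : ℕ} (γ v : Cover n) : multiplier 0 γ v = 1 := by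
  simp [multiplier]

/-- Multiplication of sections by a smooth function on the moduli space: the curve operator. -/
def curveEnd {n : ℕ} (k : ℕ) (f : Sec n 0) : Module.End ℂ (Sec n k) :=
  restrictEnd (mulFn f.toFn) (by
    rintro ψ ⟨h, h'⟩
    refine ⟨fun γ hγ v hv => ?_, fun w v hv => ?_⟩
    · change f.toFn.fn (v + γ) * ψ.fn (v + γ) = multiplier k γ v * (f.toFn.fn v * ψ.fn v)
      rw [Sec.translate f hγ hv, h γ hγ v hv, multiplier_zero]
      ring
    · change f.toFn.fn (weyl w v) * ψ.fn (weyl w v) = f.toFn.fn v * ψ.fn v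
      rw [Sec.weyl f w hv, h' w v hv])

/-- The algebra of finite-order differential operators acting on smooth sections of `𝓛ᵏ`. -/
def DiffOp (n k : ℕ) : Subalgebra ℂ (Module.End ℂ (Sec n k)) :=
  diffOps (Set.range (curveEnd (n := n) k))

/-! ### The connection of the line bundle -/

theorem contDiff_fst_coord {n : ℕ} (j : Fin n) : ContDiff ℝ ∞ fun v : Cover n => v.1.1 j :=
  ((ContinuousLinearMap.proj (R := ℝ) (φ := fun _ : Fin n => ℝ) j).comp
    ((cartan n).subtypeL.comp (ContinuousLinearMap.fst ℝ (cartan n) (cartan n)))).contDiff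

theorem contDiff_snd_coord {n : ℕ} (j : Fin n) : ContDiff ℝ ∞ fun v : Cover n => v.2.1 j :=
  ((ContinuousLinearMap.proj (R := ℝ) (φ := fun _ : Fin n => ℝ) j).comp
    ((cartan n).subtypeL.comp (ContinuousLinearMap.snd ℝ (cartan n) (cartan n)))).contDiff

theorem contDiff_omega {n : ℕ} (u : Cover n) : ContDiff ℝ ∞ fun v : Cover n => omega v u := by
  unfold omega pair
  exact contDiff_const.mul
    ((ContDiff.sum fun j _ => (contDiff_fst_coord j).mul contDiff_const).sub
      (ContDiff.sum fun j _ => (contDiff_snd_coord j).mul contDiff_const))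

/-- The connection `∇ = d - (ik/2) ω(v, ·)`, with curvature `-ikω`, in the constant
direction `u`. -/
def cov {n : ℕ} (k : ℕ) (u : Cover n) : Module.End ℂ (SmoothFn n) where
  toFun ψ := SmoothFn.mk ((regular n).indicator fun v =>
      fderiv ℝ ψ.fn v u - Complex.I * k * ((omega v u / 2 : ℝ) : ℂ) * ψ.fn v) (by
    have h1 : ContDiffOn ℝ ∞ (fun v => fderiv ℝ ψ.fn v u) (regular n) :=
      (ψ.contDiffOn.fderiv_of_isOpen (isOpen_regular n) (m := ∞) (by simp)).clm_apply
        contDiffOn_const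
    have h2 : ContDiff ℝ ∞ fun v : Cover n => ((omega v u / 2 : ℝ) : ℂ) :=
      Complex.ofRealCLM.contDiff.comp ((contDiff_omega u).div_const 2)
    have h3 := h1.sub ((contDiffOn_const (c := Complex.I * k)).mul h2.contDiffOn |>.mul
      ψ.contDiffOn)
    exact h3.congr fun v hv => Set.indicator_of_mem hv _)
    fun v hv => Set.indicator_of_notMem hv _
  map_add' a b := by
    ext v
    by_cases hv : v ∈ regular n
    · have := fderiv_add (smoothFn_differentiableAt a hv) (smoothFn_differentiableAt b hv)
      simp only [SmoothFn.mk_fn, Set.indicator_of_mem hv, SmoothFn.add_fn, Pi.add_apply]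
      rw [this]
      simp only [add_apply]
      ring
    · rw [SmoothFn.eq_zero _ hv, SmoothFn.eq_zero _ hv]
  map_smul' c a := by
    ext v
    by_cases hv : v ∈ regular n
    · have := fderiv_const_smul (smoothFn_differentiableAt a hv) c
      simp only [SmoothFn.mk_fn, Set.indicator_of_mem hv, SmoothFn.smul_fn, Pi.smul_apply,
        RingHom.id_apply]
      rw [this]
      simp only [smul_apply, smul_eq_mul]
      ring
    · rw [SmoothFn.eq_zero _ hv, SmoothFn.eq_zero _ hv]

theorem cov_apply {n : ℕ} (k : ℕ) (u : Cover n) (ψ : SmoothFn n) {v : Cover n}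
    (hv : v ∈ regular n) :
    (cov k u ψ).fn v = fderiv ℝ ψ.fn v u - Complex.I * k * ((omega v u / 2 : ℝ) : ℂ) * ψ.fn v := by
  simp only [cov, LinearMap.coe_mk, AddHom.coe_mk, SmoothFn.mk_fn, Set.indicator_of_mem hv]

/-- The direction `(u, 0)` or `(0, u)`. -/
def dir {n : ℕ} (a : Fin 2) (u : cartan n) : Cover n := if a = 0 then (u, 0) else (0, u)

/-- For a constant bivector `G` on `ℝ²`, with components `Gᵃᵇ`, the second covariant derivative
`∇²` contracted with `G ⊗ ∑ⱼ frame j ⊗ frame j`. -/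
def hessFn {n : ℕ} (k : ℕ) (G : Matrix (Fin 2) (Fin 2) ℂ) : Module.End ℂ (SmoothFn n) :=
  ∑ a, ∑ b, G a b • ∑ j, cov k (dir a (frame j)) * cov k (dir b (frame j))

theorem regular_add {n : ℕ} {γ v : Cover n} (hγ : IsLattice γ) (hv : v ∈ regular n) :
    v + γ ∈ regular n := by
  intro i j hij
  rintro ⟨⟨m, hm⟩, ⟨m', hm'⟩⟩
  obtain ⟨⟨a, ha⟩, ⟨a', ha'⟩⟩ := hγ i
  obtain ⟨⟨b, hb⟩, ⟨b', hb'⟩⟩ := hγ j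
  refine hv i j hij ⟨⟨m - a + b, ?_⟩, ⟨m' - a' + b', ?_⟩⟩
  · have : v.1.1 i + γ.1.1 i - (v.1.1 j + γ.1.1 j) = m := hm
    push_cast
    linarith
  · have : v.2.1 i + γ.2.1 i - (v.2.1 j + γ.2.1 j) = m' := hm'
    push_cast
    linarith

theorem omega_add_left {n : ℕ} (v w u : Cover n) : omega (v + w) u = omega v u + omega w u := by
  simp only [omega, pair, Prod.fst_add, Prod.snd_add, Submodule.coe_add, Pi.add_apply, add_mul,
    Finset.sum_add_distrib]
  ring

theorem omega_neg_swap {n : ℕ} (v w : Cover n) : omega v w = - omega w v := by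
  simp only [omega, pair, mul_comm]
  ring

theorem omega_smul_left {n : ℕ} (c : ℝ) (v u : Cover n) : omega (c • v) u = c * omega v u := by
  have h : ∀ x y : cartan n, pair (c • x) y = c * pair x y := by
    intro x y
    simp [pair, Finset.mul_sum, mul_assoc]
  simp only [omega, Prod.smul_fst, Prod.smul_snd, h]
  ring

/-- `v ↦ ω(γ, v)` as a continuous linear map. -/
def omegaCLM {n : ℕ} (γ : Cover n) : Cover n →L[ℝ] ℝ :=
  LinearMap.toContinuousLinearMap
    { toFun := fun v => omega γ v
      map_add' := fun v w => by
        rw [omega_neg_swap, omega_add_left, omega_neg_swap γ v, omega_neg_swap γ w]; ring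
      map_smul' := fun c v => by
        rw [omega_neg_swap, omega_smul_left, omega_neg_swap γ v]; simp }

theorem multiplier_hasFDerivAt {n : ℕ} (k : ℕ) (γ v : Cover n) :
    HasFDerivAt (fun v => multiplier k γ v)
      ((multiplier k γ v) • ((Complex.I * k / 2) •
        (Complex.ofRealCLM.comp (omegaCLM γ)))) v := by
  have h0 : HasFDerivAt (fun v : Cover n => ((omega γ v : ℝ) : ℂ))
      (Complex.ofRealCLM.comp (omegaCLM γ)) v :=
    (Complex.ofRealCLM.comp (omegaCLM γ)).hasFDerivAt
  have h1 := ((h0.const_mul (Complex.I * k / 2)).const_add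
    (Complex.I * k * ((Real.pi * pair γ.1 γ.2 : ℝ) : ℂ))).cexp
  have h2 : (fun v : Cover n => multiplier k γ v) = fun v => Complex.exp
      (Complex.I * k * ((Real.pi * pair γ.1 γ.2 : ℝ) : ℂ)
        + Complex.I * k / 2 * ((omega γ v : ℝ) : ℂ)) := by
    funext v
    unfold multiplier
    congr 1
    push_cast
    ring
  have h3 := congrFun h2 v
  rw [h2, h3]
  exact h1

theorem cov_translate {n : ℕ} (k : ℕ) (u γ : Cover n) (hγ : IsLattice γ) (ψ : SmoothFn n)
    (h : ∀ v ∈ regular n, ψ.fn (v + γ) = multiplier k γ v * ψ.fn v) (v : Cover n)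
    (hv : v ∈ regular n) :
    (cov k u ψ).fn (v + γ) = multiplier k γ v * (cov k u ψ).fn v := by
  have hd := (smoothFn_differentiableAt ψ hv).hasFDerivAt
  have h1 := (multiplier_hasFDerivAt k γ v).mul hd
  have h2 : (fun v => ψ.fn (v + γ)) =ᶠ[nhds v] fun v => multiplier k γ v * ψ.fn v := by
    filter_upwards [(isOpen_regular n).mem_nhds hv] with x hx using h x hx
  have h3 : fderiv ℝ (fun v => ψ.fn (v + γ)) v = fderiv ℝ ψ.fn (v + γ) :=
    fderiv_comp_add_right γ
  have h4 : fderiv ℝ ψ.fn (v + γ) u = multiplier k γ v * fderiv ℝ ψ.fn v u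
      + ψ.fn v * (multiplier k γ v * (Complex.I * k / 2 * (omega γ u : ℂ))) := by
    rw [← h3, h2.fderiv_eq]
    have := congrArg (fun L => L u) h1.fderiv
    simpa [omegaCLM, Pi.mul_def] using this
  rw [cov_apply k u ψ (regular_add hγ hv), cov_apply k u ψ hv, h4, h v hv, omega_add_left]
  push_cast
  ring

/-- Naturality of the connection under linear symplectic symmetries. -/
theorem cov_comp {n : ℕ} (k : ℕ) (u : Cover n) (L : Cover n ≃ₗ[ℝ] Cover n)
    (hL : ∀ v w, omega (L v) (L w) = omega v w) (ψ φ : SmoothFn n) (h : ∀ v, φ.fn v = ψ.fn (L v))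
    (hr : ∀ v ∈ regular n, L v ∈ regular n) (v : Cover n) (hv : v ∈ regular n) :
    (cov k u φ).fn v = (cov k (L u) ψ).fn (L v) := by
  have h1 : φ.fn = ψ.fn ∘ L.toContinuousLinearEquiv := funext h
  have h2 : fderiv ℝ φ.fn v u = fderiv ℝ ψ.fn (L v) (L u) := by
    rw [h1, L.toContinuousLinearEquiv.comp_right_fderiv]
    rfl
  rw [cov_apply k u φ hv, cov_apply k (L u) ψ (hr v hv), h2, hL, h v]

theorem weyl_fst {n : ℕ} (w : Equiv.Perm (Fin n)) (v : Cover n) (j : Fin n) :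
    (weyl w v).1.1 j = v.1.1 (w j) := rfl

theorem weyl_snd {n : ℕ} (w : Equiv.Perm (Fin n)) (v : Cover n) (j : Fin n) :
    (weyl w v).2.1 j = v.2.1 (w j) := rfl

theorem weyl_regular {n : ℕ} (w : Equiv.Perm (Fin n)) (v : Cover n) (hv : v ∈ regular n) :
    weyl w v ∈ regular n := by
  intro i j hij
  simp only [weyl_fst, weyl_snd]
  exact hv (w i) (w j) (by simpa using hij)

theorem weyl_regular_iff {n : ℕ} (w : Equiv.Perm (Fin n)) (v : Cover n) :
    weyl w v ∈ regular n ↔ v ∈ regular n := by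
  refine ⟨fun h => ?_, weyl_regular w v⟩
  have := weyl_regular w.symm _ h
  have h2 : weyl w.symm (weyl w v) = v := by
    ext j <;> simp [weyl_fst, weyl_snd]
  rwa [h2] at this

theorem weyl_omega {n : ℕ} (w : Equiv.Perm (Fin n)) (v v' : Cover n) :
    omega (weyl w v) (weyl w v') = omega v v' := by
  unfold omega pair
  simp only [weyl_fst, weyl_snd]
  rw [Equiv.sum_comp w fun j => v.1.1 j * v'.2.1 j, Equiv.sum_comp w fun j => v.2.1 j * v'.1.1 j]

theorem weyl_dir {n : ℕ} (w : Equiv.Perm (Fin n)) (a : Fin 2) (j : Fin n) :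
    weyl w (dir a (frame j)) = dir a (frame (w.symm j)) := by
  have hf : perm w (frame j) = frame (w.symm j) := by
    ext i
    simp [perm, frame, Equiv.eq_symm_apply]
  fin_cases a
  · change (perm w (frame j), perm w 0) = (frame (w.symm j), 0)
    rw [hf, map_zero]
  · change (perm w 0, perm w (frame j)) = (0, frame (w.symm j))
    rw [hf, map_zero]

theorem hessFn_apply {n : ℕ} (k : ℕ) (G : Matrix (Fin 2) (Fin 2) ℂ) (ψ : SmoothFn n)
    (v : Cover n) : (hessFn k G ψ).fn v =
      ∑ a, ∑ b, G a b * ∑ j, (cov k (dir a (frame j)) (cov k (dir b (frame j)) ψ)).fn v := by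
  simp [hessFn, LinearMap.sum_apply, Finset.sum_apply, Fin.sum_univ_two]

theorem hessFn_mem {n : ℕ} (k : ℕ) (G : Matrix (Fin 2) (Fin 2) ℂ) (ψ : SmoothFn n)
    (hψ : ψ ∈ Sections n k) : hessFn k G ψ ∈ Sections n k := by
  obtain ⟨h, h'⟩ := hψ
  refine ⟨fun γ hγ v hv => ?_, fun w v hv => ?_⟩
  · rw [hessFn_apply, hessFn_apply, Finset.mul_sum]
    refine Finset.sum_congr rfl fun a _ => ?_
    rw [Finset.mul_sum]
    refine Finset.sum_congr rfl fun b _ => ?_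
    rw [mul_left_comm, Finset.mul_sum _ _ (multiplier k γ v)]
    congr 1
    refine Finset.sum_congr rfl fun j _ => ?_
    exact cov_translate k _ γ hγ _ (fun v hv => cov_translate k _ γ hγ ψ (h γ hγ) v hv) v hv
  · rw [hessFn_apply, hessFn_apply]
    refine Finset.sum_congr rfl fun a _ => Finset.sum_congr rfl fun b _ => ?_
    congr 1
    rw [← Equiv.sum_comp w.symm]
    refine Finset.sum_congr rfl fun j _ => ?_
    have hψw : ∀ v, ψ.fn v = ψ.fn (weyl w v) := by
      intro v
      by_cases hv : v ∈ regular n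
      · exact (h' w v hv).symm
      · rw [ψ.eq_zero hv, ψ.eq_zero (fun hc => hv ((weyl_regular_iff w v).1 hc))]
    rw [← weyl_dir, ← weyl_dir]
    refine (cov_comp k _ (weyl w) (weyl_omega w) _ _ (fun v => ?_) (weyl_regular w) v hv).symm
    by_cases hv : v ∈ regular n
    · exact cov_comp k _ (weyl w) (weyl_omega w) _ _ hψw (weyl_regular w) v hv
    · rw [SmoothFn.eq_zero _ hv,
        SmoothFn.eq_zero _ (fun hc => hv ((weyl_regular_iff w v).1 hc))]

/-- `∇²_G` acting on sections of `𝓛ᵏ`. -/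
def hessEnd (n k : ℕ) (G : Matrix (Fin 2) (Fin 2) ℂ) : Module.End ℂ (Sec n k) :=
  restrictEnd (hessFn k G) (hessFn_mem k G)

theorem cov_mulFn {n : ℕ} (k : ℕ) (u : Cover n) (f : SmoothFn n) :
    cov k u * mulFn f - mulFn f * cov k u = mulFn (cov 0 u f) := by
  ext ψ v
  by_cases hv : v ∈ regular n
  · have h1 := fderiv_mul (smoothFn_differentiableAt f hv) (smoothFn_differentiableAt ψ hv)
    have h2 : fderiv ℝ (mulFn f ψ).fn v = f.fn v • fderiv ℝ ψ.fn v + ψ.fn v • fderiv ℝ f.fn v := h1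
    have h3 : (cov k u (mulFn f ψ)).fn v - f.fn v * (cov k u ψ).fn v = (cov 0 u f).fn v * ψ.fn v := by
      rw [cov_apply k u _ hv, cov_apply k u _ hv, cov_apply 0 u _ hv, h2]
      change _ - _ * (f.fn v * ψ.fn v) - _ = _
      simp only [add_apply, smul_apply, smul_eq_mul]
      push_cast
      ring
    exact h3
  · rw [SmoothFn.eq_zero _ hv, SmoothFn.eq_zero _ hv]

theorem mulFn_comm {n : ℕ} (f g : SmoothFn n) : mulFn f * mulFn g = mulFn g * mulFn f := by
  ext ψ v
  change f.fn v * (g.fn v * ψ.fn v) = g.fn v * (f.fn v * ψ.fn v)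
  ring

theorem cov_orderLT {n : ℕ} (k : ℕ) (u : Cover n) :
    OrderLT (Set.range (mulFn (n := n))) 2 (cov k u) := by
  rintro _ ⟨f, rfl⟩ _ ⟨g, rfl⟩
  change _ = (0 : Module.End ℂ (SmoothFn n))
  rw [cov_mulFn, mulFn_comm, sub_self]

theorem restrict_orderLT {n k : ℕ} (m : ℕ) (T : Module.End ℂ (SmoothFn n))
    (hT : OrderLT (Set.range (mulFn (n := n))) m T) (T' : Module.End ℂ (Sec n k))
    (h : ∀ ψ, (T' ψ).toFn = T ψ.toFn) : OrderLT (Set.range (curveEnd (n := n) k)) m T' := by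
  induction m generalizing T T' with
  | zero =>
    have h0 : T = 0 := hT
    change T' = 0
    refine LinearMap.ext fun ψ => Sec.ext fun v => ?_
    rw [h, h0]
    rfl
  | succ m ih =>
    rintro _ ⟨f, rfl⟩
    refine ih _ (hT (mulFn f.toFn) ⟨_, rfl⟩) _ fun ψ => ?_
    have h1 : (T' (curveEnd k f ψ)).toFn = T (mulFn f.toFn ψ.toFn) := h _
    have h2 : (curveEnd k f (T' ψ)).toFn = mulFn f.toFn (T' ψ).toFn := rfl
    have h3 : ((T' * curveEnd k f - curveEnd k f * T') ψ).toFn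
      = (T' (curveEnd k f ψ)).toFn - (curveEnd k f (T' ψ)).toFn := rfl
    rw [h3, h1, h2, h]
    rfl

theorem hessEnd_mem (n k : ℕ) (G : Matrix (Fin 2) (Fin 2) ℂ) : hessEnd n k G ∈ DiffOp n k := by
  have h : hessFn k G ∈ diffOps (Set.range (mulFn (n := n))) := by
    unfold hessFn
    refine Subalgebra.sum_mem _ fun a _ => Subalgebra.sum_mem _ fun b _ => ?_
    refine Subalgebra.smul_mem _ (Subalgebra.sum_mem _ fun j _ => ?_) _
    exact Subalgebra.mul_mem _ ⟨2, cov_orderLT k _⟩ ⟨2, cov_orderLT k _⟩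
  obtain ⟨m, hm⟩ := h
  exact ⟨m, restrict_orderLT m _ hm _ fun ψ => rfl⟩

/-- `∇²_G` as a differential operator on sections of `𝓛ᵏ`. -/
def hess (n k : ℕ) (G : Matrix (Fin 2) (Fin 2) ℂ) : DiffOp n k := ⟨hessEnd n k G, hessEnd_mem n k G⟩

/-! ### The family of Kähler structures over Teichmüller space

The Teichmüller space of the torus is the upper half-plane: to `τ` belongs the complex structure
on `Σ` with holomorphic coordinate `u + τ v`. All tensors below are constant, of the form
`T ⊗ (identity or inner product of the Cartan subalgebra)` with `T` a `2 × 2` matrix in the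
coordinates `(x, y)`. -/

/-- The Hodge star on `x du + y dv`, i.e. the complex structure with holomorphic
coordinates `y - τ x`. -/
def complexStr (τ : ℂ) : Matrix (Fin 2) (Fin 2) ℝ :=
  τ.im⁻¹ • !![τ.re, -1; ‖τ‖ ^ 2, -τ.re]

/-- The matrix of the symplectic form. -/
def omegaMat : Matrix (Fin 2) (Fin 2) ℝ := (2 * Real.pi) • !![0, 1; -1, 0]

/-- The Kähler metric `g = ω(·, J ·)`. -/
def metric (τ : ℂ) : Matrix (Fin 2) (Fin 2) ℝ := omegaMat * complexStr τ

/-- The inverse of the metric. -/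
def invMetric (τ : ℂ) : Matrix (Fin 2) (Fin 2) ℝ := (metric τ)⁻¹

/-- `G̃(V)`, minus the derivative of the inverse metric along the tangent vector `V`. -/
def Gtilde (τ V : ℂ) : Matrix (Fin 2) (Fin 2) ℂ :=
  Matrix.of fun a b => ((-lineDeriv ℝ (fun z : ℂ => invMetric z a b) τ V : ℝ) : ℂ)

/-- The projection of complexified tangent vectors onto type `(1,0)`. -/
def proj10 (τ : ℂ) : Matrix (Fin 2) (Fin 2) ℂ :=
  (1 / 2 : ℂ) • (1 - Complex.I • (complexStr τ).map (fun r : ℝ => (r : ℂ)))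

/-- The projection of complexified tangent vectors onto type `(0,1)`. -/
def proj01 (τ : ℂ) : Matrix (Fin 2) (Fin 2) ℂ :=
  (1 / 2 : ℂ) • (1 + Complex.I • (complexStr τ).map (fun r : ℝ => (r : ℂ)))

/-- The Laplace–Beltrami operator on sections of `𝓛ᵏ`. -/
def lap (n k : ℕ) (τ : UpperHalfPlane) : DiffOp n k :=
  hess n k ((invMetric τ).map (fun r : ℝ => (r : ℂ)))

/-- `b(V) = ∇²_{G(V)}` with `G(V)` the part of type `(2,0)` of `G̃(V)`. -/
def bForm (n k : ℕ) (τ : UpperHalfPlane) (V : ℂ) : DiffOp n k :=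
  hess n k (proj10 τ * Gtilde τ V * (proj10 τ).transpose)

/-- `b̄(V) = ∇²_{Ḡ(V)}` with `Ḡ(V)` the part of type `(0,2)` of `G̃(V)`. -/
def bbarForm (n k : ℕ) (τ : UpperHalfPlane) (V : ℂ) : DiffOp n k :=
  hess n k (proj01 τ * Gtilde τ V * (proj01 τ).transpose)

/-! ### Families of operators, and the formal Hitchin–Witten connection -/

/-- Smoothness of a family of operators over Teichmüller space. -/
def SmoothFamily {n k : ℕ} (D : UpperHalfPlane → DiffOp n k) : Prop :=
  ∀ ψ : Sec n k, ContDiffOn ℝ ∞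
    (fun p : ℂ × Cover n => ((D (UpperHalfPlane.ofComplex p.1)).1 ψ).toFn.fn p.2)
    ({z : ℂ | 0 < z.im} ×ˢ regular n)

/-- `V[D] = D'` at `τ`: the derivative of the family `D` along the tangent vector `V`, taken
pointwise on (fixed) sections. -/
def HasOpDeriv {n k : ℕ} (D : UpperHalfPlane → DiffOp n k) (τ : UpperHalfPlane) (V : ℂ)
    (D' : DiffOp n k) : Prop :=
  ∀ (ψ : Sec n k) (v : Cover n), v ∈ regular n →
    HasLineDerivAt ℝ (fun z : ℂ => ((D (UpperHalfPlane.ofComplex z)).1 ψ).toFn.fn v)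
      ((D'.1 ψ).toFn.fn v) (τ : ℂ) V

/-- The commutator `D ↦ [T, D]`. -/
def commOp {n k : ℕ} (T : DiffOp n k) : Module.End ℂ (DiffOp n k) :=
  LinearMap.mulLeft ℂ T - LinearMap.mulRight ℂ T

/-- `HasFormalCovDeriv R τ V Q`: the covariant derivative at `τ` along `V` of the family
`∑ R⁽ˡ⁾ s⁻ˡ` of formal power series of differential operators, with respect to the formal
Hitchin–Witten connection
`∇̃ = d - (1/2k) ∑_{n ≥ 1} (ik)ⁿ [b - (-1)ⁿ b̄, ·] s⁻ⁿ`, is `∑ Q⁽ˡ⁾ s⁻ˡ`. -/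
def HasFormalCovDeriv {n k : ℕ} (R : ℕ → UpperHalfPlane → DiffOp n k) (τ : UpperHalfPlane)
    (V : ℂ) (Q : ℕ → DiffOp n k) : Prop :=
  ∀ l, HasOpDeriv (R l) τ V (Q l + (1 / (2 * k) : ℂ) •
    ∑ m ∈ Finset.Icc 1 l, (Complex.I * k) ^ m • commOp (bForm n k τ V - (-1 : ℂ) ^ m • bbarForm n k τ V) (R (l - m) τ))

/-- A trivialisation of the formal Hitchin–Witten connection: maps `D ↦ ∑ S⁽ˡ⁾(D) s⁻ˡ` sending
every `σ`-independent differential operator to a formally parallel series starting with `D`. -/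
structure IsTrivialisation {n k : ℕ}
    (S : ℕ → UpperHalfPlane → Module.End ℂ (DiffOp n k)) : Prop where
  zero : ∀ τ D, S 0 τ D = D
  smooth : ∀ l D, SmoothFamily fun τ => S l τ D
  parallel : ∀ D τ V, HasFormalCovDeriv (fun l τ => S l τ D) τ V 0

/-! ### The mapping class group -/

/-- The action of the mapping class group `SL(2,ℤ)` on pairs `(x, y)`, lifting the one on the
moduli space; it intertwines the complex structures of `τ` and `A • τ`. -/
def mcg {n : ℕ} (A : SL(2, ℤ)) : Cover n ≃ₗ[ℝ] Cover n where
  toFun v := ((A 1 1 : ℝ) • v.1 + (A 1 0 : ℝ) • v.2, (A 0 1 : ℝ) • v.1 + (A 0 0 : ℝ) • v.2)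
  invFun v := ((A 0 0 : ℝ) • v.1 - (A 1 0 : ℝ) • v.2, (A 1 1 : ℝ) • v.2 - (A 0 1 : ℝ) • v.1)
  map_add' v w := by
    ext j <;> simp <;> ring
  map_smul' c v := by
    ext j <;> simp <;> ring
  left_inv v := by
    have h : (A 0 0 : ℝ) * A 1 1 - A 0 1 * A 1 0 = 1 := by
      have := A.det_coe
      rw [Matrix.det_fin_two] at this
      exact_mod_cast this
    ext j
    · simp
      linear_combination (v.1.1 j) * h
    · simp
      linear_combination (v.2.1 j) * h
  right_inv v := by
    have h : (A 0 0 : ℝ) * A 1 1 - A 0 1 * A 1 0 = 1 := by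
      have := A.det_coe
      rw [Matrix.det_fin_two] at this
      exact_mod_cast this
    ext j
    · simp
      linear_combination (v.1.1 j) * h
    · simp
      linear_combination (v.2.1 j) * h

theorem mcg_fst {n : ℕ} (A : SL(2, ℤ)) (v : Cover n) (j : Fin n) :
    (mcg A v).1.1 j = A 1 1 * v.1.1 j + A 1 0 * v.2.1 j := rfl

theorem mcg_snd {n : ℕ} (A : SL(2, ℤ)) (v : Cover n) (j : Fin n) :
    (mcg A v).2.1 j = A 0 1 * v.1.1 j + A 0 0 * v.2.1 j := rfl

theorem mcg_det (A : SL(2, ℤ)) : (A 0 0 : ℝ) * A 1 1 - A 0 1 * A 1 0 = 1 := by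
  have := A.det_coe
  rw [Matrix.det_fin_two] at this
  exact_mod_cast this

theorem mcg_mul {n : ℕ} (A B : SL(2, ℤ)) (v : Cover n) : mcg (A * B) v = mcg A (mcg B v) := by
  ext j
  · simp only [mcg_fst, mcg_snd, Matrix.SpecialLinearGroup.coe_mul, Matrix.mul_apply,
      Fin.sum_univ_two]
    push_cast
    ring
  · simp only [mcg_fst, mcg_snd, Matrix.SpecialLinearGroup.coe_mul, Matrix.mul_apply,
      Fin.sum_univ_two]
    push_cast
    ring

theorem mcg_one {n : ℕ} (v : Cover n) : mcg 1 v = v := by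
  ext j <;> simp [mcg_fst, mcg_snd]

theorem mcg_inv {n : ℕ} (A : SL(2, ℤ)) (v : Cover n) : mcg A⁻¹ (mcg A v) = v := by
  rw [← mcg_mul, inv_mul_cancel, mcg_one]

theorem mcg_lattice {n : ℕ} (A : SL(2, ℤ)) (γ : Cover n) (h : IsLattice γ) :
    IsLattice (mcg A γ) := by
  intro j
  obtain ⟨⟨a, ha⟩, ⟨c, hc⟩⟩ := h j
  refine ⟨⟨A 1 1 * a + A 1 0 * c, ?_⟩, ⟨A 0 1 * a + A 0 0 * c, ?_⟩⟩
  · rw [mcg_fst, ha, hc]; push_cast; ring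
  · rw [mcg_snd, ha, hc]; push_cast; ring

theorem mcg_regular_iff {n : ℕ} (A : SL(2, ℤ)) (v : Cover n) :
    mcg A v ∈ regular n ↔ v ∈ regular n := by
  have key : ∀ (A : SL(2, ℤ)) (v : Cover n), mcg A v ∈ regular n → v ∈ regular n := by
    intro A v h i j hij
    rintro ⟨⟨a, ha⟩, ⟨c, hc⟩⟩
    refine h i j hij ⟨⟨A 1 1 * a + A 1 0 * c, ?_⟩, ⟨A 0 1 * a + A 0 0 * c, ?_⟩⟩
    · rw [mcg_fst, mcg_fst]
      push_cast
      rw [← ha, ← hc]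
      ring
    · rw [mcg_snd, mcg_snd]
      push_cast
      rw [← ha, ← hc]
      ring
  refine ⟨key A v, fun h => key A⁻¹ _ ?_⟩
  rwa [mcg_inv]

theorem mcg_omega {n : ℕ} (A : SL(2, ℤ)) (v w : Cover n) :
    omega (mcg A v) (mcg A w) = omega v w := by
  unfold omega pair
  rw [← Finset.sum_sub_distrib, ← Finset.sum_sub_distrib]
  congr 1
  refine Finset.sum_congr rfl fun j _ => ?_
  simp only [mcg_fst, mcg_snd]
  linear_combination (v.1.1 j * w.2.1 j - v.2.1 j * w.1.1 j) * mcg_det A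

/-- The integral lattice is even. -/
theorem pair_self_even {n : ℕ} (x : cartan n) (h : ∀ j, ∃ m : ℤ, x.1 j = m) :
    ∃ q : ℤ, pair x x = 2 * q := by
  choose m hm using h
  have hs : ∑ j, x.1 j = 0 := x.2
  have hs' : ∑ j, m j = 0 := by
    have : ((∑ j, m j : ℤ) : ℝ) = 0 := by
      push_cast
      rw [← hs]
      exact Finset.sum_congr rfl fun j _ => (hm j).symm
    exact_mod_cast this
  have h1 : Even (∑ j, m j * m j) := by
    have h2 : ∑ j, m j * m j = ∑ j, m j * (m j + 1) := by
      simp [mul_add, Finset.sum_add_distrib, hs']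
    rw [h2]
    exact Finset.even_sum _ fun j _ => Int.even_mul_succ_self (m j)
  obtain ⟨q, hq⟩ := h1
  refine ⟨q, ?_⟩
  have : pair x x = ((∑ j, m j * m j : ℤ) : ℝ) := by
    push_cast
    exact Finset.sum_congr rfl fun j _ => by rw [hm j]
  rw [this, hq]
  push_cast
  ring

theorem pair_lattice_int {n : ℕ} (x y : cartan n) (hx : ∀ j, ∃ m : ℤ, x.1 j = m)
    (hy : ∀ j, ∃ m : ℤ, y.1 j = m) : ∃ q : ℤ, pair x y = q := by
  choose m hm using hx
  choose p hp using hy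
  refine ⟨∑ j, m j * p j, ?_⟩
  push_cast
  exact Finset.sum_congr rfl fun j _ => by rw [hm j, hp j]

theorem mcg_multiplier {n : ℕ} (k : ℕ) (A : SL(2, ℤ)) (γ v : Cover n) (h : IsLattice γ) :
    multiplier k (mcg A γ) (mcg A v) = multiplier k γ v := by
  obtain ⟨q, hq⟩ := pair_self_even γ.1 fun j => (h j).1
  obtain ⟨q', hq'⟩ := pair_self_even γ.2 fun j => (h j).2
  obtain ⟨p, hp⟩ := pair_lattice_int γ.1 γ.2 (fun j => (h j).1) fun j => (h j).2
  have h1 : pair (mcg A γ).1 (mcg A γ).2 = A 1 1 * A 0 1 * pair γ.1 γ.1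
      + (A 1 1 * A 0 0 + A 1 0 * A 0 1) * pair γ.1 γ.2 + A 1 0 * A 0 0 * pair γ.2 γ.2 := by
    unfold pair
    simp only [Finset.mul_sum, ← Finset.sum_add_distrib]
    refine Finset.sum_congr rfl fun j _ => ?_
    rw [mcg_fst, mcg_snd]
    ring
  have h2 : pair (mcg A γ).1 (mcg A γ).2 = pair γ.1 γ.2
      + 2 * ((A 1 1 * A 0 1 * q + A 1 0 * A 0 1 * p + A 1 0 * A 0 0 * q' : ℤ) : ℝ) := by
    rw [h1, hq, hq', hp]
    push_cast
    linear_combination (p : ℝ) * mcg_det A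
  unfold multiplier
  rw [mcg_omega, h2, Complex.exp_eq_exp_iff_exists_int]
  refine ⟨k * (A 1 1 * A 0 1 * q + A 1 0 * A 0 1 * p + A 1 0 * A 0 0 * q'), ?_⟩
  push_cast
  ring

/-- Pull-back of functions along the inverse of `mcg A`. -/
def mcgFn {n : ℕ} (A : SL(2, ℤ)) : Module.End ℂ (SmoothFn n) where
  toFun ψ := SmoothFn.mk (fun v => ψ.fn (mcg A⁻¹ v))
    (ψ.contDiffOn.comp (mcg (n := n) A⁻¹).toContinuousLinearEquiv.contDiff.contDiffOn
      fun _ hv => (mcg_regular_iff _ _).2 hv)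
    fun _ hv => ψ.eq_zero fun h => hv ((mcg_regular_iff _ _).1 h)
  map_add' _ _ := rfl
  map_smul' _ _ := rfl

/-- The action of the mapping class group on sections of `𝓛ᵏ`, `(A ψ)(v) = ψ(A⁻¹ v)`. -/
def mcgSec (n k : ℕ) : SL(2, ℤ) →* Module.End ℂ (Sec n k) where
  toFun A := restrictEnd (mcgFn A) (by
    rintro ψ ⟨h, h'⟩
    refine ⟨fun γ hγ v hv => ?_, fun w v hv => ?_⟩
    · change ψ.fn (mcg A⁻¹ (v + γ)) = multiplier k γ v * ψ.fn (mcg A⁻¹ v)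
      rw [map_add, h _ (mcg_lattice _ _ hγ) _ ((mcg_regular_iff _ _).2 hv), mcg_multiplier _ _ _ _ hγ]
    · change ψ.fn (mcg A⁻¹ (weyl w v)) = ψ.fn (mcg A⁻¹ v)
      rw [← h' w _ ((mcg_regular_iff A⁻¹ v).2 hv)]
      rfl)
  map_one' := by
    refine LinearMap.ext fun ψ => Sec.ext fun v => ?_
    change ψ.toFn.fn (mcg 1⁻¹ v) = ψ.toFn.fn v
    rw [inv_one, mcg_one]
  map_mul' A B := by
    refine LinearMap.ext fun ψ => Sec.ext fun v => ?_
    change ψ.toFn.fn (mcg (A * B)⁻¹ v) = ψ.toFn.fn (mcg B⁻¹ (mcg A⁻¹ v))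
    rw [mul_inv_rev, mcg_mul]

theorem mcgSec_curveEnd (n k : ℕ) (A : SL(2, ℤ)) (f : Sec n 0) :
    mcgSec n k A * curveEnd k f = curveEnd k (mcgSec n 0 A f) * mcgSec n k A := rfl

theorem mcgSec_inv (n k : ℕ) (A : SL(2, ℤ)) : mcgSec n k A * mcgSec n k A⁻¹ = 1 := by
  rw [← map_mul, mul_inv_cancel, map_one]

theorem mcgSec_conj_orderLT (n k m : ℕ) (A : SL(2, ℤ)) (D : Module.End ℂ (Sec n k))
    (h : OrderLT (Set.range (curveEnd (n := n) k)) m D) :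
    OrderLT (Set.range (curveEnd (n := n) k)) m (mcgSec n k A * D * mcgSec n k A⁻¹) := by
  induction m generalizing D with
  | zero =>
    have h0 : D = 0 := h
    subst h0
    change _ = (0 : Module.End ℂ (Sec n k))
    simp
  | succ m ih =>
    rintro _ ⟨f, rfl⟩
    have h1 := ih _ (h (curveEnd k (mcgSec n 0 A⁻¹ f)) ⟨_, rfl⟩)
    convert h1 using 1
    have e1 : mcgSec n k A⁻¹ * curveEnd k f
        = curveEnd k (mcgSec n 0 A⁻¹ f) * mcgSec n k A⁻¹ := mcgSec_curveEnd n k A⁻¹ f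
    have e2 : mcgSec n k A * curveEnd k (mcgSec n 0 A⁻¹ f) = curveEnd k f * mcgSec n k A := by
      rw [mcgSec_curveEnd]
      have : mcgSec n 0 A (mcgSec n 0 A⁻¹ f) = f := by
        have := congrArg (fun T => T f) (mcgSec_inv n 0 A)
        exact this
      rw [this]
    rw [mul_sub, sub_mul]
    congr 1
    simp only [← mul_assoc]
    rw [e2]

/-- The action of the mapping class group on differential operators, by conjugation. -/
def mcgOp {n k : ℕ} (A : SL(2, ℤ)) (D : DiffOp n k) : DiffOp n k :=
  ⟨mcgSec n k A * D.1 * mcgSec n k A⁻¹, by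
    obtain ⟨m, hm⟩ := D.2
    exact ⟨m, mcgSec_conj_orderLT n k m A D.1 hm⟩⟩

/-- Invariance of a family `D ↦ S⁽ˡ⁾(D)` under the mapping class group. -/
def IsMCGInvariant {n k : ℕ} (S : ℕ → UpperHalfPlane → Module.End ℂ (DiffOp n k)) : Prop :=
  ∀ (A : SL(2, ℤ)) l τ D, S l (A • τ) (mcgOp A D) = mcgOp A (S l τ D)

/-! ### The ansatz and the numeric recursion -/

/-- `a = -(i/2) Δ`. -/
def aOp (n k : ℕ) (τ : UpperHalfPlane) : DiffOp n k := (-(Complex.I / 2)) • lap n k τ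

/-- `P⁽ˡ⁾ = ad_aˡ / l!`. -/
def adPow (n k l : ℕ) (τ : UpperHalfPlane) : Module.End ℂ (DiffOp n k) :=
  ((l.factorial : ℂ)⁻¹) • (commOp (aOp n k τ)) ^ l

/-- `S⁽ˡ⁾ = ∑_{r = 0}^{l} c_{r,l} P⁽ˡ⁻ʳ⁾`. -/
def ansatz (n k : ℕ) (c : ℕ → ℕ → ℂ) (l : ℕ) (τ : UpperHalfPlane) : Module.End ℂ (DiffOp n k) :=
  ∑ r ∈ Finset.range (l + 1), c r l • adPow n k (l - r) τ

/-- The formal power series `∑ S⁽ˡ⁾(D) s⁻ˡ`; the variable of the power series stands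
for `1/s`. -/
def formalSeries {n k : ℕ} (S : ℕ → UpperHalfPlane → Module.End ℂ (DiffOp n k)) (τ : UpperHalfPlane)
    (D : DiffOp n k) : PowerSeries (DiffOp n k) :=
  PowerSeries.mk fun l => S l τ D

/-- Multiplication by a power series in `1/s` with constant coefficients. -/
def scalarSeries (n k : ℕ) (p : PowerSeries ℂ) : PowerSeries (DiffOp n k) :=
  PowerSeries.map (algebraMap ℂ (DiffOp n k)) p

/-- The coefficients `c_{r,l}` are indexed by `r ≤ l`; we set them to `0` for `r > l`. -/
def IsTriangular (c : ℕ → ℕ → ℂ) : Prop := ∀ r l, l < r → c r l = 0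

/-- `E^{±}_{m,l}`, with `ε = ±1`. -/
def numE (k : ℕ) (ε : ℂ) (c : ℕ → ℕ → ℂ) (m l : ℕ) : ℂ :=
  ∑ r ∈ Finset.range m,
    ((ε * 2 * Complex.I * k) ^ (m - r) / (2 * (m - r).factorial) * c r l
      - (ε * Complex.I * k) ^ (m - r) * c r (l - m + r))

/-- The numeric recursion `E^{±}_{m,l} = 0` for `1 ≤ m ≤ l`. -/
def NumRec (k : ℕ) (c : ℕ → ℕ → ℂ) : Prop :=
  ∀ m l, 1 ≤ m → m ≤ l → numE k 1 c m l = 0 ∧ numE k (-1) c m l = 0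

/-- The standard nilpotent matrix, with ones just below the diagonal. -/
def nilp (l : ℕ) : Matrix (Fin l) (Fin l) ℂ :=
  Matrix.of fun i j => if (i : ℕ) = j + 1 then 1 else 0

/-- Evaluation of a power series at a nilpotent `l × l` matrix. -/
def evalNilp {l : ℕ} (φ : PowerSeries ℂ) (M : Matrix (Fin l) (Fin l) ℂ) :
    Matrix (Fin l) (Fin l) ℂ :=
  ∑ j ∈ Finset.range l, PowerSeries.coeff j φ • M ^ j

/-- The Taylor series at `0` of `tanh z / z`. -/
def tanhc : PowerSeries ℂ :=
  PowerSeries.mk fun j => iteratedDeriv (j + 1) Complex.tanh 0 / ((j + 1).factorial : ℂ)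

/-- The lower-triangular Toeplitz matrix `tanh(ikN) (ikN)⁻¹`. -/
def tanhMat (k l : ℕ) : Matrix (Fin l) (Fin l) ℂ :=
  evalNilp tanhc ((Complex.I * k) • nilp l)

/-! ### Witten's explicit trivialisation -/

/-- `r` with `e^{4rk} = -t̄/t` for `t = k + is`, principal branch. -/
def wittenR (k : ℕ) (s : ℝ) : ℂ :=
  Complex.log (-((k - Complex.I * s) / (k + Complex.I * s))) / (4 * k)

/-- The expansion of `r` in powers of `1/s`:
`r = (1/2k) ∑_{m} (ik)^{2m+1} / (2m+1) s^{-2m-1}`. -/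
def rSeries (k : ℕ) : PowerSeries ℂ :=
  PowerSeries.mk fun l => if Odd l then (Complex.I * k) ^ l / (2 * k * l) else 0

/-- The exponential of a power series without constant term. -/
def formalExp {R : Type*} [Ring R] [Algebra ℂ R] (u : PowerSeries R) : PowerSeries R :=
  PowerSeries.mk fun l =>
    ∑ j ∈ Finset.range (l + 1), ((j.factorial : ℂ)⁻¹) • PowerSeries.coeff l (u ^ j)

/-- The formal expansion of `exp(r Δ)`. -/
def expLap (n k : ℕ) (τ : UpperHalfPlane) : PowerSeries (DiffOp n k) :=
  formalExp (scalarSeries n k (rSeries k) * PowerSeries.C (lap n k τ))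

/-- The formal expansion of `exp(-r Δ)`. -/
def expNegLap (n k : ℕ) (τ : UpperHalfPlane) : PowerSeries (DiffOp n k) :=
  formalExp (-(scalarSeries n k (rSeries k) * PowerSeries.C (lap n k τ)))

/-- The expansion of `1/t = 1/(k + is)` in powers of `1/s` (`ε = 1`), and that of
`1/t̄ = 1/(k - is)` (`ε = -1`). -/
def invT (k : ℕ) (ε : ℂ) : PowerSeries ℂ :=
  PowerSeries.mk fun l => if l = 0 then 0 else -(ε * Complex.I * k) ^ l / k

/-- The formal expansion of the connection form `(1/2t) b(V) - (1/2t̄) b̄(V)` of the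
Hitchin–Witten connection. -/
def connForm (n k : ℕ) (τ : UpperHalfPlane) (V : ℂ) : PowerSeries (DiffOp n k) :=
  scalarSeries n k (PowerSeries.C (1 / 2 : ℂ) * invT k 1) * PowerSeries.C (bForm n k τ V)
    - scalarSeries n k (PowerSeries.C (1 / 2 : ℂ) * invT k (-1)) * PowerSeries.C (bbarForm n k τ V)

end HitchinWitten

end

open HitchinWitten

/-! ### The numeric recursion: generating functions, tanh and Toeplitz matrices. -/

noncomputable section

namespace HitchinWitten

open PowerSeries

/-! ### Power series -/

/-! In genus 1 all tensors are constant in the coordinates (x, y), the tensor G̃ has only parts of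
type (2,0) and (0,2), and the curvature of the connection is -ikω. This gives V[Δ] = -(b + b̄), [Δ,
b] = -4k b and [Δ, b̄] = 4k b̄ (`famDeriv_lap`, `lap_commutator_bForm`, `lap_commutator_bbarForm`).
So b and b̄ are eigenvectors of ad_a with eigenvalues 2ik and -2ik, and a has derivative (i/2)(b +
b̄).

Differentiating ad_aᵖ/p! and moving b to the left through the powers of ad_a therefore produces the
exponential coefficients (±2ik)ⁱ/i! (`shift_sum_factorial`, `adPowDeriv_factorial`). With E^± the
left-hand sides of the numeric recursion, the covariant derivative of the ansatz in degree l is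
(1/2k) ∑ⱼ (E^+_{l-j,l} [b, P⁽ʲ⁾D] - E^-_{l-j,l} [b̄, P⁽ʲ⁾D]) (`famDeriv_ansatz`), and sufficiency
follows. For necessity, take for D the powers of an operator spanning the b-direction (or the
b̄-direction). One of the two sums disappears, and the other becomes a polynomial in the exponent
with infinitely many zeros (`numRec_of_isTrivialisation`). This needs the powers to be nonzero. It
is shown by sections that near a point are Gaussian eigenfunctions (`exists_section_eventuallyEq`,
`hess_vecMulVec_pow_ne_zero`).

On the numeric side put F_l = ∑ c_{r,l} Xʳ. For either sign the recursion says that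
(tanh(ikX)/(ikX)) F_{l+1} and F_l agree modulo X^{l+1} (`numE_iff_dvd`), because (e^{2z} -
1)/(e^{2z} + 1) = tanh z and tanh z / z is even. This is the matrix form, and it yields uniqueness.

Existence comes from the explicit solution c_{r,l} = coeff_r (g ρ̃^{l-r}), where g is the series of
the diagonal and ρ = Xρ̃ = -2ir (`solution_numRec`). The identity behind it is e^{4kr} = -t̄/t = 1 -
2k/t, with its conjugate (`formalExp_rSeries`). Every trivialisation of the given form is then g ·
exp(ρ ad_a) = g · exp(-r ad_Δ), so two of them differ by a scalar series, and g = 1 is conjugation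
by exp(rΔ). The same identity and the same shift argument, applied to powers of Δ, compute the
derivative of exp(rΔ) (`expLap_hasOpDeriv`). -/

/-- The exponential series `∑ aʲ Xʲ / j!`. -/
def expSeries (a : ℂ) : PowerSeries ℂ := PowerSeries.mk fun j => a ^ j / j.factorial

/-- The Taylor series at `0`. -/
def taylorAt (f : ℂ → ℂ) : PowerSeries ℂ :=
  PowerSeries.mk fun j => iteratedDeriv j f 0 / j.factorial

/-- Leibniz' rule, with factorials against binomials. It carries functional equations of germs over
to formal series; `tanhc` is defined only through derivatives. -/
theorem taylorAt_mul {f g : ℂ → ℂ} (hf : ContDiffAt ℂ ∞ f 0) (hg : ContDiffAt ℂ ∞ g 0) :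
    taylorAt (f * g) = taylorAt f * taylorAt g := by
  ext m
  have hf' : ContDiffAt ℂ (m : ℕ∞ω) f 0 := hf.of_le (by exact_mod_cast le_top)
  have hg' : ContDiffAt ℂ (m : ℕ∞ω) g 0 := hg.of_le (by exact_mod_cast le_top)
  rw [PowerSeries.coeff_mul, Finset.Nat.sum_antidiagonal_eq_sum_range_succ_mk]
  simp only [taylorAt, coeff_mk]
  rw [iteratedDeriv_mul hf' hg', Finset.sum_div]
  refine Finset.sum_congr rfl fun i hi => ?_
  have hi' : i ≤ m := by simpa [Nat.lt_succ_iff] using hi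
  rw [Nat.cast_choose ℂ hi']
  have h1 : (m.factorial : ℂ) ≠ 0 := by exact_mod_cast m.factorial_ne_zero
  have h2 : (i.factorial : ℂ) ≠ 0 := by exact_mod_cast i.factorial_ne_zero
  have h3 : ((m - i).factorial : ℂ) ≠ 0 := by exact_mod_cast (m - i).factorial_ne_zero
  field_simp

theorem expSeries_eq_rescale (a : ℂ) : expSeries a = rescale a (PowerSeries.exp ℂ) := by
  ext m
  simp [expSeries, coeff_exp, div_eq_mul_inv]

theorem rescale_expSeries (a b : ℂ) : rescale a (expSeries b) = expSeries (b * a) := by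
  ext m
  simp only [expSeries, coeff_rescale, coeff_mk]
  ring

theorem expSeries_mul_neg (a : ℂ) : expSeries a * expSeries (-a) = 1 := by
  have h := exp_mul_exp_eq_exp_add (A := ℂ) a (-a)
  rw [expSeries_eq_rescale, expSeries_eq_rescale, h, add_neg_cancel, rescale_zero]
  simp

theorem tanh_mul_exp : Filter.Eventually (fun z => Complex.tanh z * (Complex.exp (2 * z) + 1)
    = Complex.exp (2 * z) - 1) (nhds (0 : ℂ)) := by
  have h : ∀ᶠ z in nhds (0 : ℂ), Complex.cosh z ≠ 0 :=
    Complex.continuous_cosh.continuousAt.eventually_ne (by simp)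
  filter_upwards [h] with z hz
  rw [Complex.tanh_eq_sinh_div_cosh, div_mul_eq_mul_div, div_eq_iff hz, Complex.sinh, Complex.cosh,
    two_mul, Complex.exp_add, Complex.exp_neg]
  field_simp [Complex.exp_ne_zero]

theorem contDiffAt_tanh : ContDiffAt ℂ ∞ Complex.tanh 0 := by
  have : Complex.tanh = fun z => Complex.sinh z / Complex.cosh z :=
    funext Complex.tanh_eq_sinh_div_cosh
  rw [this]
  exact Complex.contDiff_sinh.contDiffAt.div Complex.contDiff_cosh.contDiffAt (by simp)

theorem taylorAt_tanh : taylorAt Complex.tanh = X * tanhc := by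
  ext m
  cases m with
  | zero => simp [taylorAt]
  | succ m => simp [taylorAt, tanhc, coeff_succ_X_mul]

theorem taylorAt_congr {f g : ℂ → ℂ} (h : f =ᶠ[nhds 0] g) : taylorAt f = taylorAt g := by
  ext m
  simp only [taylorAt, coeff_mk, h.iteratedDeriv_eq m]

theorem contDiff_exp_mul (a : ℂ) : ContDiff ℂ ∞ fun z => Complex.exp (a * z) := by fun_prop

/-- The formal shadow of tanh z · (e^{2z} + 1) = e^{2z} - 1, which holds wherever cosh z ≠ 0. It is
the only property of `tanhc` used below. -/
theorem X_mul_tanhc : X * tanhc * (expSeries 2 + 1) = expSeries 2 - 1 := by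
  have hc : ∀ c : ℂ, taylorAt (fun z => Complex.exp (2 * z) + c) = expSeries 2 + C c := by
    intro c
    ext m
    have h1 : iteratedDeriv m (fun z => Complex.exp (2 * z) + c) 0
        = iteratedDeriv m (fun z => Complex.exp (2 * z)) 0 + iteratedDeriv m (fun _ : ℂ => c) 0 :=
      iteratedDeriv_fun_add ((contDiff_exp_mul 2).contDiffAt.of_le (by exact_mod_cast le_top))
        contDiffAt_const
    simp only [taylorAt, coeff_mk, h1, map_add, expSeries, coeff_C, iteratedDeriv_const]
    cases m <;> simp
  have h := taylorAt_mul contDiffAt_tanh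
    (((contDiff_exp_mul 2).add (contDiff_const (c := (1 : ℂ)))).contDiffAt)
  rw [taylorAt_tanh, hc 1, map_one] at h
  refine h.symm.trans ((taylorAt_congr tanh_mul_exp).trans ?_)
  have := hc (-1)
  rw [map_neg, map_one, ← sub_eq_add_neg] at this
  simpa [sub_eq_add_neg] using this

/-- The series `tanh (ikX) / (ikX)`. -/
def tanhSeries (k : ℕ) : PowerSeries ℂ := rescale (Complex.I * k) tanhc

theorem expSeries_sub_one (k : ℕ) (ε : ℂ) (hε : ε = 1 ∨ ε = -1) :
    expSeries (ε * 2 * Complex.I * k) - 1 =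
      (expSeries (ε * 2 * Complex.I * k) + 1) * (C (ε * Complex.I * k) * X) * tanhSeries k := by
  have h := congrArg (rescale (Complex.I * k)) X_mul_tanhc
  simp only [map_mul, map_add, map_sub, map_one, rescale_X, rescale_expSeries] at h
  change _ * tanhSeries k * _ = _ at h
  rcases hε with rfl | rfl
  · rw [show (1 : ℂ) * 2 * Complex.I * k = 2 * (Complex.I * k) by ring, ← h,
      show (1 : ℂ) * Complex.I * k = Complex.I * k by ring, map_mul]
    ring
  -- For the lower sign the identity is multiplied by e^{-2z}. This is the oddness of tanh, and the
  -- reason why both signs lead to the same series `tanhSeries`.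
  · rw [show (-1 : ℂ) * 2 * Complex.I * k = -(2 * (Complex.I * k)) by ring,
      show (-1 : ℂ) * Complex.I * k = -(Complex.I * k) by ring, map_neg, map_mul]
    have h2 := expSeries_mul_neg (2 * (Complex.I * k))
    linear_combination expSeries (-(2 * (Complex.I * k))) * h
      + (1 - C Complex.I * C (k : ℂ) * X * tanhSeries k) * h2

theorem constantCoeff_expSeries (a : ℂ) : constantCoeff (expSeries a) = 1 := by
  rw [← coeff_zero_eq_constantCoeff_apply]
  simp [expSeries]

theorem isUnit_expSeries_add_one (a : ℂ) : IsUnit (expSeries a + 1) := by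
  rw [isUnit_iff_constantCoeff, map_add, constantCoeff_expSeries, map_one]
  norm_num

theorem coeff_zero_tanhc : coeff 0 tanhc = 1 := by
  have h := congrArg (coeff 1) X_mul_tanhc
  rw [mul_assoc, coeff_succ_X_mul, coeff_zero_eq_constantCoeff_apply, map_mul, map_add,
    constantCoeff_expSeries] at h
  simp [expSeries, coeff_one] at h
  rw [coeff_zero_eq_constantCoeff_apply]
  linear_combination h / 2

/-! ### The numeric recursion in terms of power series -/

/-- The series `∑ c_{r,l} Xʳ`. -/
def rowSeries (c : ℕ → ℕ → ℂ) (l : ℕ) : PowerSeries ℂ := PowerSeries.mk fun r => c r l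

theorem tanhSeries_mul_sub (k : ℕ) (ε : ℂ) (hε : ε = 1 ∨ ε = -1) (F F' : PowerSeries ℂ) :
    C (1 / 2) * (expSeries (ε * 2 * Complex.I * k) - 1) * F'
      - C (ε * Complex.I * k) * X * (F + C (1 / 2) * (expSeries (ε * 2 * Complex.I * k) - 1) * F)
      = C (1 / 2) * (expSeries (ε * 2 * Complex.I * k) + 1) * C (ε * Complex.I * k) *
        (X * (tanhSeries k * F' - F)) := by
  have h := expSeries_sub_one k ε hε
  have h2 : (C (1 / 2 : ℂ)) * 2 = 1 := by
    rw [show (2 : PowerSeries ℂ) = C (2 : ℂ) by rw [map_ofNat], ← map_mul]; norm_num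
  linear_combination C (1 / 2) * F' * h + C (ε * Complex.I * k) * X * F * h2

/-- F + ½(e - 1)F = ½(e + 1)F, so the difference of the two sides is ½(e + 1) · εik · X ·
(`tanhSeries` · F' - F). The first factors form a unit (constant term εik ≠ 0), and the extra X
shifts degrees by one. -/
theorem X_pow_dvd_iff_coeff (k : ℕ) (hk : 1 ≤ k) (ε : ℂ) (hε : ε = 1 ∨ ε = -1)
    (F F' : PowerSeries ℂ) (l : ℕ) :
    X ^ (l + 1) ∣ tanhSeries k * F' - F ↔ ∀ m ≤ l,
      coeff (m + 1) (C (1 / 2) * (expSeries (ε * 2 * Complex.I * k) - 1) * F') =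
        ε * Complex.I * k *
          coeff m (F + C (1 / 2) * (expSeries (ε * 2 * Complex.I * k) - 1) * F) := by
  have hu : IsUnit (C (1 / 2) * (expSeries (ε * 2 * Complex.I * k) + 1) * C (ε * Complex.I * k)) := by
    refine (IsUnit.mul (IsUnit.map _ (by norm_num)) (isUnit_expSeries_add_one _)).mul
      (IsUnit.map _ (isUnit_iff_ne_zero.2 ?_))
    have hk' : (k : ℂ) ≠ 0 := by exact_mod_cast (by omega : k ≠ 0)
    rcases hε with rfl | rfl <;> simp [hk', Complex.I_ne_zero]
  have h1 : X ^ (l + 1) ∣ tanhSeries k * F' - F ↔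
      X ^ (l + 2) ∣ C (1 / 2) * (expSeries (ε * 2 * Complex.I * k) - 1) * F'
      - C (ε * Complex.I * k) * X *
        (F + C (1 / 2) * (expSeries (ε * 2 * Complex.I * k) - 1) * F) := by
    rw [tanhSeries_mul_sub k ε hε, hu.dvd_mul_left, pow_succ' X (l + 1),
      mul_dvd_mul_iff_left X_ne_zero]
  rw [h1, X_pow_dvd_iff]
  have h0 : coeff 0 (C (1 / 2) * (expSeries (ε * 2 * Complex.I * k) - 1) * F'
      - C (ε * Complex.I * k) * X *
        (F + C (1 / 2) * (expSeries (ε * 2 * Complex.I * k) - 1) * F)) = 0 := by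
    rw [coeff_zero_eq_constantCoeff_apply]
    simp [constantCoeff_expSeries]
  have hs : ∀ m, coeff (m + 1) (C (1 / 2) * (expSeries (ε * 2 * Complex.I * k) - 1) * F'
      - C (ε * Complex.I * k) * X *
        (F + C (1 / 2) * (expSeries (ε * 2 * Complex.I * k) - 1) * F)) =
      coeff (m + 1) (C (1 / 2) * (expSeries (ε * 2 * Complex.I * k) - 1) * F') -
        ε * Complex.I * k *
          coeff m (F + C (1 / 2) * (expSeries (ε * 2 * Complex.I * k) - 1) * F) := by
    intro m
    rw [map_sub, mul_assoc (C (ε * Complex.I * k)), coeff_C_mul, coeff_succ_X_mul]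
  constructor
  · intro h m hm
    have := h (m + 1) (by omega)
    rw [hs] at this
    exact sub_eq_zero.1 this
  · intro h m hm
    cases m with
    | zero => exact h0
    | succ m => rw [hs, h m (by omega), sub_self]

/-- The second half of `E^{±}_{m,l}`. -/
def numTail (k : ℕ) (ε : ℂ) (c : ℕ → ℕ → ℂ) (l m : ℕ) : ℂ :=
  ∑ r ∈ Finset.range m, (ε * Complex.I * k) ^ (m - r) * c r (l - m + r)

/-- The second index l - m + r depends on l and m only through l - m. A step along a diagonal
therefore multiplies by εik and adds one new term. -/
theorem numTail_succ (k : ℕ) (ε : ℂ) (c : ℕ → ℕ → ℂ) (l m : ℕ) (h : m ≤ l) :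
    numTail k ε c (l + 1) (m + 1) = ε * Complex.I * k * (c m l + numTail k ε c l m) := by
  unfold numTail
  rw [Finset.sum_range_succ, mul_add, Finset.mul_sum, add_comm]
  congr 1
  · rw [show m + 1 - m = 1 by omega, show l + 1 - (m + 1) + m = l by omega, pow_one]
  · refine Finset.sum_congr rfl fun r hr => ?_
    have hr' : r < m := by simpa using hr
    rw [show m + 1 - r = (m - r) + 1 by omega, show l + 1 - (m + 1) + r = l - m + r by omega]
    ring

theorem numE_eq (k : ℕ) (ε : ℂ) (c : ℕ → ℕ → ℂ) (l m : ℕ) :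
    numE k ε c m l =
      coeff m (C (1 / 2) * (expSeries (ε * 2 * Complex.I * k) - 1) * rowSeries c l)
        - numTail k ε c l m := by
  unfold numE numTail
  rw [Finset.sum_sub_distrib]
  congr 1
  rw [mul_assoc (C (1 / 2 : ℂ)), coeff_C_mul, mul_comm _ (rowSeries c l), coeff_mul,
    Finset.Nat.sum_antidiagonal_eq_sum_range_succ_mk, Finset.sum_range_succ]
  simp only [rowSeries, expSeries, map_sub, coeff_mk, Nat.sub_self, pow_zero, Nat.factorial_zero,
    coeff_zero_one]
  simp only [Nat.cast_one, div_one, sub_self, mul_zero, add_zero, Finset.mul_sum]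
  refine Finset.sum_congr rfl fun r hr => ?_
  have hr' : r < m := by simpa using hr
  rw [coeff_one, if_neg (by omega)]
  field_simp
  ring

/-- Once E_{m,l} = 0, the tail at (m, l) equals a coefficient of ½(e - 1)F_l. Substituting this into
the tail at (m+1, l+1) leaves a relation between F_{l+1} and F_l alone. -/
theorem numE_iff_dvd (k : ℕ) (hk : 1 ≤ k) (ε : ℂ) (hε : ε = 1 ∨ ε = -1) (c : ℕ → ℕ → ℂ) :
    (∀ m l, 1 ≤ m → m ≤ l → numE k ε c m l = 0) ↔
      ∀ l, X ^ (l + 1) ∣ tanhSeries k * rowSeries c (l + 1) - rowSeries c l := by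
  simp only [numE_eq, sub_eq_zero, X_pow_dvd_iff_coeff k hk ε hε]
  have h0 : ∀ l, coeff 0 (C (1 / 2) * (expSeries (ε * 2 * Complex.I * k) - 1) * rowSeries c l)
      = 0 := by
    intro l
    rw [coeff_zero_eq_constantCoeff_apply]
    simp [constantCoeff_expSeries]
  constructor
  · intro h l m hm
    rw [h (m + 1) (l + 1) (by omega) (by omega), numTail_succ _ _ _ _ _ hm, map_add]
    congr 2
    · simp [rowSeries]
    · rcases Nat.eq_zero_or_pos m with rfl | hm'
      · rw [h0]; simp [numTail]
      · exact (h m l hm' hm).symm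
  · intro h m l _ hml
    -- The descent runs along diagonals, from (m+1, l+1) to (m, l), hence the general l. At m = 0
    -- both sides vanish.
    induction m generalizing l with
    | zero => rw [h0]; simp [numTail]
    | succ m ih =>
      obtain ⟨l, rfl⟩ : ∃ l', l = l' + 1 := ⟨l - 1, by omega⟩
      rw [h l m (by omega), numTail_succ _ _ _ _ _ (by omega), map_add]
      congr 2
      · simp [rowSeries]
      · rcases Nat.eq_zero_or_pos m with rfl | hm'
        · rw [h0]; simp [numTail]
        · exact ih l hm' (by omega)

theorem numRec_iff_dvd (k : ℕ) (hk : 1 ≤ k) (c : ℕ → ℕ → ℂ) : NumRec k c ↔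
    ∀ l, X ^ (l + 1) ∣ tanhSeries k * rowSeries c (l + 1) - rowSeries c l := by
  have h1 := numE_iff_dvd k hk 1 (Or.inl rfl) c
  have h2 := numE_iff_dvd k hk (-1) (Or.inr rfl) c
  constructor
  · intro h
    exact h1.1 fun m l hm hl => (h m l hm hl).1
  · intro h m l hm hl
    exact ⟨h1.2 h m l hm hl, h2.2 h m l hm hl⟩

/-! ### Toeplitz matrices -/

theorem nilp_pow (l j : ℕ) (a b : Fin l) :
    (nilp l ^ j) a b = if (a : ℕ) = b + j then 1 else 0 := by
  induction j generalizing b with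
  | zero => simp [Matrix.one_apply, Fin.ext_iff]
  | succ j ih =>
    rw [pow_succ, Matrix.mul_apply]
    by_cases hb : (b : ℕ) + 1 < l
    · rw [Finset.sum_eq_single (⟨b + 1, hb⟩ : Fin l)]
      · rw [ih]
        simp only [nilp, Matrix.of_apply, if_true, mul_one]
        congr 1
        simp only [eq_iff_iff]
        omega
      · intro x _ hx
        have : (x : ℕ) ≠ b + 1 := fun h => hx (Fin.ext h)
        simp [nilp, this]
      · simp
    · rw [Finset.sum_eq_zero]
      · have := a.2
        rw [if_neg (by omega)]
      · intro x _
        have := x.2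
        simp [nilp, show (x : ℕ) ≠ b + 1 by omega]

/-- The power `nilp l ^ j` is the j-th subdiagonal, and entries have a - b < l, so the truncation in
`evalNilp` loses nothing. -/
theorem tanhMat_apply (k l : ℕ) (a b : Fin l) :
    tanhMat k l a b = if b ≤ a then coeff ((a : ℕ) - b) (tanhSeries k) else 0 := by
  unfold tanhMat evalNilp
  simp only [smul_pow, Matrix.sum_apply, Matrix.smul_apply, nilp_pow, smul_eq_mul, mul_ite,
    mul_one, mul_zero]
  split_ifs with h
  · have h' : (b : ℕ) ≤ a := h
    rw [Finset.sum_eq_single ((a : ℕ) - b)]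
    · rw [if_pos (by omega), tanhSeries, coeff_rescale, mul_comm]
    · intro j _ hj
      rw [if_neg (by omega)]
    · intro hj
      have := a.2
      exact absurd (Finset.mem_range.2 (by omega)) hj
  · have h' : ¬ (b : ℕ) ≤ a := h
    exact Finset.sum_eq_zero fun j _ => if_neg (by omega)

theorem tanhMat_isUnit (k l : ℕ) : IsUnit (tanhMat k l) := by
  rw [Matrix.isUnit_iff_isUnit_det, Matrix.det_of_isLowerTriangular]
  · simp [tanhMat_apply, tanhSeries, coeff_zero_tanhc]
  · intro a b hab
    have hab' : a < b := hab
    rw [tanhMat_apply, if_neg (not_le.2 hab')]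

/-- A lower-triangular Toeplitz matrix is multiplication by its power series, truncated. -/
theorem tanhMat_mulVec (k l : ℕ) (c : ℕ → ℕ → ℂ) (l' : ℕ) (a : Fin l) :
    Matrix.mulVec (tanhMat k l) (fun ρ : Fin l => c ρ l') a
      = coeff a (tanhSeries k * rowSeries c l') := by
  rw [mul_comm, coeff_mul, Finset.Nat.sum_antidiagonal_eq_sum_range_succ_mk, Matrix.mulVec,
    dotProduct]
  simp only [tanhMat_apply, rowSeries, coeff_mk, ite_mul, zero_mul]
  rw [← Finset.sum_filter]
  refine Finset.sum_bij (fun b _ => (b : ℕ)) ?_ ?_ ?_ ?_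
  · intro b hb
    have : (b : ℕ) ≤ a := by simpa using hb
    simpa [Nat.lt_succ_iff] using this
  · intro b _ b' _ h
    exact Fin.ext h
  · intro b hb
    have hb' : b ≤ (a : ℕ) := by simpa [Nat.lt_succ_iff] using hb
    exact ⟨⟨b, lt_of_le_of_lt hb' a.2⟩, Finset.mem_filter.2 ⟨Finset.mem_univ _, hb'⟩, rfl⟩
  · intro b _
    ring

/-- Modulo X^{l+1} exactly the coefficients 0, …, l matter, and these are indexed by `Fin (l + 1)`.
The diagonal entry c_{l+1,l+1} does not occur in the step from l to l + 1, so it stays free. -/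
theorem numRec_iff_matrix (k : ℕ) (hk : 1 ≤ k) (c : ℕ → ℕ → ℂ) :
    NumRec k c ↔ ∀ l, (fun ρ : Fin (l + 1) => c ρ (l + 1)) =
      Matrix.mulVec (tanhMat k (l + 1))⁻¹ fun ρ : Fin (l + 1) => c ρ l := by
  rw [numRec_iff_dvd k hk]
  refine forall_congr' fun l => ?_
  have hu := (Matrix.isUnit_iff_isUnit_det _).1 (tanhMat_isUnit k (l + 1))
  have h1 : ((fun ρ : Fin (l + 1) => c ρ (l + 1)) =
      Matrix.mulVec (tanhMat k (l + 1))⁻¹ fun ρ : Fin (l + 1) => c ρ l) ↔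
      Matrix.mulVec (tanhMat k (l + 1)) (fun ρ : Fin (l + 1) => c ρ (l + 1))
        = fun ρ : Fin (l + 1) => c ρ l := by
    constructor
    · intro h
      rw [h, Matrix.mulVec_mulVec, Matrix.mul_nonsing_inv _ hu, Matrix.one_mulVec]
    · intro h
      rw [← h, Matrix.mulVec_mulVec, Matrix.nonsing_inv_mul _ hu, Matrix.one_mulVec]
  rw [h1, X_pow_dvd_iff, funext_iff]
  simp only [tanhMat_mulVec, map_sub, sub_eq_zero]
  constructor
  · intro h a
    rw [h a a.2]
    simp [rowSeries]
  · intro h m hm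
    rw [h ⟨m, hm⟩]
    simp [rowSeries]

theorem numRec_unique (k : ℕ) (hk : 1 ≤ k) {c c' : ℕ → ℕ → ℂ} (h : NumRec k c) (h' : NumRec k c')
    (hd : ∀ l, c l l = c' l l) : ∀ l r, r ≤ l → c r l = c' r l := by
  rw [numRec_iff_matrix k hk] at h h'
  intro l
  induction l with
  | zero =>
    intro r hr
    obtain rfl : r = 0 := by omega
    exact hd 0
  | succ l ih =>
    intro r hr
    rcases Nat.lt_or_eq_of_le hr with hr | rfl
    · have e : (fun ρ : Fin (l + 1) => c ρ l) = fun ρ : Fin (l + 1) => c' ρ l :=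
        funext fun ρ => ih ρ (by omega)
      have := (h l).trans ((congrArg _ e).trans (h' l).symm)
      exact congrFun this ⟨r, hr⟩
    · exact hd _

end HitchinWitten

end


/-! ### The identity e^{4kr} = 1 - 2k/t and the explicit solution of the recursion. -/

noncomputable section

namespace HitchinWitten

open PowerSeries

/-! ### Formal exponentials -/

theorem coeff_mul_pow_eq_zero {u : PowerSeries ℂ} (hu : constantCoeff u = 0) (g : PowerSeries ℂ)
    {l j : ℕ} (h : l < j) : coeff l (g * u ^ j) = 0 := by
  have h1 : X ^ j ∣ g * u ^ j := (pow_dvd_pow_of_dvd (X_dvd_iff.2 hu) j).mul_left g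
  exact X_pow_dvd_iff.1 h1 l h

theorem coeff_pow_eq_zero {u : PowerSeries ℂ} (hu : constantCoeff u = 0)
    {l j : ℕ} (h : l < j) : coeff l (u ^ j) = 0 := by
  simpa using coeff_mul_pow_eq_zero hu 1 h

theorem coeff_formalExp {u : PowerSeries ℂ} (hu : constantCoeff u = 0) {l N : ℕ} (h : l ≤ N) :
    coeff l (formalExp u) = ∑ j ∈ Finset.range (N + 1), (j.factorial : ℂ)⁻¹ * coeff l (u ^ j) := by
  rw [formalExp, coeff_mk]
  simp only [smul_eq_mul]
  refine Finset.sum_subset (Finset.range_subset_range.2 (by omega)) fun j _ hj => ?_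
  rw [coeff_pow_eq_zero hu (by simpa using hj), mul_zero]

theorem coeff_mul_formalExp {u : PowerSeries ℂ} (hu : constantCoeff u = 0) (g : PowerSeries ℂ)
    {l N : ℕ} (h : l ≤ N) : coeff l (g * formalExp u) =
      ∑ j ∈ Finset.range (N + 1), (j.factorial : ℂ)⁻¹ * coeff l (g * u ^ j) := by
  simp only [coeff_mul, Finset.mul_sum]
  rw [Finset.sum_comm]
  refine Finset.sum_congr rfl fun x hx => ?_
  have hx' : x.1 + x.2 = l := by simpa using hx
  rw [coeff_formalExp hu (show x.2 ≤ N by omega), Finset.mul_sum]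
  exact Finset.sum_congr rfl fun j _ => by ring

theorem constantCoeff_formalExp {u : PowerSeries ℂ} (hu : constantCoeff u = 0) :
    constantCoeff (formalExp u) = 1 := by
  rw [← coeff_zero_eq_constantCoeff_apply, coeff_formalExp hu le_rfl]
  simp

theorem derivative_formalExp {u : PowerSeries ℂ} (hu : constantCoeff u = 0) :
    derivative ℂ (formalExp u) = derivative ℂ u * formalExp u := by
  ext l
  rw [coeff_derivative, coeff_formalExp hu (le_refl (l + 1)), coeff_mul_formalExp hu _ (le_refl l),
    Finset.sum_range_succ', add_mul, Finset.sum_mul]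
  have h0 : ((Nat.factorial 0 : ℕ) : ℂ)⁻¹ * coeff (l + 1) (u ^ 0) * ((l : ℂ) + 1) = 0 := by
    simp [coeff_one]
  rw [h0, add_zero]
  refine Finset.sum_congr rfl fun j _ => ?_
  have h1 : coeff (l + 1) (u ^ (j + 1)) * ((l : ℂ) + 1) = (j + 1) * coeff l (derivative ℂ u * u ^ j) := by
    rw [← coeff_derivative, derivative_pow, Nat.add_sub_cancel]
    have : ((j + 1 : ℕ) : PowerSeries ℂ) = C ((j : ℂ) + 1) := by
      rw [map_add, map_one, map_natCast]; push_cast; rfl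
    rw [this, mul_assoc, coeff_C_mul, mul_comm (u ^ j)]
  rw [mul_assoc, h1, Nat.factorial_succ]
  have h2 : (j.factorial : ℂ) ≠ 0 := by exact_mod_cast j.factorial_ne_zero
  have h3 : (j : ℂ) + 1 ≠ 0 := by exact_mod_cast j.succ_ne_zero
  push_cast
  field_simp

theorem constantCoeff_rSeries (k : ℕ) : constantCoeff (rSeries k) = 0 := by
  rw [← coeff_zero_eq_constantCoeff_apply]
  simp [rSeries]

/-- Up to scaling r is an inverse hyperbolic tangent, so its derivative is a geometric series in X².
With c = εik the claim is (4εk r)' = 2c/(1 - c²X²). -/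
theorem derivative_rSeries (k : ℕ) (hk : 1 ≤ k) (ε : ℂ) :
    (1 - C ((Complex.I * k) ^ 2) * X ^ 2) * derivative ℂ (C (ε * 4 * k) * rSeries k)
      = C (2 * (ε * Complex.I * k)) := by
  have hk' : (k : ℂ) ≠ 0 := by exact_mod_cast (by omega : k ≠ 0)
  have hd : ∀ n, coeff n (derivative ℂ (C (ε * 4 * k) * rSeries k))
      = if Even n then 2 * ε * (Complex.I * k) ^ (n + 1) else 0 := by
    intro n
    rw [coeff_derivative, coeff_C_mul, rSeries, coeff_mk]
    have hn : (n : ℂ) + 1 ≠ 0 := by exact_mod_cast n.succ_ne_zero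
    by_cases h : Even n
    · rw [if_pos h, if_pos h.add_one]
      push_cast
      field_simp
      ring
    · rw [if_neg h, if_neg (by simpa [Nat.even_add_one, ← Nat.not_even_iff_odd] using h)]
      ring
  ext n
  rw [sub_mul, one_mul, map_sub, mul_assoc (C ((Complex.I * k) ^ 2)), coeff_C_mul,
    coeff_X_pow_mul', hd, coeff_C]
  match n with
  | 0 => simp; ring
  | 1 => simp
  | n + 2 =>
    simp only [Nat.le_add_left, if_true, Nat.add_sub_cancel, hd, Nat.add_eq_zero_iff,
      OfNat.ofNat_ne_zero, and_false, if_false]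
    by_cases h : Even n
    · rw [if_pos h, if_pos (by simpa [Nat.even_add] using h)]
      ring
    · rw [if_neg h, if_neg (by simpa [Nat.even_add] using h)]
      simp

/-- Uniqueness for a differential equation: for c = εik and E the exponential, G = (1 - cX)E
satisfies (1 + cX)G' = cG and G(0) = 1, as does 1 + cX. -/
theorem formalExp_rSeries_mul (k : ℕ) (hk : 1 ≤ k) (ε : ℂ) (hε : ε ^ 2 = 1) :
    (1 - C (ε * Complex.I * k) * X) * formalExp (C (ε * 4 * k) * rSeries k)
      = 1 + C (ε * Complex.I * k) * X := by
  have hu : constantCoeff (C (ε * 4 * k) * rSeries k) = 0 := by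
    rw [map_mul, constantCoeff_rSeries, mul_zero]
  have hE := derivative_formalExp hu
  have hr := derivative_rSeries k hk ε
  have hc0 := constantCoeff_formalExp hu
  set E := formalExp (C (ε * 4 * k) * rSeries k)
  set u := C (ε * 4 * k) * rSeries k
  obtain ⟨c, hc⟩ : ∃ c, c = ε * Complex.I * k := ⟨_, rfl⟩
  rw [← hc] at hr ⊢
  have hcc : (Complex.I * k) ^ 2 = c ^ 2 := by
    rw [hc]; linear_combination (-(Complex.I * k) ^ 2) * hε
  have h2c : C (2 * c) = 2 * C c := by rw [map_mul, map_ofNat]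
  rw [hcc, map_pow, h2c] at hr
  have hG : (1 + C c * X) * derivative ℂ ((1 - C c * X) * E) = C c * ((1 - C c * X) * E) := by
    have h1 : derivative ℂ ((1 - C c * X) * E) = (1 - C c * X) * derivative ℂ E - C c * E := by
      rw [Derivation.leibniz, map_sub, derivative_one, Derivation.leibniz, derivative_X,
        derivative_C]
      simp only [smul_eq_mul]
      ring
    rw [h1, hE]
    linear_combination E * hr
  set G := (1 - C c * X) * E with hGdef
  -- The factor 1 - n vanishes at n = 1, so the series stops after degree 1.
  have hrec : ∀ n, coeff (n + 1) G * ((n : ℂ) + 1) = c * (1 - n) * coeff n G := by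
    intro n
    have h := congrArg (coeff n) hG
    rw [add_mul, one_mul, map_add, coeff_C_mul, coeff_derivative, mul_assoc, coeff_C_mul] at h
    cases n with
    | zero => simpa using h
    | succ n =>
      rw [coeff_succ_X_mul, coeff_derivative] at h
      push_cast at h ⊢
      linear_combination h
  have h0 : coeff 0 G = 1 := by
    rw [coeff_zero_eq_constantCoeff_apply, hGdef, map_mul, hc0]
    simp
  have h1 : coeff 1 G = c := by
    have := hrec 0
    rw [h0] at this
    simpa using this
  have h2 : ∀ n, coeff (n + 2) G = 0 := by
    intro n
    induction n with
    | zero =>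
      have := hrec 1
      norm_num at this
      exact this
    | succ n ih =>
      have := hrec (n + 2)
      rw [ih, mul_zero] at this
      exact (mul_eq_zero.1 this).resolve_right (by exact_mod_cast (n + 2).succ_ne_zero)
  ext n
  match n with
  | 0 => rw [h0]; simp
  | 1 => rw [h1, map_add, coeff_C_mul]; simp [coeff_one]
  | n + 2 => rw [h2, map_add, coeff_C_mul, coeff_X, coeff_one]; simp

/-- For ε = 1 this is 1 - 2k/t = -t̄/t, with numerator and denominator divided by is; ε = -1
exchanges t and t̄. -/
theorem one_sub_invT_mul (k : ℕ) (hk : 1 ≤ k) (ε : ℂ) :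
    (1 - C (ε * Complex.I * k) * X) * (1 - C (2 * k : ℂ) * invT k ε)
      = 1 + C (ε * Complex.I * k) * X := by
  have hk' : (k : ℂ) ≠ 0 := by exact_mod_cast (by omega : k ≠ 0)
  have hF : ∀ n, coeff n (1 - C (2 * k : ℂ) * invT k ε)
      = if n = 0 then 1 else 2 * (ε * Complex.I * k) ^ n := by
    intro n
    rw [map_sub, coeff_C_mul, invT, coeff_mk, coeff_one]
    split_ifs
    · ring
    · field_simp
      ring
  ext n
  rw [sub_mul, one_mul, map_sub, mul_assoc, coeff_C_mul, hF, map_add, coeff_C_mul]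
  match n with
  | 0 => simp
  | 1 => rw [coeff_succ_X_mul, hF]; simp [coeff_one]; ring
  | n + 2 =>
    rw [coeff_succ_X_mul, hF]
    simp [coeff_one, coeff_X]
    ring

theorem formalExp_rSeries (k : ℕ) (hk : 1 ≤ k) (ε : ℂ) (hε : ε ^ 2 = 1) :
    formalExp (C (ε * 4 * k) * rSeries k) = 1 - C (2 * k : ℂ) * invT k ε := by
  have hne : (1 - C (ε * Complex.I * k) * X : PowerSeries ℂ) ≠ 0 := by
    intro h
    have := congrArg constantCoeff h
    simp at this
  exact mul_left_cancel₀ hne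
    ((formalExp_rSeries_mul k hk ε hε).trans (one_sub_invT_mul k hk ε).symm)

/-! ### The explicit solution of the numeric recursion -/

/-- The series `ρ̃` with `ρ = -2i r = X ρ̃`. -/
def rhoTilde (k : ℕ) : PowerSeries ℂ :=
  PowerSeries.mk fun l => if Even l then (Complex.I * k) ^ l / (l + 1) else 0

theorem X_mul_rhoTilde (k : ℕ) (hk : 1 ≤ k) :
    X * rhoTilde k = C (-2 * Complex.I) * rSeries k := by
  have hk' : (k : ℂ) ≠ 0 := by exact_mod_cast (by omega : k ≠ 0)
  ext n
  rw [coeff_C_mul, rSeries, coeff_mk]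
  cases n with
  | zero => simp
  | succ n =>
    rw [coeff_succ_X_mul, rhoTilde, coeff_mk]
    have hn : (n : ℂ) + 1 ≠ 0 := by exact_mod_cast n.succ_ne_zero
    by_cases h : Even n
    · rw [if_pos h, if_pos h.add_one, pow_succ]
      push_cast
      field_simp
      ring_nf
      simp
    · rw [if_neg h, if_neg (by simpa [Nat.even_add_one, ← Nat.not_even_iff_odd] using h), mul_zero]

theorem constantCoeff_X_mul (g : PowerSeries ℂ) : constantCoeff (X * g) = 0 := by simp

/-- The coefficients with prescribed generating function `g` of the diagonal. -/
def solution (k : ℕ) (g : PowerSeries ℂ) (r l : ℕ) : ℂ :=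
  if r ≤ l then coeff r (g * rhoTilde k ^ (l - r)) else 0

theorem solution_diag (k : ℕ) (g : PowerSeries ℂ) (l : ℕ) : solution k g l l = coeff l g := by
  simp [solution]

theorem solution_triangular (k : ℕ) (g : PowerSeries ℂ) : IsTriangular (solution k g) := by
  intro r l h
  rw [solution, if_neg (by omega)]

/-- With ρ = Xρ̃ the coefficient of P⁽ʲ⁾ in S⁽ˡ⁾ is the coefficient of s⁻ˡ in gρʲ. Since the P⁽ʲ⁾
contain 1/j!, the ansatz sums up to g · exp(ρ ad_a). -/
theorem solution_eq_coeff (k : ℕ) (g : PowerSeries ℂ) {j l : ℕ} (h : j ≤ l) :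
    solution k g (l - j) l = coeff l (g * (X * rhoTilde k) ^ j) := by
  rw [solution, if_pos (by omega), mul_pow, mul_left_comm, coeff_X_pow_mul', if_pos h,
    show l - (l - j) = j by omega]

/-- Let p = l - m. The first half of E_{m,l} is the m-th coefficient of ½ gρ̃ᵖ (e^{4εkr} - 1), as
2εikρ = 4εkr. In the second half the exponent of ρ̃ is constantly p, and the powers of εik form -k ·
`invT`. The two halves agree by `formalExp_rSeries`. -/
theorem solution_numE (k : ℕ) (hk : 1 ≤ k) (g : PowerSeries ℂ) (ε : ℂ) (hε : ε ^ 2 = 1) (m l : ℕ)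
    (hml : m ≤ l) : numE k ε (solution k g) m l = 0 := by
  have hk' : (k : ℂ) ≠ 0 := by exact_mod_cast (by omega : k ≠ 0)
  obtain ⟨p, rfl⟩ : ∃ p, l = p + m := ⟨l - m, by omega⟩
  have hu : constantCoeff (C (ε * 4 * k) * rSeries k) = 0 := by
    rw [map_mul, constantCoeff_rSeries, mul_zero]
  have hru : C (ε * 4 * k) * rSeries k = C (ε * 2 * Complex.I * k) * (X * rhoTilde k) := by
    rw [X_mul_rhoTilde k hk, ← mul_assoc, ← map_mul]
    congr 2
    linear_combination (4 * ε * k) * Complex.I_sq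
  have key := congrArg (fun f => coeff m (g * rhoTilde k ^ p * f)) (formalExp_rSeries k hk ε hε)
  beta_reduce at key
  rw [coeff_mul_formalExp hu _ (le_refl m), Finset.sum_range_succ', mul_sub, mul_one, map_sub] at key
  simp only [pow_zero, mul_one, Nat.factorial_zero, Nat.cast_one, inv_one, one_mul] at key
  have h1 : ∑ j ∈ Finset.range m, ((j + 1).factorial : ℂ)⁻¹ *
      coeff m (g * rhoTilde k ^ p * (C (ε * 4 * k) * rSeries k) ^ (j + 1)) =
      -(coeff m (g * rhoTilde k ^ p * (C (2 * k : ℂ) * invT k ε))) := by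
    linear_combination key
  have h2 : ∑ r ∈ Finset.range m, (ε * 2 * Complex.I * k) ^ (m - r) / (2 * (m - r).factorial)
      * solution k g r (p + m) = 1 / 2 * ∑ j ∈ Finset.range m, ((j + 1).factorial : ℂ)⁻¹ *
      coeff m (g * rhoTilde k ^ p * (C (ε * 4 * k) * rSeries k) ^ (j + 1)) := by
    rw [← Finset.sum_range_reflect, Finset.mul_sum]
    refine Finset.sum_congr rfl fun j hj => ?_
    have hj' : j < m := by simpa using hj
    rw [show m - (m - 1 - j) = j + 1 by omega, solution, if_pos (by omega), hru,
      mul_pow (C (ε * 2 * Complex.I * k)), mul_pow X, ← map_pow, show g * rhoTilde k ^ p * (C ((ε * 2 * Complex.I * k) ^ (j + 1)) *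
        (X ^ (j + 1) * rhoTilde k ^ (j + 1))) = C ((ε * 2 * Complex.I * k) ^ (j + 1)) *
        (X ^ (j + 1) * (g * rhoTilde k ^ (p + (j + 1)))) by rw [pow_add]; ring, coeff_C_mul,
      coeff_X_pow_mul', if_pos (by omega), show p + m - (m - 1 - j) = p + (j + 1) by omega,
      show m - (j + 1) = m - 1 - j by omega]
    have : ((j + 1).factorial : ℂ) ≠ 0 := by exact_mod_cast (j + 1).factorial_ne_zero
    field_simp
  have h3 : coeff m (g * rhoTilde k ^ p * (C (2 * k : ℂ) * invT k ε)) =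
      -2 * ∑ r ∈ Finset.range m, (ε * Complex.I * k) ^ (m - r) * solution k g r (p + m - m + r) := by
    rw [← mul_assoc, mul_comm _ (C (2 * k : ℂ)), mul_assoc, coeff_C_mul, coeff_mul,
      Finset.Nat.sum_antidiagonal_eq_sum_range_succ_mk, Finset.sum_range_succ, Finset.mul_sum]
    simp only [invT, coeff_mk, Nat.sub_self, if_true, mul_zero, add_zero]
    rw [Finset.mul_sum]
    refine Finset.sum_congr rfl fun r hr => ?_
    have hr' : r < m := by simpa using hr
    rw [if_neg (by omega), solution, if_pos (by omega), show p + m - m + r - r = p by omega]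
    field_simp
  unfold numE
  rw [Finset.sum_sub_distrib, h2, h1, h3]
  ring

theorem solution_numRec (k : ℕ) (hk : 1 ≤ k) (g : PowerSeries ℂ) : NumRec k (solution k g) :=
  fun m l _ h => ⟨solution_numE k hk g 1 (by norm_num) m l h,
    solution_numE k hk g (-1) (by norm_num) m l h⟩

/-- By uniqueness the explicit family exhausts all solutions; everything below about a solution
depends on its diagonal alone. -/
theorem eq_solution (k : ℕ) (hk : 1 ≤ k) {c : ℕ → ℕ → ℂ} (h : NumRec k c) {r l : ℕ} (hr : r ≤ l) :
    c r l = solution k (PowerSeries.mk fun l => c l l) r l :=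
  numRec_unique k hk h (solution_numRec k hk _) (fun l => by rw [solution_diag, coeff_mk]) l r hr

theorem existsUnique_solution (k : ℕ) (hk : 1 ≤ k) (d : ℕ → ℂ) :
    ∃! c : ℕ → ℕ → ℂ, IsTriangular c ∧ NumRec k c ∧ ∀ l, c l l = d l := by
  refine ⟨solution k (PowerSeries.mk d), ⟨solution_triangular k _, solution_numRec k hk _,
    fun l => by rw [solution_diag, coeff_mk]⟩, ?_⟩
  rintro c ⟨h1, h2, h3⟩
  funext r l
  rcases le_or_gt r l with h | h
  · exact numRec_unique k hk h2 (solution_numRec k hk _)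
      (fun l => by rw [solution_diag, coeff_mk, h3]) l r h
  · rw [h1 r l h, solution_triangular k _ r l h]

end HitchinWitten

end


/-! ### Formal identities for operators: the shift lemma and conjugation by an exponential. -/

noncomputable section

namespace HitchinWitten

open PowerSeries

/-! ### Sequences shifted by an operator -/

section Shift

variable {M : Type*} [AddCommGroup M] [Module ℂ M]

/-- On the sequence `Y`, the operator `L` acts as β plus the shift, and these commute: the binomial
theorem. It is used for ad_a and for right multiplication by Δ. -/
theorem pow_apply_shift (L : Module.End ℂ M) (Y : ℕ → M) (β : ℂ)
    (hL : ∀ q, L (Y q) = β • Y q + Y (q + 1)) (p : ℕ) :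
    (L ^ p) (Y 0) = ∑ x ∈ Finset.HasAntidiagonal.antidiagonal p, p.choose x.1 • (β ^ x.1 • Y x.2) := by
  induction p with
  | zero => simp
  | succ p ih =>
    rw [Finset.sum_antidiagonal_choose_succ_nsmul (fun i j => β ^ i • Y j) p, pow_succ',
      Module.End.mul_apply, ih, map_sum, ← Finset.sum_add_distrib]
    refine Finset.sum_congr rfl fun x hx => ?_
    have hx' : x.1 + x.2 = p := by simpa using hx
    rw [Nat.choose_symm_of_eq_add hx'.symm, map_nsmul, map_smul, hL]
    rw [smul_add, smul_add, smul_smul, ← pow_succ, add_comm]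

/-- `T p` is the sum of L^{p-1-q} Y_q over q < p. Since βY_q = L Y_q - Y_{q+1}, the sum βT_p
telescopes to Lᵖ Y₀ - Y_p. -/
theorem shift_sum (L : Module.End ℂ M) (Y T : ℕ → M) (β : ℂ)
    (hL : ∀ q, L (Y q) = β • Y q + Y (q + 1)) (h0 : T 0 = 0)
    (hT : ∀ p, T (p + 1) = Y p + L (T p)) (p : ℕ) :
    β • T p = ∑ x ∈ Finset.HasAntidiagonal.antidiagonal p, p.choose x.1 • (β ^ x.1 • Y x.2) - Y p := by
  rw [← pow_apply_shift L Y β hL]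
  induction p with
  | zero => simp [h0]
  | succ p ih =>
    rw [hT, smul_add, ← map_smul, ih, map_sub, hL, pow_succ', Module.End.mul_apply]
    abel

theorem shift_sum_factorial (L : Module.End ℂ M) (Y T : ℕ → M) (β : ℂ)
    (hL : ∀ q, L (Y q) = β • Y q + Y (q + 1)) (h0 : T 0 = 0)
    (hT : ∀ p, T (p + 1) = Y p + L (T p)) (p : ℕ) :
    β • ((p.factorial : ℂ)⁻¹ • T p) =
      ∑ x ∈ Finset.HasAntidiagonal.antidiagonal p, (β ^ x.1 / x.1.factorial) • ((x.2.factorial : ℂ)⁻¹ • Y x.2)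
        - (p.factorial : ℂ)⁻¹ • Y p := by
  rw [smul_comm, shift_sum L Y T β hL h0 hT, smul_sub, Finset.smul_sum]
  congr 1
  refine Finset.sum_congr rfl fun x hx => ?_
  have hx' : x.1 + x.2 = p := by simpa using hx
  rw [← Nat.cast_smul_eq_nsmul ℂ, smul_smul, smul_smul, smul_smul]
  congr 1
  subst hx'
  rw [Nat.cast_add_choose]
  have h1 : (x.1.factorial : ℂ) ≠ 0 := by exact_mod_cast x.1.factorial_ne_zero
  have h2 : (x.2.factorial : ℂ) ≠ 0 := by exact_mod_cast x.2.factorial_ne_zero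
  have h3 : ((x.1 + x.2).factorial : ℂ) ≠ 0 := by exact_mod_cast (x.1 + x.2).factorial_ne_zero
  field_simp

theorem sum_row_antidiagonal (c : ℕ → ℂ) (w : ℕ → ℂ) (Z : ℕ → M) (l : ℕ) :
    ∑ r ∈ Finset.range (l + 1), c r • ∑ x ∈ Finset.HasAntidiagonal.antidiagonal (l - r), w x.1 • Z x.2 =
      ∑ j ∈ Finset.range (l + 1), (∑ x ∈ Finset.HasAntidiagonal.antidiagonal (l - j), w x.1 * c x.2) • Z j := by
  simp only [Finset.smul_sum, Finset.sum_smul, Finset.sum_sigma']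
  refine Finset.sum_bij' (fun a _ => ⟨a.2.2, (a.2.1, a.1)⟩) (fun a _ => ⟨a.2.2, (a.2.1, a.1)⟩)
    ?_ ?_ ?_ ?_ ?_
  · rintro ⟨r, i, j⟩ h
    simp only [Finset.mem_sigma, Finset.mem_range, Finset.HasAntidiagonal.mem_antidiagonal] at h ⊢
    omega
  · rintro ⟨r, i, j⟩ h
    simp only [Finset.mem_sigma, Finset.mem_range, Finset.HasAntidiagonal.mem_antidiagonal] at h ⊢
    omega
  · intro _ _; rfl
  · intro _ _; rfl
  · rintro ⟨r, i, j⟩ _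
    simp only [smul_smul, mul_comm]

theorem sum_numTail (k : ℕ) (ε : ℂ) (c : ℕ → ℕ → ℂ) (Z : ℕ → M) (l : ℕ) :
    ∑ m ∈ Finset.Icc 1 l, (ε * Complex.I * k) ^ m •
        ∑ r ∈ Finset.range (l - m + 1), c r (l - m) • Z (l - m - r) =
      ∑ j ∈ Finset.range (l + 1), numTail k ε c l (l - j) • Z j := by
  simp only [numTail, Finset.smul_sum, Finset.sum_smul, Finset.sum_sigma']
  refine Finset.sum_bij' (fun a _ => ⟨l - a.1 - a.2, a.2⟩) (fun a _ => ⟨l - a.1 - a.2, a.2⟩)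
    ?_ ?_ ?_ ?_ ?_
  · rintro ⟨m, r⟩ h
    simp only [Finset.mem_sigma, Finset.mem_range, Finset.mem_Icc] at h ⊢
    omega
  · rintro ⟨m, r⟩ h
    simp only [Finset.mem_sigma, Finset.mem_range, Finset.mem_Icc] at h ⊢
    omega
  · rintro ⟨m, r⟩ h
    simp only [Finset.mem_sigma, Finset.mem_range, Finset.mem_Icc] at h
    simp only [Sigma.mk.injEq, heq_eq_eq, and_true]
    omega
  · rintro ⟨m, r⟩ h
    simp only [Finset.mem_sigma, Finset.mem_range] at h
    simp only [Sigma.mk.injEq, heq_eq_eq, and_true]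
    omega
  · rintro ⟨m, r⟩ h
    simp only [Finset.mem_sigma, Finset.mem_range, Finset.mem_Icc] at h
    simp only [smul_smul]
    rw [show l - (l - m - r) - r = m by omega, show l - (l - (l - m - r)) + r = l - m by omega]

/-- The combination of both sides of the recursion of operators yields the numbers
`E^{±}_{m,l}`. -/
theorem sum_numE (k : ℕ) (ε : ℂ) (c : ℕ → ℕ → ℂ) (Z : ℕ → M) (l : ℕ) :
    (1 / 2 : ℂ) • ∑ r ∈ Finset.range (l + 1), c r l •
        (∑ x ∈ Finset.HasAntidiagonal.antidiagonal (l - r),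
          ((ε * 2 * Complex.I * k) ^ x.1 / x.1.factorial) • Z x.2 - Z (l - r)) -
      ∑ m ∈ Finset.Icc 1 l, (ε * Complex.I * k) ^ m •
        ∑ r ∈ Finset.range (l - m + 1), c r (l - m) • Z (l - m - r) =
      ∑ j ∈ Finset.range (l + 1), numE k ε c (l - j) l • Z j := by
  have h1 : ∀ p, (∑ x ∈ Finset.HasAntidiagonal.antidiagonal p,
      ((ε * 2 * Complex.I * k) ^ x.1 / x.1.factorial) • Z x.2 - Z p)
      = ∑ x ∈ Finset.HasAntidiagonal.antidiagonal p,
        (coeff x.1 (expSeries (ε * 2 * Complex.I * k) - 1)) • Z x.2 := by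
    intro p
    simp only [map_sub, sub_smul, Finset.sum_sub_distrib, coeff_one, expSeries, coeff_mk]
    congr 1
    rw [Finset.sum_eq_single (0, p)]
    · simp
    · rintro ⟨i, j⟩ hij hne
      have : i ≠ 0 := by
        rintro rfl
        exact hne (by simpa using hij)
      simp [this]
    · simp
  simp only [h1]
  rw [sum_row_antidiagonal (fun r => c r l)
    (fun i => coeff i (expSeries (ε * 2 * Complex.I * k) - 1)), sum_numTail, Finset.smul_sum,
    ← Finset.sum_sub_distrib]
  refine Finset.sum_congr rfl fun j _ => ?_
  rw [numE_eq, mul_assoc (C (1 / 2 : ℂ)), coeff_C_mul, coeff_mul, sub_smul, smul_smul]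
  simp only [rowSeries, coeff_mk]

end Shift

/-! ### Power series with operator coefficients -/

section Conjugation

variable {R : Type*} [Ring R] [Algebra ℂ R]

theorem coeff_formalExp_scalar {p : PowerSeries ℂ} (hp : constantCoeff p = 0) (T : R) {l N : ℕ}
    (h : l ≤ N) : coeff l (formalExp (PowerSeries.map (algebraMap ℂ R) p * C T)) =
      ∑ j ∈ Finset.range (N + 1), ((j.factorial : ℂ)⁻¹ * coeff l (p ^ j)) • T ^ j := by
  have hc : Commute (PowerSeries.map (algebraMap ℂ R) p) (C T) := by
    ext m
    rw [coeff_mul_C, coeff_C_mul, coeff_map, Algebra.commutes]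
  have h1 : ∀ j, coeff l ((PowerSeries.map (algebraMap ℂ R) p * C T) ^ j)
      = coeff l (p ^ j) • T ^ j := by
    intro j
    rw [hc.mul_pow, ← map_pow, ← map_pow, coeff_mul_C, coeff_map, ← Algebra.smul_def]
  rw [formalExp, coeff_mk]
  simp only [h1, smul_smul]
  refine Finset.sum_subset (Finset.range_subset_range.2 (by omega)) fun j _ hj => ?_
  rw [coeff_pow_eq_zero hp (by simpa using hj), mul_zero, zero_smul]

/-- Truncated exponentials multiply to a sum over a square; the part beyond the triangle i + j ≤ l
vanishes because `p` has no constant term. -/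
theorem sum_square_eq_sum_antidiagonal {M : Type*} [AddCommMonoid M] (f : ℕ → ℕ → M) (l : ℕ)
    (h : ∀ i j, l < i + j → f i j = 0) :
    ∑ i ∈ Finset.range (l + 1), ∑ j ∈ Finset.range (l + 1), f i j =
      ∑ n ∈ Finset.range (l + 1), ∑ x ∈ Finset.HasAntidiagonal.antidiagonal n, f x.1 x.2 := by
  rw [← Finset.sum_product', Finset.sum_sigma']
  symm
  refine Finset.sum_of_injOn (fun a => a.2) ?_ ?_ ?_ ?_
  · rintro ⟨n, i, j⟩ h ⟨n', i', j'⟩ h' he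
    simp only [Finset.coe_sigma, Set.mem_sigma_iff, Finset.mem_coe, Finset.mem_range,
      Finset.HasAntidiagonal.mem_antidiagonal] at h h'
    simp only [Prod.mk.injEq] at he
    obtain ⟨rfl, rfl⟩ := he
    obtain rfl : n = n' := by omega
    rfl
  · rintro ⟨n, i, j⟩ h
    simp only [Finset.coe_sigma, Set.mem_sigma_iff, Finset.mem_coe, Finset.mem_range,
      Finset.HasAntidiagonal.mem_antidiagonal, Finset.mem_product] at h ⊢
    omega
  · rintro ⟨i, j⟩ _ hn
    refine h i j ?_
    by_contra hc
    exact hn ⟨⟨i + j, (i, j)⟩, by simpa [Nat.lt_succ_iff] using hc, rfl⟩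
  · rintro _ _; rfl

/-- Left and right multiplication by T commute, so exp(-pT) D exp(pT) = exp(p(R_T - L_T)) D by the
binomial theorem. -/
theorem coeff_conj_formalExp {p : PowerSeries ℂ} (hp : constantCoeff p = 0) (T D : R) (l : ℕ) :
    coeff l (formalExp (-(PowerSeries.map (algebraMap ℂ R) p * C T)) * C D *
      formalExp (PowerSeries.map (algebraMap ℂ R) p * C T)) =
      ∑ n ∈ Finset.range (l + 1), ((n.factorial : ℂ)⁻¹ * coeff l (p ^ n)) •
        ((LinearMap.mulRight ℂ T - LinearMap.mulLeft ℂ T) ^ n) D := by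
  have hn : constantCoeff (-p) = 0 := by rw [map_neg, hp, neg_zero]
  rw [← neg_mul, ← map_neg, coeff_mul]
  have h1 : ∀ x ∈ Finset.HasAntidiagonal.antidiagonal l,
      coeff x.1 (formalExp (PowerSeries.map (algebraMap ℂ R) (-p) * C T) * C D) *
        coeff x.2 (formalExp (PowerSeries.map (algebraMap ℂ R) p * C T)) =
      ∑ i ∈ Finset.range (l + 1), ∑ j ∈ Finset.range (l + 1),
        (((i.factorial : ℂ)⁻¹ * (j.factorial : ℂ)⁻¹) *
          (coeff x.1 ((-p) ^ i) * coeff x.2 (p ^ j))) • (T ^ i * D * T ^ j) := by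
    intro x hx
    have hx' : x.1 + x.2 = l := by simpa using hx
    rw [coeff_mul_C, coeff_formalExp_scalar hn T (show x.1 ≤ l by omega),
      coeff_formalExp_scalar hp T (show x.2 ≤ l by omega), Finset.sum_mul, Finset.sum_mul_sum]
    refine Finset.sum_congr rfl fun i _ => Finset.sum_congr rfl fun j _ => ?_
    rw [smul_mul_assoc, smul_mul_smul_comm]
    congr 1
    ring
  rw [Finset.sum_congr rfl h1, Finset.sum_comm]
  have h2 : ∀ i ∈ Finset.range (l + 1), ∑ x ∈ Finset.HasAntidiagonal.antidiagonal l,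
      ∑ j ∈ Finset.range (l + 1), (((i.factorial : ℂ)⁻¹ * (j.factorial : ℂ)⁻¹) *
          (coeff x.1 ((-p) ^ i) * coeff x.2 (p ^ j))) • (T ^ i * D * T ^ j) =
      ∑ j ∈ Finset.range (l + 1), (((i.factorial : ℂ)⁻¹ * (j.factorial : ℂ)⁻¹) *
        ((-1) ^ i * coeff l (p ^ (i + j)))) • (T ^ i * D * T ^ j) := by
    intro i _
    rw [Finset.sum_comm]
    refine Finset.sum_congr rfl fun j _ => ?_
    rw [← Finset.sum_smul, ← Finset.mul_sum, ← coeff_mul, pow_add]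
    congr 2
    rw [neg_pow p i, mul_assoc, show ((-1 : PowerSeries ℂ)) ^ i = C ((-1 : ℂ) ^ i) by simp,
      coeff_C_mul]
  rw [Finset.sum_congr rfl h2, sum_square_eq_sum_antidiagonal]
  · refine Finset.sum_congr rfl fun n _ => ?_
    have hc : Commute (-LinearMap.mulLeft ℂ T : Module.End ℂ R) (LinearMap.mulRight ℂ T) :=
      LinearMap.ext fun x => by simp [mul_assoc]
    rw [sub_eq_neg_add, hc.add_pow', LinearMap.sum_apply, Finset.smul_sum]
    refine Finset.sum_congr rfl fun x hx => ?_
    have hx' : x.1 + x.2 = n := by simpa using hx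
    subst hx'
    have hm : -LinearMap.mulLeft ℂ T = LinearMap.mulLeft ℂ (-T) := by ext; simp
    rw [hm, LinearMap.pow_mulLeft, LinearMap.pow_mulRight, LinearMap.smul_apply]
    have h3 : (LinearMap.mulLeft ℂ ((-T) ^ x.1) * LinearMap.mulRight ℂ (T ^ x.2)) D
        = (-1 : ℂ) ^ x.1 • (T ^ x.1 * D * T ^ x.2) := by
      rcases Nat.even_or_odd x.1 with h | h <;> simp [h.neg_one_pow, h.neg_pow, mul_assoc]
    rw [h3, ← Nat.cast_smul_eq_nsmul ℂ, smul_smul, smul_smul, Nat.cast_add_choose]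
    congr 1
    have h4 : ((x.1 + x.2).factorial : ℂ) ≠ 0 := by exact_mod_cast (x.1 + x.2).factorial_ne_zero
    field_simp
  · intro i j hij
    rw [coeff_pow_eq_zero hp hij]
    simp

end Conjugation

end HitchinWitten

end


noncomputable section

namespace HitchinWitten

/-! ### The curvature of the connection, and commutators of second-order operators -/

theorem pair_frame_left {n : ℕ} (j : Fin n) (z : cartan n) : pair (frame j) z = z.1 j := by
  have hz : ∑ i, z.1 i = 0 := z.2
  simp only [pair, frame, sub_mul, Finset.sum_sub_distrib, ← Finset.mul_sum, hz]
  simp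

theorem pair_comm {n : ℕ} (x y : cartan n) : pair x y = pair y x := by
  simp only [pair, mul_comm]

theorem sum_smul_frame {n : ℕ} (x : cartan n) : ∑ j, pair x (frame j) • frame j = x := by
  have hx : ∑ i, x.1 i = 0 := x.2
  ext i
  simp only [pair_comm x, pair_frame_left]
  simp only [Submodule.coe_sum, Submodule.coe_smul, Finset.sum_apply,
    Pi.smul_apply, smul_eq_mul, frame, mul_sub, Finset.sum_sub_distrib, ← Finset.sum_mul, hx]
  simp

theorem omega_dir {n : ℕ} (a b : Fin 2) (u w : cartan n) :
    omega (dir a u) (dir b w) = omegaMat a b * pair u w := by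
  fin_cases a <;> fin_cases b <;> simp [omega, dir, omegaMat, pair]

theorem dir_smul {n : ℕ} (a : Fin 2) (c : ℝ) (u : cartan n) : dir a (c • u) = c • dir a u := by
  fin_cases a <;> simp [dir]

theorem dir_sum {n : ℕ} {ι : Type*} (s : Finset ι) (a : Fin 2) (u : ι → cartan n) :
    dir a (∑ j ∈ s, u j) = ∑ j ∈ s, dir a (u j) := by
  fin_cases a
  · simp [dir, Prod.ext_iff, Prod.fst_sum, Prod.snd_sum]
  · simp [dir, Prod.ext_iff, Prod.fst_sum, Prod.snd_sum]

theorem omega_add_right {n : ℕ} (v w u : Cover n) : omega v (w + u) = omega v w + omega v u := by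
  rw [omega_neg_swap, omega_add_left, omega_neg_swap w, omega_neg_swap u]
  ring

theorem omega_smul_right {n : ℕ} (c : ℝ) (v u : Cover n) : omega v (c • u) = c * omega v u := by
  rw [omega_neg_swap, omega_smul_left, omega_neg_swap u]
  ring

theorem cov_add_dir {n : ℕ} (k : ℕ) (u w : Cover n) : cov k (u + w) = cov k u + cov k w := by
  ext ψ v
  by_cases hv : v ∈ regular n
  · change _ = (cov k u ψ).fn v + (cov k w ψ).fn v
    rw [cov_apply k _ _ hv, cov_apply k _ _ hv, cov_apply k _ _ hv, map_add, omega_add_right]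
    push_cast
    ring
  · rw [SmoothFn.eq_zero _ hv, SmoothFn.eq_zero _ hv]

theorem cov_smul_dir {n : ℕ} (k : ℕ) (c : ℝ) (u : Cover n) : cov k (c • u) = (c : ℂ) • cov k u := by
  ext ψ v
  by_cases hv : v ∈ regular n
  · change _ = (c : ℂ) * (cov k u ψ).fn v
    rw [cov_apply k _ _ hv, cov_apply k _ _ hv, map_smul, omega_smul_right]
    push_cast
    rw [Complex.real_smul]
    ring
  · rw [SmoothFn.eq_zero _ hv, SmoothFn.eq_zero _ hv]

theorem cov_sum_dir {n : ℕ} (k : ℕ) {ι : Type*} (s : Finset ι) (u : ι → Cover n) :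
    cov k (∑ j ∈ s, u j) = ∑ j ∈ s, cov k (u j) := by
  classical
  induction s using Finset.induction_on with
  | empty =>
    have := cov_smul_dir (n := n) k 0 0
    simpa using this
  | insert a s ha ih => rw [Finset.sum_insert ha, Finset.sum_insert ha, cov_add_dir, ih]

/-- The curvature is `-ikω`. -/
theorem cov_commutator {n : ℕ} (k : ℕ) (u w : Cover n) :
    cov k u * cov k w - cov k w * cov k u = (-(Complex.I * k * omega u w)) • 1 := by
  ext ψ v
  by_cases hv : v ∈ regular n
  swap
  · rw [SmoothFn.eq_zero _ hv, SmoothFn.eq_zero _ hv]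
  have hψ : ContDiffAt ℝ ∞ ψ.fn v := ψ.contDiffOn.contDiffAt ((isOpen_regular n).mem_nhds hv)
  have hd : DifferentiableAt ℝ (fderiv ℝ ψ.fn) v :=
    (hψ.fderiv_right (m := ∞) (by simp)).differentiableAt (by simp)
  have hψd := smoothFn_differentiableAt ψ hv
  have key : ∀ u w : Cover n, (cov k u (cov k w ψ)).fn v =
      fderiv ℝ (fderiv ℝ ψ.fn) v u w
        - Complex.I * k / 2 * (omega u w * ψ.fn v + omega v w * fderiv ℝ ψ.fn v u)
        - Complex.I * k * ((omega v u / 2 : ℝ) : ℂ) *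
          (fderiv ℝ ψ.fn v w - Complex.I * k * ((omega v w / 2 : ℝ) : ℂ) * ψ.fn v) := by
    intro u w
    have h1 : (cov k w ψ).fn =ᶠ[nhds v] fun v => fderiv ℝ ψ.fn v w
        - Complex.I * k / 2 * (((omega v w : ℝ) : ℂ) * ψ.fn v) := by
      filter_upwards [(isOpen_regular n).mem_nhds hv] with x hx
      rw [cov_apply k w ψ hx]
      push_cast
      ring
    have h2 : HasFDerivAt (fun v => fderiv ℝ ψ.fn v w)
        ((fderiv ℝ (fderiv ℝ ψ.fn) v).flip w) v := by
      have := hd.hasFDerivAt.clm_apply (hasFDerivAt_const w v)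
      simpa using this
    have h3 : HasFDerivAt (fun v : Cover n => ((omega v w : ℝ) : ℂ))
        (Complex.ofRealCLM.comp (-omegaCLM w)) v := by
      have := (Complex.ofRealCLM.comp (-omegaCLM w)).hasFDerivAt (x := v)
      convert this using 1
      ext x
      simp [omegaCLM, omega_neg_swap x w]
    have h4 := h2.sub ((h3.mul hψd.hasFDerivAt).const_mul (Complex.I * k / 2))
    have h5 : fderiv ℝ (cov k w ψ).fn v u = fderiv ℝ (fderiv ℝ ψ.fn) v u w
        - Complex.I * k / 2 * (omega u w * ψ.fn v + omega v w * fderiv ℝ ψ.fn v u) := by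
      rw [h1.fderiv_eq]
      have := congrArg (fun L => L u) h4.fderiv
      refine Eq.trans this ?_
      simp [omegaCLM, omega_neg_swap u w]
      ring
    rw [cov_apply k u _ hv, h5, cov_apply k w ψ hv]
  -- In `key` the second derivative, the first-order terms taken together and the product of the two
  -- potentials are symmetric in u and w. Only the derivative of the potential, the term in ω(u, w),
  -- survives the difference.
  change (cov k u (cov k w ψ)).fn v - (cov k w (cov k u ψ)).fn v =
    (-(Complex.I * k * omega u w)) * ψ.fn v
  have h2 : (2 : WithTop ℕ∞) ≤ ∞ := WithTop.coe_le_coe.2 (le_top : (2 : ℕ∞) ≤ ⊤)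
  have hs : fderiv ℝ (fderiv ℝ ψ.fn) v u w = fderiv ℝ (fderiv ℝ ψ.fn) v w u :=
    (hψ.isSymmSndFDerivAt (by simpa using h2)).eq u w
  rw [key, key, hs, omega_neg_swap w u]
  push_cast
  ring

/-- The contraction of `∇²` over the Cartan subalgebra in the directions `a`, `b`. -/
def hessComp (n k : ℕ) (a b : Fin 2) : Module.End ℂ (SmoothFn n) :=
  ∑ j, cov k (dir a (frame j)) * cov k (dir b (frame j))

theorem hessFn_eq {n : ℕ} (k : ℕ) (G : Matrix (Fin 2) (Fin 2) ℂ) :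
    hessFn (n := n) k G = ∑ a, ∑ b, G a b • hessComp n k a b := rfl

/-- Each of the two factors contributes its curvature with the direction u. Summing over the frame
then recovers u, because the frame inverts the inner product. -/
theorem hessComp_commutator_cov (n k : ℕ) (a b c : Fin 2) (u : cartan n) :
    hessComp n k a b * cov k (dir c u) - cov k (dir c u) * hessComp n k a b =
      (-(Complex.I * k)) • ((omegaMat b c : ℂ) • cov k (dir a u)
        + (omegaMat a c : ℂ) • cov k (dir b u)) := by
  have h1 : ∀ a : Fin 2, cov k (dir a u) =
      ∑ j, ((pair u (frame j) : ℝ) : ℂ) • cov k (dir a (frame j)) := by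
    intro a
    conv_lhs => rw [← sum_smul_frame u, dir_sum, cov_sum_dir]
    simp only [dir_smul, cov_smul_dir]
  rw [h1 a, h1 b, hessComp, Finset.sum_mul, Finset.mul_sum, ← Finset.sum_sub_distrib,
    Finset.smul_sum, Finset.smul_sum, ← Finset.sum_add_distrib, Finset.smul_sum]
  refine Finset.sum_congr rfl fun j _ => ?_
  have h2 := cov_commutator k (dir a (frame j)) (dir c u)
  have h3 := cov_commutator k (dir b (frame j)) (dir c u)
  rw [omega_dir, pair_comm] at h2 h3
  set A := cov k (dir a (frame j))
  set B := cov k (dir b (frame j))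
  set U := cov k (dir c u)
  have h4 : A * B * U - U * (A * B) = A * (B * U - U * B) + (A * U - U * A) * B := by noncomm_ring
  rw [h4, h2, h3, mul_smul_comm, mul_one, smul_mul_assoc, one_mul]
  push_cast
  module

theorem hessComp_commutator (n k : ℕ) (a b c d : Fin 2) :
    hessComp n k a b * hessComp n k c d - hessComp n k c d * hessComp n k a b =
      (-(Complex.I * k)) • ((omegaMat b c : ℂ) • hessComp n k a d
        + (omegaMat a c : ℂ) • hessComp n k b d + (omegaMat b d : ℂ) • hessComp n k c a
        + (omegaMat a d : ℂ) • hessComp n k c b) := by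
  conv_lhs => rw [hessComp.eq_def n k c d]
  rw [Finset.mul_sum, Finset.sum_mul, ← Finset.sum_sub_distrib, hessComp.eq_def n k a d,
    hessComp.eq_def n k b d, hessComp.eq_def n k c a, hessComp.eq_def n k c b]
  simp only [Finset.smul_sum, ← Finset.sum_add_distrib]
  refine Finset.sum_congr rfl fun j _ => ?_
  have h2 := hessComp_commutator_cov n k a b c (frame j)
  have h3 := hessComp_commutator_cov n k a b d (frame j)
  set H := hessComp n k a b
  set U := cov k (dir c (frame j))
  set W := cov k (dir d (frame j))
  have h4 : H * (U * W) - U * W * H = U * (H * W - W * H) + (H * U - U * H) * W := by noncomm_ring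
  rw [h4, h2, h3]
  simp only [mul_smul_comm, mul_add, smul_mul_assoc, add_mul]
  module

/-- The curvature is a constant scalar, so two second-order operators commute to a second-order one.
Symmetry of G and antisymmetry of ω merge the four contractions into pairs; this explains the factor
2. -/
theorem hessFn_commutator {n : ℕ} (k : ℕ) (G H : Matrix (Fin 2) (Fin 2) ℂ) (hG : G 0 1 = G 1 0) :
    hessFn (n := n) k G * hessFn k H - hessFn k H * hessFn k G =
      (-(2 * Complex.I * k)) • hessFn k (G * omegaMat.map (fun r : ℝ => (r : ℂ)) * H
        - H * omegaMat.map (fun r : ℝ => (r : ℂ)) * G) := by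
  have h1 : hessFn (n := n) k G * hessFn k H - hessFn k H * hessFn k G =
      ∑ a, ∑ b, ∑ c, ∑ d, (G a b * H c d) • (hessComp n k a b * hessComp n k c d
        - hessComp n k c d * hessComp n k a b) := by
    simp only [hessFn_eq, Fin.sum_univ_two]
    simp only [add_mul, mul_add, smul_mul_smul_comm, smul_sub, mul_comm (H _ _)]
    abel
  rw [h1]
  simp only [hessComp_commutator, hessFn_eq, Fin.sum_univ_two, Matrix.sub_apply, Matrix.mul_apply,
    Matrix.map_apply]
  simp only [omegaMat, Matrix.smul_apply, Matrix.of_apply, Matrix.cons_val', Matrix.cons_val_zero,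
    Matrix.cons_val_one, Matrix.cons_val_fin_one, smul_eq_mul, hG]
  push_cast
  module

theorem hess_ext {n k : ℕ} {D D' : DiffOp n k} (h : ∀ ψ, (D.1 ψ).toFn = (D'.1 ψ).toFn) : D = D' :=
  Subtype.ext (LinearMap.ext fun ψ => Subtype.ext (h ψ))

/-- `hess` as a linear map. -/
def hessLin (n k : ℕ) : Matrix (Fin 2) (Fin 2) ℂ →ₗ[ℂ] DiffOp n k where
  toFun := hess n k
  map_add' G H := hess_ext fun ψ => by
    change hessFn k (G + H) ψ.toFn = hessFn k G ψ.toFn + hessFn k H ψ.toFn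
    rw [← LinearMap.add_apply]
    congr 1
    simp only [hessFn_eq, Matrix.add_apply, add_smul, Finset.sum_add_distrib]
  map_smul' c G := hess_ext fun ψ => by
    change hessFn k (c • G) ψ.toFn = c • hessFn k G ψ.toFn
    rw [← LinearMap.smul_apply]
    congr 1
    simp only [hessFn_eq, Matrix.smul_apply, smul_eq_mul, mul_smul, Finset.smul_sum]

theorem hessLin_apply (n k : ℕ) (G : Matrix (Fin 2) (Fin 2) ℂ) : hessLin n k G = hess n k G := rfl

theorem hess_commutator (n k : ℕ) (G H : Matrix (Fin 2) (Fin 2) ℂ) (hG : G 0 1 = G 1 0) :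
    hess n k G * hess n k H - hess n k H * hess n k G =
      (-(2 * Complex.I * k)) • hess n k (G * omegaMat.map (fun r : ℝ => (r : ℂ)) * H
        - H * omegaMat.map (fun r : ℝ => (r : ℂ)) * G) :=
  hess_ext fun ψ => congrArg (fun T => T ψ.toFn) (hessFn_commutator k G H hG)

end HitchinWitten

end


/-! ### Explicit Kähler structures, the commutators with Δ, and differentiation of families of
operators. -/

noncomputable section

namespace HitchinWitten

/-! ### The Kähler structures in coordinates -/

theorem invMetric_eq (z : ℂ) :
    invMetric z = (2 * Real.pi * z.im)⁻¹ • !![1, z.re; z.re, z.re ^ 2 + z.im ^ 2] := by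
  by_cases h : z.im = 0
  -- On the real axis both sides are zero by the conventions for inverses of zero and of singular
  -- matrices.
  · simp [invMetric, metric, complexStr, h]
  · refine Matrix.inv_eq_right_inv ?_
    have hp : Real.pi ≠ 0 := Real.pi_ne_zero
    have hn : ‖z‖ ^ 2 = z.re ^ 2 + z.im ^ 2 := by
      rw [Complex.sq_norm, Complex.normSq_apply]; ring
    ext i j
    fin_cases i <;> fin_cases j <;>
      simp [metric, complexStr, omegaMat, Matrix.mul_apply, Fin.sum_univ_two, hn] <;>
      field_simp <;> ring

/-- The direction of type `(1,0)`. -/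
def vecZ (τ : ℂ) : Fin 2 → ℂ := ![1, τ.re - Complex.I * τ.im]

/-- The direction of type `(0,1)`. -/
def vecZbar (τ : ℂ) : Fin 2 → ℂ := ![1, τ.re + Complex.I * τ.im]

theorem complexStr_apply (τ : ℂ) : (complexStr τ).map (fun r : ℝ => (r : ℂ)) =
    (τ.im : ℂ)⁻¹ • !![(τ.re : ℂ), -1; (τ.re : ℂ) ^ 2 + (τ.im : ℂ) ^ 2, -(τ.re : ℂ)] := by
  have hn : ‖τ‖ ^ 2 = τ.re ^ 2 + τ.im ^ 2 := by
    rw [Complex.sq_norm, Complex.normSq_apply]; ring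
  ext i j
  fin_cases i <;> fin_cases j <;> simp [complexStr]
  exact Or.inl (by exact_mod_cast hn)

theorem proj10_vecZ (τ : ℂ) (h : τ.im ≠ 0) : Matrix.mulVec (proj10 τ) (vecZ τ) = vecZ τ := by
  have hi : (τ.im : ℂ) ≠ 0 := by exact_mod_cast h
  have hI := Complex.I_sq
  ext i
  fin_cases i <;>
    simp [proj10, complexStr_apply, Matrix.mulVec, dotProduct, vecZ, Matrix.one_apply] <;>
    field_simp <;> ring_nf <;> simp [hI] <;> ring

theorem proj10_vecZbar (τ : ℂ) (h : τ.im ≠ 0) : Matrix.mulVec (proj10 τ) (vecZbar τ) = 0 := by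
  have hi : (τ.im : ℂ) ≠ 0 := by exact_mod_cast h
  have hI := Complex.I_sq
  ext i
  fin_cases i <;>
    simp [proj10, complexStr_apply, Matrix.mulVec, dotProduct, vecZbar, Matrix.one_apply] <;>
    field_simp <;> ring_nf <;> simp [hI]

theorem proj01_vecZ (τ : ℂ) (h : τ.im ≠ 0) : Matrix.mulVec (proj01 τ) (vecZ τ) = 0 := by
  have hi : (τ.im : ℂ) ≠ 0 := by exact_mod_cast h
  have hI := Complex.I_sq
  ext i
  fin_cases i <;>
    simp [proj01, complexStr_apply, Matrix.mulVec, dotProduct, vecZ, Matrix.one_apply] <;>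
    field_simp <;> ring_nf <;> simp [hI]

theorem proj01_vecZbar (τ : ℂ) (h : τ.im ≠ 0) :
    Matrix.mulVec (proj01 τ) (vecZbar τ) = vecZbar τ := by
  have hi : (τ.im : ℂ) ≠ 0 := by exact_mod_cast h
  have hI := Complex.I_sq
  ext i
  fin_cases i <;>
    simp [proj01, complexStr_apply, Matrix.mulVec, dotProduct, vecZbar, Matrix.one_apply] <;>
    field_simp <;> ring_nf <;> simp [hI] <;> ring

theorem hasLineDerivAt_invMetric (τ V : ℂ) (h : τ.im ≠ 0) (a b : Fin 2) :
    HasLineDerivAt ℝ (fun z : ℂ => invMetric z a b) ((2 * Real.pi * τ.im ^ 2)⁻¹ •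
      (!![-V.im, V.re * τ.im - V.im * τ.re; V.re * τ.im - V.im * τ.re,
        2 * V.re * τ.re * τ.im + V.im * (τ.im ^ 2 - τ.re ^ 2)] : Matrix (Fin 2) (Fin 2) ℝ) a b)
      τ V := by
  have hp : Real.pi ≠ 0 := Real.pi_ne_zero
  have hre : HasDerivAt (fun t : ℝ => (τ + t • V).re) V.re 0 := by
    have := ((hasDerivAt_id (0 : ℝ)).mul_const V.re).const_add τ.re
    simpa using this
  have him : HasDerivAt (fun t : ℝ => (τ + t • V).im) V.im 0 := by
    have := ((hasDerivAt_id (0 : ℝ)).mul_const V.im).const_add τ.im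
    simpa using this
  have h0 : (2 * Real.pi * (τ + (0 : ℝ) • V).im) ≠ 0 := by
    simpa using h
  have hinv := (him.const_mul (2 * Real.pi)).inv h0
  have hsq := (hre.pow 2).add (him.pow 2)
  unfold HasLineDerivAt
  simp only [invMetric_eq]
  fin_cases a <;> fin_cases b
  · simp only [Matrix.smul_apply, Matrix.of_apply, Matrix.cons_val', Matrix.cons_val_zero,
      Matrix.cons_val_fin_one, Fin.zero_eta, smul_eq_mul, mul_one]
    refine hinv.congr_deriv ?_
    simp
    field_simp
  · simp only [Matrix.smul_apply, Matrix.of_apply, Matrix.cons_val', Matrix.cons_val_zero,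
      Matrix.cons_val_one, Matrix.cons_val_fin_one, Fin.zero_eta, Fin.mk_one, smul_eq_mul]
    refine (hinv.mul hre).congr_deriv ?_
    simp
    field_simp
    ring
  · simp only [Matrix.smul_apply, Matrix.of_apply, Matrix.cons_val', Matrix.cons_val_zero,
      Matrix.cons_val_one, Matrix.cons_val_fin_one, Fin.zero_eta, Fin.mk_one, smul_eq_mul]
    refine (hinv.mul hre).congr_deriv ?_
    simp
    field_simp
    ring
  · simp only [Matrix.smul_apply, Matrix.of_apply, Matrix.cons_val',
      Matrix.cons_val_one, Matrix.cons_val_fin_one, Fin.mk_one, smul_eq_mul]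
    refine (hinv.mul hsq).congr_deriv ?_
    simp
    field_simp
    ring

/-- The coefficient of `G(V)`. -/
def coefB (τ V : ℂ) : ℂ := -(Complex.I * V / (4 * Real.pi * (τ.im : ℂ) ^ 2))

/-- The coefficient of `Ḡ(V)`. -/
def coefBbar (τ V : ℂ) : ℂ :=
  Complex.I * (V.re - Complex.I * V.im) / (4 * Real.pi * (τ.im : ℂ) ^ 2)

/-- With `vecZ` = (1, τ̄) and `vecZbar` = (1, τ), the tensor has no mixed term. This is what makes b
+ b̄ equal to the full second derivative contracted with G̃. -/
theorem Gtilde_eq (τ V : ℂ) (h : τ.im ≠ 0) : Gtilde τ V =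
    coefB τ V • Matrix.vecMulVec (vecZ τ) (vecZ τ)
      + coefBbar τ V • Matrix.vecMulVec (vecZbar τ) (vecZbar τ) := by
  have hp : (Real.pi : ℂ) ≠ 0 := by exact_mod_cast Real.pi_ne_zero
  have hi : (τ.im : ℂ) ≠ 0 := by exact_mod_cast h
  have hB' : coefB τ V = (V.im - Complex.I * V.re) / (4 * Real.pi * (τ.im : ℂ) ^ 2) := by
    rw [coefB, ← neg_div]
    congr 1
    conv_lhs => rw [← Complex.re_add_im V]
    linear_combination (-(V.im : ℂ)) * Complex.I_sq
  have hI := Complex.I_sq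
  ext a b
  rw [Gtilde, Matrix.of_apply, (hasLineDerivAt_invMetric τ V h a b).lineDeriv]
  fin_cases a <;> fin_cases b <;>
    simp [hB', coefBbar, vecZ, vecZbar] <;> field_simp <;> ring_nf <;>
    simp [hI, Complex.I_pow_three] <;> ring

theorem conj_vecMulVec (P : Matrix (Fin 2) (Fin 2) ℂ) (v : Fin 2 → ℂ) :
    P * Matrix.vecMulVec v v * P.transpose = Matrix.vecMulVec (P.mulVec v) (P.mulVec v) := by
  rw [Matrix.mul_vecMulVec, Matrix.vecMulVec_mul, Matrix.vecMul_transpose]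

theorem bForm_eq (n k : ℕ) (τ : UpperHalfPlane) (V : ℂ) : bForm n k τ V =
    coefB τ V • hess n k (Matrix.vecMulVec (vecZ τ) (vecZ τ)) := by
  have h : (τ : ℂ).im ≠ 0 := τ.im_pos.ne'
  rw [bForm, Gtilde_eq τ V h, mul_add, add_mul, mul_smul_comm, mul_smul_comm, smul_mul_assoc,
    smul_mul_assoc, conj_vecMulVec, conj_vecMulVec, proj10_vecZ _ h, proj10_vecZbar _ h,
    Matrix.zero_vecMulVec, smul_zero, add_zero, ← hessLin_apply, map_smul, hessLin_apply]

theorem bbarForm_eq (n k : ℕ) (τ : UpperHalfPlane) (V : ℂ) : bbarForm n k τ V =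
    coefBbar τ V • hess n k (Matrix.vecMulVec (vecZbar τ) (vecZbar τ)) := by
  have h : (τ : ℂ).im ≠ 0 := τ.im_pos.ne'
  rw [bbarForm, Gtilde_eq τ V h, mul_add, add_mul, mul_smul_comm, mul_smul_comm, smul_mul_assoc,
    smul_mul_assoc, conj_vecMulVec, conj_vecMulVec, proj01_vecZ _ h, proj01_vecZbar _ h,
    Matrix.zero_vecMulVec, smul_zero, zero_add, ← hessLin_apply, map_smul, hessLin_apply]

theorem bForm_add_bbarForm (n k : ℕ) (τ : UpperHalfPlane) (V : ℂ) :
    bForm n k τ V + bbarForm n k τ V = hess n k (Gtilde τ V) := by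
  rw [bForm_eq, bbarForm_eq, Gtilde_eq τ V τ.im_pos.ne']
  simp only [← hessLin_apply, map_add, map_smul]

theorem invMetric_map (z : ℂ) : (invMetric z).map (fun r : ℝ => (r : ℂ)) =
    (2 * Real.pi * (z.im : ℂ))⁻¹ • !![1, (z.re : ℂ); (z.re : ℂ), (z.re : ℂ) ^ 2 + (z.im : ℂ) ^ 2] := by
  rw [invMetric_eq]
  ext i j
  fin_cases i <;> fin_cases j <;> simp

theorem omegaMat_map : omegaMat.map (fun r : ℝ => (r : ℂ)) =
    !![0, 2 * (Real.pi : ℂ); -(2 * (Real.pi : ℂ)), 0] := by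
  ext i j
  fin_cases i <;> fin_cases j <;> simp [omegaMat]

theorem vecMulVec_vecZ (z : ℂ) : Matrix.vecMulVec (vecZ z) (vecZ z) =
    !![1, z.re - Complex.I * z.im; z.re - Complex.I * z.im, (z.re - Complex.I * z.im) ^ 2] := by
  ext i j
  fin_cases i <;> fin_cases j <;> simp [vecZ, sq]

theorem vecMulVec_vecZbar (z : ℂ) : Matrix.vecMulVec (vecZbar z) (vecZbar z) =
    !![1, z.re + Complex.I * z.im; z.re + Complex.I * z.im, (z.re + Complex.I * z.im) ^ 2] := by
  ext i j
  fin_cases i <;> fin_cases j <;> simp [vecZbar, sq]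

/-- From g = ΩJ one has g⁻¹Ω = -J, which acts on type (1,0) by -i; acting from the other side Ωg⁻¹
gives i. The difference is -2i, and the factor -2ik of the commutator turns it into -4k. -/
theorem invMetric_omega_vecZ (z : ℂ) (h : z.im ≠ 0) :
    (invMetric z).map (fun r : ℝ => (r : ℂ)) * omegaMat.map (fun r : ℝ => (r : ℂ)) *
      Matrix.vecMulVec (vecZ z) (vecZ z) - Matrix.vecMulVec (vecZ z) (vecZ z) *
      omegaMat.map (fun r : ℝ => (r : ℂ)) * (invMetric z).map (fun r : ℝ => (r : ℂ)) =
      (-(2 * Complex.I)) • Matrix.vecMulVec (vecZ z) (vecZ z) := by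
  have hp : (Real.pi : ℂ) ≠ 0 := by exact_mod_cast Real.pi_ne_zero
  have hi : (z.im : ℂ) ≠ 0 := by exact_mod_cast h
  have hI := Complex.I_sq
  rw [invMetric_map, omegaMat_map, vecMulVec_vecZ]
  simp only [Matrix.smul_mul, Matrix.mul_smul, Matrix.mul_fin_two]
  ext i j
  fin_cases i <;> fin_cases j <;> simp <;> field_simp <;> ring_nf <;>
    simp [hI, Complex.I_pow_three] <;> ring

theorem invMetric_omega_vecZbar (z : ℂ) (h : z.im ≠ 0) :
    (invMetric z).map (fun r : ℝ => (r : ℂ)) * omegaMat.map (fun r : ℝ => (r : ℂ)) *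
      Matrix.vecMulVec (vecZbar z) (vecZbar z) - Matrix.vecMulVec (vecZbar z) (vecZbar z) *
      omegaMat.map (fun r : ℝ => (r : ℂ)) * (invMetric z).map (fun r : ℝ => (r : ℂ)) =
      (2 * Complex.I) • Matrix.vecMulVec (vecZbar z) (vecZbar z) := by
  have hp : (Real.pi : ℂ) ≠ 0 := by exact_mod_cast Real.pi_ne_zero
  have hi : (z.im : ℂ) ≠ 0 := by exact_mod_cast h
  have hI := Complex.I_sq
  rw [invMetric_map, omegaMat_map, vecMulVec_vecZbar]
  simp only [Matrix.smul_mul, Matrix.mul_smul, Matrix.mul_fin_two]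
  ext i j
  fin_cases i <;> fin_cases j <;> simp <;> field_simp <;> ring_nf <;>
    simp [hI, Complex.I_pow_three] <;> ring

/-- Hence the operators in the b- and b̄-directions commute to a multiple of Δ, and the three span a
copy of sl₂. Only the proof of necessity uses this. -/
theorem vecZbar_omega_vecZ (z : ℂ) (h : z.im ≠ 0) :
    Matrix.vecMulVec (vecZbar z) (vecZbar z) * omegaMat.map (fun r : ℝ => (r : ℂ)) *
      Matrix.vecMulVec (vecZ z) (vecZ z) - Matrix.vecMulVec (vecZ z) (vecZ z) *
      omegaMat.map (fun r : ℝ => (r : ℂ)) * Matrix.vecMulVec (vecZbar z) (vecZbar z) =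
      (-(16 * Real.pi ^ 2 * Complex.I * z.im ^ 2)) • (invMetric z).map (fun r : ℝ => (r : ℂ)) := by
  have hp : (Real.pi : ℂ) ≠ 0 := by exact_mod_cast Real.pi_ne_zero
  have hi : (z.im : ℂ) ≠ 0 := by exact_mod_cast h
  rw [invMetric_map, omegaMat_map, vecMulVec_vecZ, vecMulVec_vecZbar]
  simp only [Matrix.mul_fin_two]
  ext i j
  fin_cases i <;> fin_cases j <;> simp <;> field_simp <;> ring_nf <;>
    simp [Complex.I_pow_three] <;> ring

theorem lap_commutator_vecZ (n k : ℕ) (τ : UpperHalfPlane) :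
    lap n k τ * hess n k (Matrix.vecMulVec (vecZ τ) (vecZ τ))
      - hess n k (Matrix.vecMulVec (vecZ τ) (vecZ τ)) * lap n k τ =
      (-(4 * k : ℂ)) • hess n k (Matrix.vecMulVec (vecZ τ) (vecZ τ)) := by
  rw [lap, hess_commutator _ _ _ _ (by rw [invMetric_map]; simp),
    invMetric_omega_vecZ _ τ.im_pos.ne', ← hessLin_apply, map_smul, smul_smul]
  congr 1
  linear_combination (4 * (k : ℂ)) * Complex.I_sq

theorem lap_commutator_vecZbar (n k : ℕ) (τ : UpperHalfPlane) :
    lap n k τ * hess n k (Matrix.vecMulVec (vecZbar τ) (vecZbar τ))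
      - hess n k (Matrix.vecMulVec (vecZbar τ) (vecZbar τ)) * lap n k τ =
      (4 * k : ℂ) • hess n k (Matrix.vecMulVec (vecZbar τ) (vecZbar τ)) := by
  rw [lap, hess_commutator _ _ _ _ (by rw [invMetric_map]; simp),
    invMetric_omega_vecZbar _ τ.im_pos.ne', ← hessLin_apply, map_smul, smul_smul]
  congr 1
  linear_combination (-(4 * (k : ℂ))) * Complex.I_sq

theorem lap_commutator_bForm (n k : ℕ) (τ : UpperHalfPlane) (V : ℂ) :
    lap n k τ * bForm n k τ V - bForm n k τ V * lap n k τ = (-(4 * k : ℂ)) • bForm n k τ V := by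
  rw [bForm_eq, mul_smul_comm, smul_mul_assoc, ← smul_sub, lap_commutator_vecZ, smul_comm]

theorem lap_commutator_bbarForm (n k : ℕ) (τ : UpperHalfPlane) (V : ℂ) :
    lap n k τ * bbarForm n k τ V - bbarForm n k τ V * lap n k τ
      = (4 * k : ℂ) • bbarForm n k τ V := by
  rw [bbarForm_eq, mul_smul_comm, smul_mul_assoc, ← smul_sub, lap_commutator_vecZbar, smul_comm]

/-! ### Families of operators spanned by finitely many fixed ones -/

/-- `D` is a combination of finitely many fixed operators with smooth coefficients, and `D'` is
its derivative. -/
def FamDeriv {n k : ℕ} (D : UpperHalfPlane → DiffOp n k)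
    (D' : UpperHalfPlane → ℂ → DiffOp n k) : Prop :=
  ∃ (ι : Type) (_ : Fintype ι) (f : ι → ℂ → ℂ) (E : ι → DiffOp n k),
    (∀ i, ContDiffOn ℝ ∞ (f i) {z : ℂ | 0 < z.im}) ∧ (∀ τ, D τ = ∑ i, f i τ • E i) ∧
    ∀ τ V, D' τ V = ∑ i, lineDeriv ℝ (f i) τ V • E i

theorem isOpen_im_pos : IsOpen {z : ℂ | 0 < z.im} := isOpen_lt continuous_const Complex.continuous_im

theorem differentiableAt_of_contDiffOn {f : ℂ → ℂ} (hf : ContDiffOn ℝ ∞ f {z : ℂ | 0 < z.im})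
    (τ : UpperHalfPlane) : DifferentiableAt ℝ f τ :=
  (hf.contDiffAt (isOpen_im_pos.mem_nhds τ.im_pos)).differentiableAt (by simp)

variable {n k : ℕ}

theorem FamDeriv.const (D : DiffOp n k) : FamDeriv (fun _ => D) fun _ _ => 0 :=
  ⟨Unit, inferInstance, fun _ _ => 1, fun _ => D, fun _ => contDiffOn_const, by simp,
    fun τ V => by simp [lineDeriv]⟩

theorem FamDeriv.add {A B : UpperHalfPlane → DiffOp n k} {A' B' : UpperHalfPlane → ℂ → DiffOp n k}
    (hA : FamDeriv A A') (hB : FamDeriv B B') :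
    FamDeriv (fun τ => A τ + B τ) fun τ V => A' τ V + B' τ V := by
  obtain ⟨ι, _, f, E, h1, h2, h3⟩ := hA
  obtain ⟨κ, _, g, F, h4, h5, h6⟩ := hB
  refine ⟨ι ⊕ κ, inferInstance, Sum.elim f g, Sum.elim E F, ?_, ?_, ?_⟩
  · rintro (i | i)
    · exact h1 i
    · exact h4 i
  · intro τ
    simp [Fintype.sum_sum_type, h2, h5]
  · intro τ V
    simp [Fintype.sum_sum_type, h3, h6]

theorem FamDeriv.smul {A : UpperHalfPlane → DiffOp n k} {A' : UpperHalfPlane → ℂ → DiffOp n k}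
    (hA : FamDeriv A A') (c : ℂ) : FamDeriv (fun τ => c • A τ) fun τ V => c • A' τ V := by
  obtain ⟨ι, _, f, E, h1, h2, h3⟩ := hA
  refine ⟨ι, inferInstance, f, fun i => c • E i, h1, fun τ => ?_, fun τ V => ?_⟩
  · simp only [h2, Finset.smul_sum, smul_comm c]
  · simp only [h3, Finset.smul_sum, smul_comm c]

theorem FamDeriv.sum {ι : Type*} (s : Finset ι) {A : ι → UpperHalfPlane → DiffOp n k}
    {A' : ι → UpperHalfPlane → ℂ → DiffOp n k} (h : ∀ i, FamDeriv (A i) (A' i)) :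
    FamDeriv (fun τ => ∑ i ∈ s, A i τ) fun τ V => ∑ i ∈ s, A' i τ V := by
  classical
  induction s using Finset.induction_on with
  | empty => simpa using FamDeriv.const (0 : DiffOp n k)
  | insert a s ha ih => simpa [Finset.sum_insert ha] using (h a).add ih

/-- The reason for working with `FamDeriv`: it satisfies the product rule, whereas `HasOpDeriv` is
pointwise on fixed sections and does not control compositions. It applies since every Δ lies in the
span of four fixed operators. -/
theorem FamDeriv.mul {A B : UpperHalfPlane → DiffOp n k} {A' B' : UpperHalfPlane → ℂ → DiffOp n k}
    (hA : FamDeriv A A') (hB : FamDeriv B B') :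
    FamDeriv (fun τ => A τ * B τ) fun τ V => A' τ V * B τ + A τ * B' τ V := by
  obtain ⟨ι, _, f, E, h1, h2, h3⟩ := hA
  obtain ⟨κ, _, g, F, h4, h5, h6⟩ := hB
  refine ⟨ι × κ, inferInstance, fun i z => f i.1 z * g i.2 z, fun i => E i.1 * F i.2, ?_, ?_, ?_⟩
  · exact fun i => (h1 i.1).mul (h4 i.2)
  · intro τ
    simp only [h2, h5, Finset.sum_mul_sum, smul_mul_smul_comm, Fintype.sum_prod_type]
  · intro τ V
    simp only [h2, h3, h5, h6, Finset.sum_mul_sum, smul_mul_smul_comm, Fintype.sum_prod_type,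
      ← Finset.sum_add_distrib, ← add_smul]
    refine Finset.sum_congr rfl fun i _ => Finset.sum_congr rfl fun j _ => ?_
    congr 1
    have hf := differentiableAt_of_contDiffOn (h1 i) τ
    have hg := differentiableAt_of_contDiffOn (h4 j) τ
    rw [(hf.fun_mul hg).lineDeriv_eq_fderiv, hf.lineDeriv_eq_fderiv, hg.lineDeriv_eq_fderiv,
      fderiv_fun_mul hf hg]
    simp
    ring

theorem FamDeriv.commOp {A B : UpperHalfPlane → DiffOp n k}
    {A' B' : UpperHalfPlane → ℂ → DiffOp n k} (hA : FamDeriv A A') (hB : FamDeriv B B') :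
    FamDeriv (fun τ => commOp (A τ) (B τ))
      fun τ V => HitchinWitten.commOp (A' τ V) (B τ) + HitchinWitten.commOp (A τ) (B' τ V) := by
  have h := (hA.mul hB).add ((hB.mul hA).smul (-1))
  convert h using 1
  · funext τ
    simp [HitchinWitten.commOp, sub_eq_add_neg]
  · funext τ V
    simp only [HitchinWitten.commOp, LinearMap.sub_apply, LinearMap.mulLeft_apply,
      LinearMap.mulRight_apply]
    module

/-- The value at `v` of the operator applied to `ψ`. -/
def evalOp (ψ : Sec n k) (v : Cover n) : DiffOp n k →ₗ[ℂ] ℂ where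
  toFun D := (D.1 ψ).toFn.fn v
  map_add' _ _ := rfl
  map_smul' _ _ := rfl

theorem FamDeriv.smoothFamily {D : UpperHalfPlane → DiffOp n k}
    {D' : UpperHalfPlane → ℂ → DiffOp n k} (h : FamDeriv D D') : SmoothFamily D := by
  obtain ⟨ι, _, f, E, h1, h2, -⟩ := h
  intro ψ
  have h3 : ContDiffOn ℝ ∞ (fun p : ℂ × Cover n => ∑ i, f i p.1 * ((E i).1 ψ).toFn.fn p.2)
      ({z : ℂ | 0 < z.im} ×ˢ regular n) := by
    refine ContDiffOn.sum fun i _ => ?_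
    exact ((h1 i).comp contDiffOn_fst fun p hp => hp.1).mul
      (((E i).1 ψ).toFn.contDiffOn.comp contDiffOn_snd fun p hp => hp.2)
  refine h3.congr fun p hp => ?_
  change evalOp ψ p.2 (D (UpperHalfPlane.ofComplex p.1)) = ∑ i, f i p.1 * evalOp ψ p.2 (E i)
  rw [h2, map_sum]
  refine Finset.sum_congr rfl fun i _ => ?_
  rw [map_smul, smul_eq_mul, UpperHalfPlane.ofComplex_apply_of_im_pos hp.1]

theorem FamDeriv.hasOpDeriv {D : UpperHalfPlane → DiffOp n k}
    {D' : UpperHalfPlane → ℂ → DiffOp n k} (h : FamDeriv D D') (τ : UpperHalfPlane) (V : ℂ) :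
    HasOpDeriv D τ V (D' τ V) := by
  obtain ⟨ι, _, f, E, h1, h2, h3⟩ := h
  intro ψ v _
  change HasLineDerivAt ℝ (fun z : ℂ => evalOp ψ v (D (UpperHalfPlane.ofComplex z)))
    (evalOp ψ v (D' τ V)) τ V
  have h4 : HasFDerivAt (fun z : ℂ => ∑ i, f i z * evalOp ψ v (E i))
      (∑ i, evalOp ψ v (E i) • fderiv ℝ (f i) τ) (τ : ℂ) :=
    HasFDerivAt.fun_sum fun i _ =>
      (differentiableAt_of_contDiffOn (h1 i) τ).hasFDerivAt.mul_const _
  have h5 := h4.hasLineDerivAt V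
  have h6 : (∑ i, evalOp ψ v (E i) • fderiv ℝ (f i) τ) V = evalOp ψ v (D' τ V) := by
    rw [h3, map_sum, sum_apply]
    refine Finset.sum_congr rfl fun i _ => ?_
    rw [map_smul, (differentiableAt_of_contDiffOn (h1 i) τ).lineDeriv_eq_fderiv]
    simp [mul_comm]
  rw [h6] at h5
  refine h5.congr_of_eventuallyEq ?_
  filter_upwards [isOpen_im_pos.mem_nhds τ.im_pos] with z hz
  rw [h2, map_sum]
  refine Finset.sum_congr rfl fun i _ => ?_
  rw [map_smul, smul_eq_mul, UpperHalfPlane.ofComplex_apply_of_im_pos hz]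

theorem HasOpDeriv.unique {D : UpperHalfPlane → DiffOp n k} {τ : UpperHalfPlane} {V : ℂ}
    {A B : DiffOp n k} (hA : HasOpDeriv D τ V A) (hB : HasOpDeriv D τ V B) : A = B := by
  refine Subtype.ext (LinearMap.ext fun ψ => Sec.ext fun v => ?_)
  by_cases hv : v ∈ regular n
  · exact HasDerivAt.unique (hA ψ v hv) (hB ψ v hv)
  · rw [SmoothFn.eq_zero _ hv, SmoothFn.eq_zero _ hv]

theorem contDiffOn_invMetric (a b : Fin 2) :
    ContDiffOn ℝ ∞ (fun z : ℂ => invMetric z a b) {z : ℂ | 0 < z.im} := by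
  have hre : ContDiff ℝ ∞ fun z : ℂ => z.re := Complex.reCLM.contDiff
  have him : ContDiff ℝ ∞ fun z : ℂ => z.im := Complex.imCLM.contDiff
  have hinv : ContDiffOn ℝ ∞ (fun z : ℂ => (2 * Real.pi * z.im)⁻¹) {z : ℂ | 0 < z.im} :=
    (contDiff_const.mul him).contDiffOn.inv fun z hz =>
      mul_ne_zero (by simp [Real.pi_ne_zero]) (ne_of_gt hz)
  have h : ContDiff ℝ ∞ fun z : ℂ =>
      (!![1, z.re; z.re, z.re ^ 2 + z.im ^ 2] : Matrix (Fin 2) (Fin 2) ℝ) a b := by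
    fin_cases a <;> fin_cases b
    · exact contDiff_const
    · exact hre
    · exact hre
    · exact (hre.pow 2).add (him.pow 2)
  simp only [invMetric_eq, Matrix.smul_apply, smul_eq_mul]
  exact hinv.mul h.contDiffOn

theorem hess_eq_sum (G : Matrix (Fin 2) (Fin 2) ℂ) :
    hess n k G = ∑ i : Fin 2 × Fin 2, G i.1 i.2 • hess n k (Matrix.single i.1 i.2 1) := by
  conv_lhs => rw [← hessLin_apply, Matrix.matrix_eq_sum_single G, map_sum]
  rw [Fintype.sum_prod_type]
  refine Finset.sum_congr rfl fun i _ => ?_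
  rw [map_sum]
  refine Finset.sum_congr rfl fun j _ => ?_
  rw [← hessLin_apply, ← map_smul, Matrix.smul_single, smul_eq_mul, mul_one]

/-- `V[Δ] = -(b(V) + b̄(V))`. -/
theorem famDeriv_lap : FamDeriv (lap n k) fun τ V => -(bForm n k τ V + bbarForm n k τ V) := by
  refine ⟨Fin 2 × Fin 2, inferInstance, fun i z => (invMetric z i.1 i.2 : ℂ),
    fun i => hess n k (Matrix.single i.1 i.2 1), ?_, ?_, ?_⟩
  · exact fun i => Complex.ofRealCLM.contDiff.comp_contDiffOn (contDiffOn_invMetric i.1 i.2)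
  · exact fun τ => hess_eq_sum _
  · intro τ V
    beta_reduce
    rw [bForm_add_bbarForm, hess_eq_sum, ← Finset.sum_neg_distrib]
    refine Finset.sum_congr rfl fun i _ => ?_
    rw [← neg_smul]
    congr 1
    obtain ⟨a, b⟩ := i
    have h := hasLineDerivAt_invMetric τ V τ.im_pos.ne' a b
    have h2 : HasLineDerivAt ℝ (fun z : ℂ => (invMetric z a b : ℂ))
        ((lineDeriv ℝ (fun z : ℂ => invMetric z a b) τ V : ℝ) : ℂ) τ V := by
      rw [h.lineDeriv]
      exact HasDerivAt.ofReal_comp h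
    rw [h2.lineDeriv, Gtilde, Matrix.of_apply]
    push_cast
    ring

end HitchinWitten

end


/-! ### Parallel transport: the ansatz, exp(rΔ), and the formal series. -/

noncomputable section

namespace HitchinWitten

open PowerSeries

variable {n k : ℕ}

/-! ### The covariant derivative of the ansatz -/

theorem commOp_apply (T D : DiffOp n k) : commOp T D = T * D - D * T := rfl

theorem commOp_add (T T' : DiffOp n k) : commOp (T + T') = commOp T + commOp T' := by
  ext1 D
  simp only [commOp_apply, LinearMap.add_apply, add_mul, mul_add]
  abel

theorem commOp_smul (c : ℂ) (T : DiffOp n k) : commOp (c • T) = c • commOp T := by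
  ext1 D
  simp only [commOp_apply, LinearMap.smul_apply, smul_mul_assoc, mul_smul_comm, smul_sub]

theorem commOp_sub (T T' : DiffOp n k) : commOp (T - T') = commOp T - commOp T' := by
  ext1 D
  simp only [commOp_apply, LinearMap.sub_apply, sub_mul, mul_sub]
  abel

theorem commOp_leibniz (a b D : DiffOp n k) :
    commOp a (commOp b D) = commOp (commOp a b) D + commOp b (commOp a D) := by
  simp only [commOp_apply, sub_mul, mul_sub, mul_assoc]
  abel

theorem commOp_aOp_bForm (τ : UpperHalfPlane) (V : ℂ) :
    commOp (aOp n k τ) (bForm n k τ V) = (1 * 2 * Complex.I * k) • bForm n k τ V := by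
  rw [aOp, commOp_smul, LinearMap.smul_apply, commOp_apply, lap_commutator_bForm, smul_smul]
  congr 1
  ring

theorem commOp_aOp_bbarForm (τ : UpperHalfPlane) (V : ℂ) :
    commOp (aOp n k τ) (bbarForm n k τ V) = (-1 * 2 * Complex.I * k) • bbarForm n k τ V := by
  rw [aOp, commOp_smul, LinearMap.smul_apply, commOp_apply, lap_commutator_bbarForm, smul_smul]
  congr 1
  ring

theorem famDeriv_aOp : FamDeriv (aOp n k)
    fun τ V => (Complex.I / 2) • (bForm n k τ V + bbarForm n k τ V) := by
  have h := (famDeriv_lap (n := n) (k := k)).smul (-(Complex.I / 2))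
  have e : (fun (τ : UpperHalfPlane) (V : ℂ) =>
      (Complex.I / 2) • (bForm n k τ V + bbarForm n k τ V)) =
      fun τ V => (-(Complex.I / 2)) • (-(bForm n k τ V + bbarForm n k τ V)) := by
    funext τ V
    module
  rw [e]
  exact h

/-- The derivative of `ad_aᵖ` in the direction `b` of `a`. -/
def adPowDeriv (a b D : DiffOp n k) : ℕ → DiffOp n k
  | 0 => 0
  | p + 1 => commOp b ((commOp a ^ p) D) + commOp a (adPowDeriv a b D p)

theorem famDeriv_adPow (D : DiffOp n k) (p : ℕ) : FamDeriv (fun τ => (commOp (aOp n k τ) ^ p) D)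
    fun τ V => (Complex.I / 2) • (adPowDeriv (aOp n k τ) (bForm n k τ V) D p
      + adPowDeriv (aOp n k τ) (bbarForm n k τ V) D p) := by
  induction p with
  | zero => simpa [adPowDeriv] using FamDeriv.const D
  | succ p ih =>
    have h := famDeriv_aOp.commOp ih
    have e : (fun τ => (commOp (aOp n k τ) ^ (p + 1)) D) =
        fun τ => commOp (aOp n k τ) ((commOp (aOp n k τ) ^ p) D) := by
      funext τ
      rw [pow_succ', Module.End.mul_apply]
    rw [e]
    convert h using 1
    funext τ V
    simp only [adPowDeriv, commOp_smul, commOp_add, LinearMap.smul_apply, LinearMap.add_apply,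
      map_smul, map_add]
    module

/-- The shift lemma with L = ad_a, Y_q = [b, ad_a^q D] and β = 2εik: by Jacobi, ad_a Y_q = βY_q +
Y_{q+1}. The prefactor is (i/2)/β = ε/(4k). -/
theorem adPowDeriv_factorial (hk : 1 ≤ k) (a b D : DiffOp n k) (ε : ℂ) (hε : ε ^ 2 = 1)
    (hab : commOp a b = (ε * 2 * Complex.I * k) • b) (p : ℕ) :
    (Complex.I / 2) • ((p.factorial : ℂ)⁻¹ • adPowDeriv a b D p) = (1 / (2 * k) : ℂ) • ε •
      (1 / 2 : ℂ) • (∑ x ∈ Finset.HasAntidiagonal.antidiagonal p,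
        ((ε * 2 * Complex.I * k) ^ x.1 / x.1.factorial) •
          commOp b ((x.2.factorial : ℂ)⁻¹ • (commOp a ^ x.2) D)
        - commOp b ((p.factorial : ℂ)⁻¹ • (commOp a ^ p) D)) := by
  have hk' : (k : ℂ) ≠ 0 := by exact_mod_cast (by omega : k ≠ 0)
  have h := shift_sum_factorial (commOp a) (fun q => commOp b ((commOp a ^ q) D))
    (adPowDeriv a b D) (ε * 2 * Complex.I * k) (fun q => by
      rw [commOp_leibniz, hab, commOp_smul, pow_succ', Module.End.mul_apply]
      rfl) rfl (fun _ => rfl) p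
  simp only [map_smul]
  rw [← h]
  simp only [smul_smul]
  congr 1
  field_simp
  linear_combination (-(p.factorial : ℂ)⁻¹) * hε

theorem commOp_ansatz (c : ℕ → ℕ → ℂ) (l : ℕ) (τ : UpperHalfPlane) (b D : DiffOp n k) :
    commOp b (ansatz n k c l τ D) =
      ∑ r ∈ Finset.range (l + 1), c r l • commOp b (adPow n k (l - r) τ D) := by
  rw [ansatz, LinearMap.sum_apply, map_sum]
  exact Finset.sum_congr rfl fun r _ => by rw [LinearMap.smul_apply, map_smul]

/-- The first summand is what parallelism demands. The second is the defect; it is linear in the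
numbers `numE`, so that the operator equation is reduced to the numeric one. -/
theorem famDeriv_ansatz (hk : 1 ≤ k) (c : ℕ → ℕ → ℂ) (l : ℕ) (D : DiffOp n k) :
    FamDeriv (fun τ => ansatz n k c l τ D) fun τ V =>
      (1 / (2 * k) : ℂ) • (∑ m ∈ Finset.Icc 1 l, (Complex.I * k) ^ m •
        commOp (bForm n k τ V - (-1 : ℂ) ^ m • bbarForm n k τ V) (ansatz n k c (l - m) τ D)) +
      (1 / (2 * k) : ℂ) • (∑ j ∈ Finset.range (l + 1),
          numE k 1 c (l - j) l • commOp (bForm n k τ V) (adPow n k j τ D) -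
        ∑ j ∈ Finset.range (l + 1),
          numE k (-1) c (l - j) l • commOp (bbarForm n k τ V) (adPow n k j τ D)) := by
  have h := FamDeriv.sum (Finset.range (l + 1)) fun r =>
    ((famDeriv_adPow (n := n) (k := k) D (l - r)).smul ((l - r).factorial : ℂ)⁻¹).smul (c r l)
  convert h using 1
  · funext τ
    simp only [ansatz, LinearMap.sum_apply, LinearMap.smul_apply, adPow]
  · funext τ V
    have h1 := fun r => adPowDeriv_factorial hk (aOp n k τ) (bForm n k τ V) D 1 (by norm_num)
      (commOp_aOp_bForm τ V) (l - r)
    have h2 := fun r => adPowDeriv_factorial hk (aOp n k τ) (bbarForm n k τ V) D (-1) (by norm_num)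
      (commOp_aOp_bbarForm τ V) (l - r)
    have h3 : ∀ r, c r l • ((l - r).factorial : ℂ)⁻¹ • (Complex.I / 2) •
        (adPowDeriv (aOp n k τ) (bForm n k τ V) D (l - r)
          + adPowDeriv (aOp n k τ) (bbarForm n k τ V) D (l - r)) =
        c r l • ((Complex.I / 2) • (((l - r).factorial : ℂ)⁻¹ •
          adPowDeriv (aOp n k τ) (bForm n k τ V) D (l - r)) +
          (Complex.I / 2) • (((l - r).factorial : ℂ)⁻¹ •
          adPowDeriv (aOp n k τ) (bbarForm n k τ V) D (l - r))) := by
      intro r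
      module
    simp only [h3, h1, h2]
    have e1 := sum_numE k 1 c (fun j => commOp (bForm n k τ V) (adPow n k j τ D)) l
    have e2 := sum_numE k (-1) c (fun j => commOp (bbarForm n k τ V) (adPow n k j τ D)) l
    rw [← e1, ← e2]
    have h4 : ∀ m, (Complex.I * k) ^ m •
        commOp (bForm n k τ V - (-1 : ℂ) ^ m • bbarForm n k τ V) (ansatz n k c (l - m) τ D) =
        (1 * Complex.I * k) ^ m • ∑ r ∈ Finset.range (l - m + 1),
          c r (l - m) • commOp (bForm n k τ V) (adPow n k (l - m - r) τ D) -
        (-1 * Complex.I * k) ^ m • ∑ r ∈ Finset.range (l - m + 1),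
          c r (l - m) • commOp (bbarForm n k τ V) (adPow n k (l - m - r) τ D) := by
      intro m
      rw [commOp_sub, commOp_smul, LinearMap.sub_apply, LinearMap.smul_apply, commOp_ansatz,
        commOp_ansatz, one_mul, mul_assoc (-1 : ℂ), mul_pow (-1 : ℂ)]
      module
    simp only [h4, Finset.sum_sub_distrib, smul_add, Finset.sum_add_distrib]
    simp only [adPow, LinearMap.smul_apply]
    simp only [smul_comm (c _ l) (1 / (2 * k) : ℂ), smul_comm (c _ l) (1 : ℂ),
      smul_comm (c _ l) (-1 : ℂ), smul_comm (c _ l) (1 / 2 : ℂ), ← Finset.smul_sum]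
    module

theorem ansatz_isTrivialisation (hk : 1 ≤ k) {c : ℕ → ℕ → ℂ} (h0 : c 0 0 = 1) (h : NumRec k c) :
    IsTrivialisation (ansatz n k c) where
  zero τ D := by simp [ansatz, adPow, h0]
  smooth l D := (famDeriv_ansatz hk c l D).smoothFamily
  parallel D τ V l := by
    have hE : ∀ (ε : ℂ), ε = 1 ∨ ε = -1 → ∀ j, numE k ε c (l - j) l = 0 := by
      intro ε hε j
      -- The term j = l has m = 0, outside the range of the recursion; there `numE` is an empty sum.
      rcases Nat.eq_zero_or_pos (l - j) with hj | hj
      · rw [hj]; simp [numE]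
      · rcases hε with rfl | rfl
        · exact (h _ _ hj (Nat.sub_le _ _)).1
        · exact (h _ _ hj (Nat.sub_le _ _)).2
    have := (famDeriv_ansatz (n := n) hk c l D).hasOpDeriv τ V
    simp only [hE 1 (Or.inl rfl), hE (-1) (Or.inr rfl), zero_smul, Finset.sum_const_zero, sub_zero,
      smul_zero, add_zero] at this
    simpa using this

/-- Derivatives of families are unique, so for a trivialisation the defect vanishes for every D, τ
and V. The proof of necessity starts here. -/
theorem sum_numE_eq_zero (hk : 1 ≤ k) {c : ℕ → ℕ → ℂ} (h : IsTrivialisation (ansatz n k c))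
    (l : ℕ) (D : DiffOp n k) (τ : UpperHalfPlane) (V : ℂ) :
    ∑ j ∈ Finset.range (l + 1), numE k 1 c (l - j) l • commOp (bForm n k τ V) (adPow n k j τ D) =
      ∑ j ∈ Finset.range (l + 1),
        numE k (-1) c (l - j) l • commOp (bbarForm n k τ V) (adPow n k j τ D) := by
  have hk' : (k : ℂ) ≠ 0 := by exact_mod_cast (by omega : k ≠ 0)
  have h1 := (famDeriv_ansatz (n := n) hk c l D).hasOpDeriv τ V
  have h2 := h1.unique (h.parallel D τ V l)
  rw [Pi.zero_apply, zero_add, add_eq_left] at h2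
  exact sub_eq_zero.1 ((smul_eq_zero.1 h2).resolve_left (by simp [hk']))

/-! ### The explicit trivialisation -/

theorem scalarSeries_eq (p : PowerSeries ℂ) :
    scalarSeries n k p = PowerSeries.map (algebraMap ℂ (DiffOp n k)) p := rfl

theorem coeff_expLap (τ : UpperHalfPlane) (l : ℕ) : coeff l (expLap n k τ) =
    ∑ j ∈ Finset.range (l + 1), ((j.factorial : ℂ)⁻¹ * coeff l (rSeries k ^ j)) • lap n k τ ^ j :=
  coeff_formalExp_scalar (constantCoeff_rSeries k) _ le_rfl

theorem neg_mul_add_mul_neg {R : Type*} [Ring R] (x y z w : R) :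
    -x * y + z * -w = -(x * y + z * w) := by
  rw [neg_mul, mul_neg, neg_add]

/-- The derivative of `Δʲ` in the direction `b` of `Δ`. -/
def powDeriv (T b : DiffOp n k) : ℕ → DiffOp n k
  | 0 => 0
  | p + 1 => T ^ p * b + powDeriv T b p * T

theorem famDeriv_lap_pow (p : ℕ) : FamDeriv (fun τ => lap n k τ ^ p)
    fun τ V => -(powDeriv (lap n k τ) (bForm n k τ V) p
      + powDeriv (lap n k τ) (bbarForm n k τ V) p) := by
  induction p with
  | zero => simpa [powDeriv] using FamDeriv.const (1 : DiffOp n k)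
  | succ p ih =>
    have h := ih.mul famDeriv_lap
    simp only [← pow_succ] at h
    convert h using 1
    funext τ V
    refine Eq.trans ?_ (neg_mul_add_mul_neg _ _ _ _).symm
    refine congrArg (fun x => -x) ?_
    simp only [powDeriv, add_mul, mul_add]
    abel

/-- The shift lemma again, for L = right multiplication by T, Y_q = T^q b and β = 4εk. Summed
against rʲ/j! the binomial sum factors as exp(rT) · (e^{βr} - 1)/β · b, and (e^{βr} - 1)/β is -ε/2
times `invT`. -/
theorem powDeriv_factorial (hk : 1 ≤ k) (T b : DiffOp n k) (ε : ℂ) (hε : ε ^ 2 = 1)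
    (hab : T * b - b * T = (-(ε * 4 * k)) • b) (l : ℕ) :
    ∑ j ∈ Finset.range (l + 1),
      ((j.factorial : ℂ)⁻¹ * coeff l (rSeries k ^ j)) • powDeriv T b j =
      -(ε • ∑ q ∈ Finset.range (l + 1), ((q.factorial : ℂ)⁻¹ *
        coeff l (rSeries k ^ q * (C (1 / 2 : ℂ) * invT k ε))) • (T ^ q * b)) := by
  have hk' : (k : ℂ) ≠ 0 := by exact_mod_cast (by omega : k ≠ 0)
  have hε0 : ε ≠ 0 := by rintro rfl; norm_num at hε
  have hu : constantCoeff (C (ε * 4 * k) * rSeries k) = 0 := by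
    rw [map_mul, constantCoeff_rSeries, mul_zero]
  have hβ : ε * 4 * k ≠ 0 := mul_ne_zero (mul_ne_zero hε0 (by norm_num)) hk'
  have h := shift_sum_factorial (LinearMap.mulRight ℂ T) (fun q => T ^ q * b) (powDeriv T b)
    (ε * 4 * k) (fun q => by
      rw [LinearMap.mulRight_apply]
      have : b * T = T * b + (ε * 4 * k) • b := by
        rw [neg_smul] at hab
        rw [← sub_eq_zero]
        rw [← sub_eq_zero] at hab
        rw [← neg_eq_zero, ← hab]
        abel
      rw [mul_assoc, this, mul_add, mul_smul_comm, ← mul_assoc, ← pow_succ, add_comm]) rfl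
    (fun _ => rfl)
  refine smul_right_injective _ hβ ?_
  beta_reduce
  rw [Finset.smul_sum]
  have h1 : ∀ j, (ε * 4 * k) • ((j.factorial : ℂ)⁻¹ * coeff l (rSeries k ^ j)) • powDeriv T b j =
      ∑ x ∈ Finset.HasAntidiagonal.antidiagonal j,
        (coeff l (rSeries k ^ (x.1 + x.2)) * ((ε * 4 * k) ^ x.1 / x.1.factorial)
          * (x.2.factorial : ℂ)⁻¹) • (T ^ x.2 * b)
      - (coeff l (rSeries k ^ j) * (j.factorial : ℂ)⁻¹) • (T ^ j * b) := by
    intro j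
    have e : (ε * 4 * k) • ((j.factorial : ℂ)⁻¹ * coeff l (rSeries k ^ j)) • powDeriv T b j =
        coeff l (rSeries k ^ j) • ((ε * 4 * k) • (j.factorial : ℂ)⁻¹ • powDeriv T b j) := by
      module
    rw [e, h, smul_sub, Finset.smul_sum, smul_smul]
    refine congrArg (· - _) (Finset.sum_congr rfl fun x hx => ?_)
    have hx' : x.1 + x.2 = j := by simpa using hx
    rw [hx', smul_smul, smul_smul, mul_assoc]
  simp only [h1]
  rw [Finset.sum_sub_distrib, ← sum_square_eq_sum_antidiagonal (fun i q =>
    (coeff l (rSeries k ^ (i + q)) * ((ε * 4 * k) ^ i / i.factorial)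
          * (q.factorial : ℂ)⁻¹) • (T ^ q * b)), Finset.sum_comm, ← Finset.sum_sub_distrib,
    smul_neg, Finset.smul_sum, Finset.smul_sum, ← Finset.sum_neg_distrib]
  · refine Finset.sum_congr rfl fun q _ => ?_
    rw [← Finset.sum_smul, ← sub_smul, smul_smul, smul_smul, ← neg_smul]
    congr 1
    -- The inner sum over i is an exponential of 4εkr, evaluated by `formalExp_rSeries`.
    have key := coeff_mul_formalExp hu (rSeries k ^ q) (le_refl l)
    rw [formalExp_rSeries k hk ε hε, mul_sub, mul_one, map_sub] at key
    have e1 : ∀ j, (j.factorial : ℂ)⁻¹ * coeff l (rSeries k ^ q * (C (ε * 4 * k) * rSeries k) ^ j)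
        = coeff l (rSeries k ^ (j + q)) * ((ε * 4 * k) ^ j / j.factorial) := by
      intro j
      rw [mul_pow, ← map_pow, mul_left_comm, coeff_C_mul, ← pow_add, add_comm q]
      ring
    simp only [e1] at key
    rw [← Finset.sum_mul, ← key]
    have e2 : ∀ c : ℂ, coeff l (rSeries k ^ q * (C c * invT k ε))
        = c * coeff l (rSeries k ^ q * invT k ε) := by
      intro c
      rw [mul_left_comm, coeff_C_mul]
    rw [e2, e2]
    linear_combination (2 * (k : ℂ) * (q.factorial : ℂ)⁻¹ *
      coeff l (rSeries k ^ q * invT k ε)) * hε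
  · intro i j hij
    rw [coeff_pow_eq_zero (constantCoeff_rSeries k) hij, zero_mul, zero_mul, zero_smul]

theorem coeff_expLap_mul (τ : UpperHalfPlane) (g : PowerSeries ℂ) (B : DiffOp n k) (l : ℕ) :
    coeff l (expLap n k τ * (scalarSeries n k g * C B)) =
      ∑ q ∈ Finset.range (l + 1), ((q.factorial : ℂ)⁻¹ * coeff l (rSeries k ^ q * g)) •
        (lap n k τ ^ q * B) := by
  have e : ∀ q, coeff l (rSeries k ^ q * g) = ∑ x ∈ Finset.HasAntidiagonal.antidiagonal l,
      coeff x.1 (rSeries k ^ q) * coeff x.2 g := fun q => coeff_mul _ _ _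
  rw [coeff_mul]
  simp only [e, Finset.mul_sum, Finset.sum_smul]
  rw [Finset.sum_comm]
  refine Finset.sum_congr rfl fun x hx => ?_
  have hx' : x.1 + x.2 = l := by simpa using hx
  have h1 : coeff x.1 (expLap n k τ) = ∑ j ∈ Finset.range (l + 1),
      ((j.factorial : ℂ)⁻¹ * coeff x.1 (rSeries k ^ j)) • lap n k τ ^ j :=
    coeff_formalExp_scalar (constantCoeff_rSeries k) _ (by omega)
  rw [coeff_mul_C, scalarSeries_eq, coeff_map, ← Algebra.smul_def, h1, Finset.sum_mul]
  refine Finset.sum_congr rfl fun j _ => ?_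
  rw [smul_mul_smul_comm, mul_assoc]

/-- The minus sign in V[Δ] cancels that of `powDeriv_factorial`; the remaining ε is the relative
sign of the b- and b̄-terms in `connForm`. -/
theorem expLap_hasOpDeriv (hk : 1 ≤ k) (τ : UpperHalfPlane) (V : ℂ) (l : ℕ) :
    HasOpDeriv (fun τ => coeff l (expLap n k τ)) τ V
      (coeff l (expLap n k τ * connForm n k τ V)) := by
  have h := (FamDeriv.sum (Finset.range (l + 1)) fun j =>
    (famDeriv_lap_pow (n := n) (k := k) j).smul
      ((j.factorial : ℂ)⁻¹ * coeff l (rSeries k ^ j))).hasOpDeriv τ V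
  simp only [← coeff_expLap] at h
  convert h using 1
  have h1 := powDeriv_factorial hk (lap n k τ) (bForm n k τ V) 1 (by norm_num)
    (by rw [lap_commutator_bForm, one_mul]) l
  have h2 := powDeriv_factorial hk (lap n k τ) (bbarForm n k τ V) (-1) (by norm_num)
    (by rw [lap_commutator_bbarForm]; congr 1; ring) l
  rw [connForm, mul_sub, map_sub, coeff_expLap_mul, coeff_expLap_mul]
  simp only [smul_neg, smul_add, Finset.sum_neg_distrib, Finset.sum_add_distrib]
  rw [h1, h2]
  module

/-! ### The formal series of the ansatz -/

theorem coeff_formalSeries_ansatz (hk : 1 ≤ k) {c : ℕ → ℕ → ℂ} (h : NumRec k c)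
    (τ : UpperHalfPlane) (D : DiffOp n k) (l : ℕ) :
    coeff l (formalSeries (ansatz n k c) τ D) = ∑ j ∈ Finset.range (l + 1),
      coeff l ((PowerSeries.mk fun l => c l l) * (X * rhoTilde k) ^ j) • adPow n k j τ D := by
  rw [formalSeries, coeff_mk, ansatz, LinearMap.sum_apply, ← Finset.sum_range_reflect]
  refine Finset.sum_congr rfl fun j hj => ?_
  have hj' : j ≤ l := by simpa [Nat.lt_succ_iff] using hj
  rw [show l + 1 - 1 - j = l - j by omega, LinearMap.smul_apply, eq_solution k hk h (Nat.sub_le _ _),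
    solution_eq_coeff k _ hj', show l - (l - j) = j by omega]

/-- The formal series is ∑ⱼ gρʲ P⁽ʲ⁾ with g the series of the diagonal, hence linear in g over
scalar series. -/
theorem scalarSeries_mul_formalSeries (hk : 1 ≤ k) {c c' : ℕ → ℕ → ℂ} (h : NumRec k c)
    (h' : NumRec k c') (p : PowerSeries ℂ)
    (hp : (PowerSeries.mk fun l => c l l) = p * PowerSeries.mk fun l => c' l l)
    (τ : UpperHalfPlane) (D : DiffOp n k) :
    formalSeries (ansatz n k c) τ D = scalarSeries n k p * formalSeries (ansatz n k c') τ D := by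
  ext1 l
  have hρ : constantCoeff (X * rhoTilde k) = 0 := constantCoeff_X_mul _
  rw [coeff_formalSeries_ansatz hk h, hp, coeff_mul]
  simp only [mul_assoc, coeff_mul, Finset.sum_smul]
  rw [Finset.sum_comm]
  refine Finset.sum_congr rfl fun x hx => ?_
  have hx' : x.1 + x.2 = l := by simpa using hx
  rw [coeff_formalSeries_ansatz hk h', scalarSeries_eq, coeff_map, ← Algebra.smul_def,
    Finset.smul_sum]
  symm
  -- The inner sum may run up to l: the added terms vanish since ρʲ starts in degree j.
  refine (Finset.sum_subset (Finset.range_subset_range.2 (show x.2 + 1 ≤ l + 1 by omega)) fun j _ hj => ?_).trans ?_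
  · rw [coeff_mul_pow_eq_zero hρ _ (by simpa using hj), zero_smul, smul_zero]
  · refine Finset.sum_congr rfl fun j _ => ?_
    rw [smul_smul, ← coeff_mul]

theorem mulRight_sub_mulLeft_lap (τ : UpperHalfPlane) :
    LinearMap.mulRight ℂ (lap n k τ) - LinearMap.mulLeft ℂ (lap n k τ) =
      (-2 * Complex.I) • commOp (aOp n k τ) := by
  rw [aOp, commOp_smul, smul_smul, show -2 * Complex.I * -(Complex.I / 2) = -1 by
    linear_combination Complex.I_sq]
  ext1 D
  simp only [LinearMap.sub_apply, LinearMap.mulRight_apply, LinearMap.mulLeft_apply,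
    LinearMap.smul_apply, commOp_apply]
  module

/-- Here g = 1, and ρ ad_a = -2ir · (-i/2) ad_Δ = -r ad_Δ, whose exponential is the conjugation by
exp(rΔ). -/
theorem formalSeries_eq_conj (hk : 1 ≤ k) {c : ℕ → ℕ → ℂ} (h : NumRec k c) (h0 : c 0 0 = 1)
    (hc : ∀ l, 0 < l → c l l = 0) (τ : UpperHalfPlane) (D : DiffOp n k) :
    formalSeries (ansatz n k c) τ D = expNegLap n k τ * C D * expLap n k τ := by
  have h1 : (PowerSeries.mk fun l => c l l) = (1 : PowerSeries ℂ) := by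
    ext l
    rw [coeff_mk, coeff_one]
    split_ifs with hl
    · rw [hl, h0]
    · exact hc l (by omega)
  ext1 l
  rw [coeff_formalSeries_ansatz hk h, h1]
  refine Eq.trans ?_ (coeff_conj_formalExp (constantCoeff_rSeries k) (lap n k τ) D l).symm
  refine Finset.sum_congr rfl fun j _ => ?_
  rw [one_mul, X_mul_rhoTilde k hk, mul_pow, ← map_pow, coeff_C_mul, mulRight_sub_mulLeft_lap,
    smul_pow, LinearMap.smul_apply, adPow, LinearMap.smul_apply, smul_smul, smul_smul]
  congr 1
  ring

end HitchinWitten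

end


noncomputable section

namespace HitchinWitten

/-! ### Equivariance under the mapping class group -/

/-- The matrix of `mcg A` in the coordinates `(x, y)`. -/
def mcgMat (A : SL(2, ℤ)) : Matrix (Fin 2) (Fin 2) ℂ := !![(A 1 1 : ℂ), A 1 0; (A 0 1 : ℂ), A 0 0]

theorem mcgFn_cov {n : ℕ} (k : ℕ) (A : SL(2, ℤ)) (u : Cover n) :
    mcgFn A * cov k u = cov k (mcg A u) * mcgFn A := by
  refine LinearMap.ext fun ψ => SmoothFn.ext fun v => ?_
  by_cases hv : v ∈ regular n
  · have h := cov_comp k (mcg A u) (mcg A⁻¹) (mcg_omega A⁻¹) ψ (mcgFn A ψ) (fun _ => rfl)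
      (fun v hv => (mcg_regular_iff _ _).2 hv) v hv
    rw [mcg_inv] at h
    exact h.symm
  · rw [SmoothFn.eq_zero _ hv, SmoothFn.eq_zero _ hv]

theorem cov_mcg_dir {n : ℕ} (k : ℕ) (A : SL(2, ℤ)) (a : Fin 2) (u : cartan n) :
    cov k (mcg A (dir a u)) = ∑ c, mcgMat A c a • cov k (dir c u) := by
  have h : mcg A (dir a u) = ∑ c, (!![(A 1 1 : ℝ), A 1 0; (A 0 1 : ℝ), A 0 0] c a) • dir c u := by
    rw [Fin.sum_univ_two]
    fin_cases a <;> ext j <;> simp [mcg_fst, mcg_snd, dir]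
  rw [h, cov_sum_dir]
  refine Finset.sum_congr rfl fun c _ => ?_
  rw [cov_smul_dir]
  congr 1
  fin_cases a <;> fin_cases c <;> simp [mcgMat]

theorem mcgFn_hessFn {n : ℕ} (k : ℕ) (A : SL(2, ℤ)) (G : Matrix (Fin 2) (Fin 2) ℂ) :
    mcgFn (n := n) A * hessFn k G =
      hessFn k (mcgMat A * G * (mcgMat A).transpose) * mcgFn A := by
  have h : ∀ a b, mcgFn (n := n) A * hessComp n k a b =
      ∑ c, ∑ d, (mcgMat A c a * mcgMat A d b) • (hessComp n k c d * mcgFn A) := by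
    intro a b
    have h1 : ∀ j : Fin n, mcgFn A * (cov k (dir a (frame j)) * cov k (dir b (frame j))) =
        ∑ c, ∑ d, (mcgMat A c a * mcgMat A d b) •
          (cov k (dir c (frame j)) * cov k (dir d (frame j)) * mcgFn A) := by
      intro j
      rw [← mul_assoc, mcgFn_cov, mul_assoc, mcgFn_cov, cov_mcg_dir, cov_mcg_dir, ← mul_assoc,
        Finset.sum_mul_sum, Finset.sum_mul]
      refine Finset.sum_congr rfl fun c _ => ?_
      rw [Finset.sum_mul]
      refine Finset.sum_congr rfl fun d _ => ?_
      rw [smul_mul_smul_comm, smul_mul_assoc]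
    simp only [hessComp, Finset.mul_sum, h1, Finset.sum_mul, Finset.smul_sum]
    rw [Finset.sum_comm]
    exact Finset.sum_congr rfl fun c _ => Finset.sum_comm
  simp only [hessFn_eq, Finset.mul_sum, mul_smul_comm, h, Finset.sum_mul, smul_mul_assoc]
  simp only [Fin.sum_univ_two, Matrix.mul_apply, Matrix.transpose_apply]
  module

theorem mcgOp_hess {n k : ℕ} (A : SL(2, ℤ)) (G : Matrix (Fin 2) (Fin 2) ℂ) :
    mcgOp A (hess n k G) = hess n k (mcgMat A * G * (mcgMat A).transpose) := by
  refine hess_ext fun ψ => ?_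
  have h1 := congrArg (fun T => T (mcgSec n k A⁻¹ ψ).toFn) (mcgFn_hessFn (n := n) k A G)
  have h2 : mcgFn A (mcgSec n k A⁻¹ ψ).toFn = ψ.toFn :=
    congrArg (fun T => (T ψ).toFn) (mcgSec_inv n k A)
  have h3 : ((mcgOp A (hess n k G)).1 ψ).toFn =
    (hessFn k (mcgMat A * G * (mcgMat A).transpose)) (mcgFn A (mcgSec n k A⁻¹ ψ).toFn) := h1
  rw [h3, h2]
  rfl

/-- Conceptually `mcgMat A` sends (1, τ) to (cτ + d)(1, Aτ), while Im(Aτ) = Im τ/|cτ + d|². The code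
verifies the four entries. -/
theorem mcgMat_invMetric (A : SL(2, ℤ)) (τ : UpperHalfPlane) :
    mcgMat A * (invMetric τ).map (fun r : ℝ => (r : ℂ)) * (mcgMat A).transpose =
      (invMetric ((A • τ : UpperHalfPlane) : ℂ)).map (fun r : ℝ => (r : ℂ)) := by
  obtain ⟨a, ha⟩ : ∃ a : ℝ, a = A 0 0 := ⟨_, rfl⟩
  obtain ⟨b, hb⟩ : ∃ b : ℝ, b = A 0 1 := ⟨_, rfl⟩
  obtain ⟨c, hc⟩ : ∃ c : ℝ, c = A 1 0 := ⟨_, rfl⟩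
  obtain ⟨d, hd⟩ : ∃ d : ℝ, d = A 1 1 := ⟨_, rfl⟩
  have hdet : a * d - b * c = 1 := by rw [ha, hb, hc, hd]; exact mcg_det A
  obtain ⟨x, hx⟩ : ∃ x, x = (τ : ℂ).re := ⟨_, rfl⟩
  obtain ⟨y, hy⟩ : ∃ y, y = (τ : ℂ).im := ⟨_, rfl⟩
  have hy0 : y ≠ 0 := by rw [hy]; exact τ.im_pos.ne'
  -- This is |cτ + d|²: its vanishing would force c = d = 0, against determinant 1.
  have hN : (c * x + d) ^ 2 + (c * y) ^ 2 ≠ 0 := by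
    intro h0
    have h1 : c * y = 0 := by nlinarith [sq_nonneg (c * x + d), sq_nonneg (c * y)]
    have h2 : c * x + d = 0 := by nlinarith [sq_nonneg (c * x + d), sq_nonneg (c * y)]
    have h3 : c = 0 := by simpa [hy0] using h1
    subst h3
    have h4 : d = 0 := by simpa using h2
    subst h4
    simp at hdet
  have hA : ((A • τ : UpperHalfPlane) : ℂ) = (a * τ + b) / (c * τ + d) := by
    rw [UpperHalfPlane.coe_specialLinearGroup_apply, ha, hb, hc, hd]
    simp
  have hτ : (τ : ℂ) = x + y * Complex.I := by rw [hx, hy, Complex.re_add_im]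
  have hre : ((A • τ : UpperHalfPlane) : ℂ).re =
      ((a * x + b) * (c * x + d) + a * c * y ^ 2) / ((c * x + d) ^ 2 + (c * y) ^ 2) := by
    rw [hA, hτ, Complex.div_re, Complex.normSq_apply]
    simp
    rw [← add_div, ← sq, ← sq]
    congr 1
    ring
  have him : ((A • τ : UpperHalfPlane) : ℂ).im = y / ((c * x + d) ^ 2 + (c * y) ^ 2) := by
    rw [hA, hτ, Complex.div_im, Complex.normSq_apply]
    simp
    rw [← sub_div, ← sq, ← sq]
    congr 1
    linear_combination y * hdet
  have hM : mcgMat A = (!![d, c; b, a] : Matrix (Fin 2) (Fin 2) ℝ).map (fun r : ℝ => (r : ℂ)) := by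
    ext i j
    fin_cases i <;> fin_cases j <;> simp [mcgMat, ha, hb, hc, hd]
  have key : !![d, c; b, a] * invMetric τ * (!![d, c; b, a] : Matrix (Fin 2) (Fin 2) ℝ).transpose =
      invMetric ((A • τ : UpperHalfPlane) : ℂ) := by
    rw [invMetric_eq, invMetric_eq, hre, him, ← hx, ← hy]
    have hp := Real.pi_ne_zero
    obtain ⟨N, hN'⟩ : ∃ N, N = (c * x + d) ^ 2 + (c * y) ^ 2 := ⟨_, rfl⟩
    rw [← hN'] at hN ⊢
    ext i j
    fin_cases i <;> fin_cases j <;> simp [Matrix.mul_apply, Fin.sum_univ_two] <;> field_simp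
    · linear_combination -hN'
    · ring
    · ring
    · linear_combination (b * (b + a * x) + a * (b * x + a * (x ^ 2 + y ^ 2))) * hN' +
        y ^ 2 * (a * d - b * c + 1) * hdet
  rw [← key, hM]
  ext i j
  simp only [Matrix.mul_apply, Matrix.transpose_apply, Matrix.map_apply, Fin.sum_univ_two]
  push_cast
  ring

variable {n k : ℕ}

theorem mcgOp_lap (A : SL(2, ℤ)) (τ : UpperHalfPlane) : mcgOp A (lap n k τ) = lap n k (A • τ) := by
  rw [lap, mcgOp_hess, mcgMat_invMetric, lap]

theorem mcgOp_smul (A : SL(2, ℤ)) (c : ℂ) (D : DiffOp n k) : mcgOp A (c • D) = c • mcgOp A D := by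
  refine Subtype.ext ?_
  change mcgSec n k A * (c • D.1) * mcgSec n k A⁻¹ = c • (mcgSec n k A * D.1 * mcgSec n k A⁻¹)
  rw [mul_smul_comm, smul_mul_assoc]

theorem mcgOp_add (A : SL(2, ℤ)) (D D' : DiffOp n k) :
    mcgOp A (D + D') = mcgOp A D + mcgOp A D' := by
  refine Subtype.ext ?_
  change mcgSec n k A * (D.1 + D'.1) * mcgSec n k A⁻¹ =
    mcgSec n k A * D.1 * mcgSec n k A⁻¹ + mcgSec n k A * D'.1 * mcgSec n k A⁻¹
  rw [mul_add, add_mul]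

theorem mcgOp_mul (A : SL(2, ℤ)) (D D' : DiffOp n k) :
    mcgOp A (D * D') = mcgOp A D * mcgOp A D' := by
  refine Subtype.ext ?_
  change mcgSec n k A * (D.1 * D'.1) * mcgSec n k A⁻¹ =
    mcgSec n k A * D.1 * mcgSec n k A⁻¹ * (mcgSec n k A * D'.1 * mcgSec n k A⁻¹)
  have h : mcgSec n k A⁻¹ * mcgSec n k A = 1 := by
    rw [← map_mul, inv_mul_cancel, map_one]
  simp only [mul_assoc]
  rw [← mul_assoc (mcgSec n k A⁻¹) (mcgSec n k A), h, one_mul]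

/-- `mcgOp` as a linear map. -/
def mcgOpLin (n k : ℕ) (A : SL(2, ℤ)) : DiffOp n k →ₗ[ℂ] DiffOp n k where
  toFun := mcgOp A
  map_add' := mcgOp_add A
  map_smul' := mcgOp_smul A

theorem mcgOp_commOp (A : SL(2, ℤ)) (T D : DiffOp n k) :
    mcgOp A (commOp T D) = commOp (mcgOp A T) (mcgOp A D) := by
  have h := (mcgOpLin n k A).map_sub (T * D) (D * T)
  have h' : mcgOp A (T * D - D * T) = mcgOp A (T * D) - mcgOp A (D * T) := h
  rw [commOp_apply, commOp_apply, h', mcgOp_mul, mcgOp_mul]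

theorem mcgOp_adPow (A : SL(2, ℤ)) (τ : UpperHalfPlane) (D : DiffOp n k) (l : ℕ) :
    adPow n k l (A • τ) (mcgOp A D) = mcgOp A (adPow n k l τ D) := by
  rw [adPow, adPow, LinearMap.smul_apply, LinearMap.smul_apply, mcgOp_smul]
  congr 1
  induction l with
  | zero => rfl
  | succ l ih =>
    rw [pow_succ', pow_succ', Module.End.mul_apply, Module.End.mul_apply, ih, mcgOp_commOp, aOp,
      aOp, mcgOp_smul, mcgOp_lap]

theorem ansatz_isMCGInvariant (c : ℕ → ℕ → ℂ) : IsMCGInvariant (ansatz n k c) := by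
  intro A l τ D
  have h := map_sum (mcgOpLin n k A) (fun r => c r l • adPow n k (l - r) τ D) (Finset.range (l + 1))
  have h' : mcgOp A (∑ r ∈ Finset.range (l + 1), c r l • adPow n k (l - r) τ D) =
    ∑ r ∈ Finset.range (l + 1), mcgOp A (c r l • adPow n k (l - r) τ D) := h
  simp only [ansatz, LinearMap.sum_apply, LinearMap.smul_apply, h', mcgOp_smul, mcgOp_adPow]

end HitchinWitten

end


noncomputable section

namespace HitchinWitten

/-! ### Sections with prescribed germ at a point -/

theorem isLattice_zero {n : ℕ} : IsLattice (0 : Cover n) :=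
  fun _ => ⟨⟨0, by simp⟩, ⟨0, by simp⟩⟩

theorem IsLattice.neg {n : ℕ} {γ : Cover n} (h : IsLattice γ) : IsLattice (-γ) := by
  intro j
  obtain ⟨⟨a, ha⟩, ⟨b, hb⟩⟩ := h j
  exact ⟨⟨-a, by simp [ha]⟩, ⟨-b, by simp [hb]⟩⟩

theorem IsLattice.add {n : ℕ} {γ δ : Cover n} (h : IsLattice γ) (h' : IsLattice δ) :
    IsLattice (γ + δ) := by
  intro j
  obtain ⟨⟨a, ha⟩, ⟨b, hb⟩⟩ := h j
  obtain ⟨⟨c, hc⟩, ⟨d, hd⟩⟩ := h' j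
  exact ⟨⟨a + c, by simp [ha, hc]⟩, ⟨b + d, by simp [hb, hd]⟩⟩

theorem IsLattice.sub {n : ℕ} {γ δ : Cover n} (h : IsLattice γ) (h' : IsLattice δ) :
    IsLattice (γ - δ) := by
  rw [sub_eq_add_neg]
  exact h.add h'.neg

theorem IsLattice.weyl {n : ℕ} {γ : Cover n} (h : IsLattice γ) (w : Equiv.Perm (Fin n)) :
    IsLattice (weyl w γ) :=
  fun j => h (w j)

theorem isClosed_isLattice (n : ℕ) : IsClosed {γ : Cover n | IsLattice γ} := by
  have hc : IsClosed (Set.range ((↑) : ℤ → ℝ)) := Int.isClosedEmbedding_coe_real.isClosed_range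
  have h : {γ : Cover n | IsLattice γ} = ⋂ j, ((fun v : Cover n => v.1.1 j) ⁻¹' Set.range ((↑) : ℤ → ℝ)
      ∩ (fun v : Cover n => v.2.1 j) ⁻¹' Set.range ((↑) : ℤ → ℝ)) := by
    ext γ
    simp [IsLattice, eq_comm]
  rw [h]
  exact isClosed_iInter fun j => (hc.preimage (contDiff_fst_coord j).continuous).inter
    (hc.preimage (contDiff_snd_coord j).continuous)

theorem weyl_weyl {n : ℕ} (w w' : Equiv.Perm (Fin n)) (v : Cover n) :
    weyl w (weyl w' v) = weyl (w' * w) v := rfl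

theorem weyl_one {n : ℕ} (v : Cover n) : weyl 1 v = v := rfl

theorem weyl_multiplier {n : ℕ} (k : ℕ) (w : Equiv.Perm (Fin n)) (γ v : Cover n) :
    multiplier k (weyl w γ) (weyl w v) = multiplier k γ v := by
  have h : pair (weyl w γ).1 (weyl w γ).2 = pair γ.1 γ.2 :=
    Equiv.sum_comp w fun j => γ.1.1 j * γ.2.1 j
  rw [multiplier, multiplier, weyl_omega, h]

theorem multiplier_zero_left {n : ℕ} (k : ℕ) (v : Cover n) : multiplier k 0 v = 1 := by
  simp [multiplier, pair, omega]

theorem multiplier_ne_zero {n : ℕ} (k : ℕ) (γ v : Cover n) : multiplier k γ v ≠ 0 :=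
  Complex.exp_ne_zero _

/-- The cocycle condition. -/
theorem multiplier_add {n : ℕ} (k : ℕ) {γ δ : Cover n} (hγ : IsLattice γ) (hδ : IsLattice δ)
    (v : Cover n) : multiplier k (γ + δ) v = multiplier k γ (v + δ) * multiplier k δ v := by
  -- The exponents of the two sides differ by 2πi · kq, with q the integral pairing of δ.1 and γ.2.
  obtain ⟨q, hq⟩ := pair_lattice_int δ.1 γ.2 (fun j => (hδ j).1) fun j => (hγ j).2
  have h1 : pair (γ + δ).1 (γ + δ).2 =
      pair γ.1 γ.2 + pair γ.1 δ.2 + pair δ.1 γ.2 + pair δ.1 δ.2 := by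
    simp only [pair, ← Finset.sum_add_distrib]
    refine Finset.sum_congr rfl fun j _ => ?_
    change (γ.1.1 j + δ.1.1 j) * (γ.2.1 j + δ.2.1 j) = _
    ring
  have h2 : omega γ δ = 2 * Real.pi * (pair γ.1 δ.2 - q) := by
    rw [omega, pair_comm γ.2, hq]
  rw [multiplier, multiplier, multiplier, ← Complex.exp_add, omega_add_left, omega_add_right, h1,
    h2, hq, Complex.exp_eq_exp_iff_exists_int]
  refine ⟨k * q, ?_⟩
  push_cast
  ring

theorem contDiff_multiplier {n : ℕ} (k : ℕ) (γ : Cover n) :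
    ContDiff ℝ ∞ fun v => multiplier k γ v := by
  unfold multiplier
  refine ContDiff.cexp (contDiff_const.mul (Complex.ofRealCLM.contDiff.comp
    (contDiff_const.add (ContDiff.div_const ?_ 2))))
  exact (omegaCLM γ).contDiff

/-- A point over the smooth part of the moduli space, whose entries are equidistributed. -/
def basePoint (n : ℕ) : Cover n :=
  (⟨fun j => ((j : ℝ) - (n - 1) / 2) / n, by
    change ∑ j : Fin n, ((j : ℝ) - (n - 1) / 2) / n = 0
    rw [← Finset.sum_div, Finset.sum_sub_distrib, Fin.sum_univ_eq_sum_range (fun j => (j : ℝ)) n]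
    have h := Finset.sum_range_id_mul_two n
    have h' : (∑ i ∈ Finset.range n, (i : ℝ)) * 2 = n * (n - 1) := by
      rcases Nat.eq_zero_or_pos n with rfl | hn
      · simp
      · have := congrArg (fun m : ℕ => (m : ℝ)) h
        push_cast [Nat.cast_sub (Nat.succ_le_of_lt hn)] at this
        exact this
    have : ∑ i ∈ Finset.range n, (i : ℝ) - ∑ _x : Fin n, ((n : ℝ) - 1) / 2 = 0 := by
      simp
      linarith
    rw [this, zero_div]⟩, 0)

/-- Multiplied by n, the quantity is the integer i - j + nm of absolute value less than 1, hence 0;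
then |i - j| < n forces m = 0. -/
theorem eq_of_abs_lt_one_of_int {n : ℕ} (i j : Fin n) (m : ℤ)
    (h : |((i : ℝ) - j) / n + m| < 1 / n) : i = j ∧ m = 0 := by
  have hn : (0 : ℝ) < n := by exact_mod_cast i.pos
  have h1 : |(((i : ℤ) - j + n * m : ℤ) : ℝ)| < 1 := by
    have : (((i : ℤ) - j + n * m : ℤ) : ℝ) = (((i : ℝ) - j) / n + m) * n := by
      push_cast
      field_simp
    rw [this, abs_mul, abs_of_pos hn]
    rwa [lt_div_iff₀ hn] at h
  have h2 : |(i : ℤ) - j + n * m| < 1 := by exact_mod_cast h1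
  have h3 : (i : ℤ) - j + n * m = 0 := Int.abs_lt_one_iff.1 h2
  have hi := i.2
  have hj := j.2
  have hm : m = 0 := by
    by_contra hm
    rcases lt_or_gt_of_ne hm with hm | hm
    · nlinarith
    · nlinarith
  subst hm
  exact ⟨Fin.ext (by omega), rfl⟩

theorem basePoint_mem_regular (n : ℕ) : basePoint n ∈ regular n := by
  rintro i j hij ⟨⟨m, hm⟩, -⟩
  have hn : (0 : ℝ) < n := by exact_mod_cast i.pos
  refine hij (eq_of_abs_lt_one_of_int i j (-m) ?_).1
  have : ((i : ℝ) - j) / n + ((-m : ℤ) : ℝ) = 0 := by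
    push_cast
    rw [← hm]
    simp only [basePoint]
    ring
  rw [this, abs_zero]
  positivity

theorem abs_coord_lt {n : ℕ} {v v' : Cover n} {r : ℝ} (h : v ∈ Metric.ball v' r) (j : Fin n) :
    |v.1.1 j - v'.1.1 j| < r ∧ |v.2.1 j - v'.2.1 j| < r := by
  rw [Metric.mem_ball, dist_eq_norm] at h
  have h1 : ‖v.1 - v'.1‖ < r := (norm_fst_le (v - v')).trans_lt h
  have h2 : ‖v.2 - v'.2‖ < r := (norm_snd_le (v - v')).trans_lt h
  exact ⟨(norm_le_pi_norm (v.1 - v'.1).1 j).trans_lt h1,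
    (norm_le_pi_norm (v.2 - v'.2).1 j).trans_lt h2⟩

/-- The translates of the ball around the base point are disjoint. -/
theorem eq_one_of_mem_ball {n : ℕ} {w : Equiv.Perm (Fin n)} {γ v : Cover n} (hγ : IsLattice γ)
    (hv : v ∈ Metric.ball (basePoint n) (1 / (2 * n)))
    (hv' : weyl w v + γ ∈ Metric.ball (basePoint n) (1 / (2 * n))) : w = 1 ∧ γ = 0 := by
  have h : ∀ j, w j = j ∧ γ.1.1 j = 0 ∧ γ.2.1 j = 0 := by
    intro j
    have hn : (1 : ℝ) ≤ n := by exact_mod_cast j.pos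
    obtain ⟨⟨a, ha⟩, ⟨b, hb⟩⟩ := hγ j
    obtain ⟨h1, h2⟩ := abs_coord_lt hv (w j)
    obtain ⟨h3, h4⟩ := abs_coord_lt hv' j
    have e1 : (weyl w v + γ).1.1 j = v.1.1 (w j) + a := by rw [← ha]; rfl
    have e2 : (weyl w v + γ).2.1 j = v.2.1 (w j) + b := by rw [← hb]; rfl
    rw [e1] at h3
    rw [e2] at h4
    -- Two radii add up to the spacing 1/n of the base point, the origin of the radius 1/(2n).
    have hr : (1 : ℝ) / (2 * n) + 1 / (2 * n) = 1 / n := by field_simp; norm_num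
    have h5 : |((w j : ℝ) - j) / n + a| < 1 / n := by
      rw [← hr]
      have : ((w j : ℝ) - j) / n + a = (v.1.1 (w j) + a - (basePoint n).1.1 j)
          - (v.1.1 (w j) - (basePoint n).1.1 (w j)) := by
        simp only [basePoint]
        ring
      rw [this]
      exact (abs_sub _ _).trans_lt (add_lt_add h3 h1)
    have h6 : |(b : ℝ)| < 1 := by
      have h7 : (1 : ℝ) / n ≤ 1 := by
        rw [div_le_one (by linarith)]
        exact hn
      refine lt_of_lt_of_le ?_ h7
      rw [← hr]
      have : (b : ℝ) = (v.2.1 (w j) + b - (basePoint n).2.1 j)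
          - (v.2.1 (w j) - (basePoint n).2.1 (w j)) := by
        simp [basePoint]
      rw [this]
      exact (abs_sub _ _).trans_lt (add_lt_add h4 h2)
    obtain ⟨h8, h9⟩ := eq_of_abs_lt_one_of_int (w j) j a h5
    have h10 : b = 0 := Int.abs_lt_one_iff.1 (by exact_mod_cast h6)
    exact ⟨h8, by rw [ha, h9]; simp, by rw [hb, h10]; simp⟩
  refine ⟨Equiv.ext fun j => (h j).1, ?_⟩
  ext j
  · exact (h j).2.1
  · exact (h j).2.2

open Classical in
/-- The quasi-periodic extension of a function supported in a ball around the base point. -/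
def periodise {n : ℕ} (k : ℕ) (F : Cover n → ℂ) (v : Cover n) : ℂ :=
  if h : ∃ p : Equiv.Perm (Fin n) × Cover n, IsLattice p.2 ∧
      weyl p.1 v + p.2 ∈ Metric.ball (basePoint n) (1 / (2 * n)) then
    (multiplier k h.choose.2 (weyl h.choose.1 v))⁻¹ * F (weyl h.choose.1 v + h.choose.2)
  else 0

/-- At most one element of the group of permutations and translations carries v into the ball, so
the chosen element must be the given one. The orbit sum has a single term. -/
theorem periodise_of_mem {n : ℕ} (k : ℕ) (F : Cover n → ℂ) {w : Equiv.Perm (Fin n)}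
    {γ v : Cover n} (hγ : IsLattice γ)
    (hv : weyl w v + γ ∈ Metric.ball (basePoint n) (1 / (2 * n))) :
    periodise k F v = (multiplier k γ (weyl w v))⁻¹ * F (weyl w v + γ) := by
  have h : ∃ p : Equiv.Perm (Fin n) × Cover n, IsLattice p.2 ∧
      weyl p.1 v + p.2 ∈ Metric.ball (basePoint n) (1 / (2 * n)) := ⟨(w, γ), hγ, hv⟩
  rw [periodise, dif_pos h]
  obtain ⟨h1, h2⟩ := h.choose_spec
  set w' := h.choose.1
  set γ' := h.choose.2
  have h3 : weyl (w⁻¹ * w') (weyl w v + γ) + (γ' - weyl (w⁻¹ * w') γ) = weyl w' v + γ' := by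
    rw [map_add, weyl_weyl, mul_inv_cancel_left]
    abel
  obtain ⟨h4, h5⟩ := eq_one_of_mem_ball (h1.sub (hγ.weyl (w⁻¹ * w'))) hv (h3 ▸ h2)
  rw [h4, weyl_one, sub_eq_zero] at h5
  rw [inv_mul_eq_one] at h4
  rw [h5, ← h4]

theorem periodise_translate {n : ℕ} (k : ℕ) (F : Cover n → ℂ) {γ : Cover n} (hγ : IsLattice γ)
    (v : Cover n) : periodise k F (v + γ) = multiplier k γ v * periodise k F v := by
  by_cases h : ∃ p : Equiv.Perm (Fin n) × Cover n, IsLattice p.2 ∧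
      weyl p.1 v + p.2 ∈ Metric.ball (basePoint n) (1 / (2 * n))
  · obtain ⟨⟨w, δ⟩, hδ, hv⟩ := h
    have e : weyl w (v + γ) + (δ - weyl w γ) = weyl w v + δ := by
      rw [map_add]
      abel
    rw [periodise_of_mem k F (hδ.sub (hγ.weyl w)) (e ▸ hv), periodise_of_mem k F hδ hv, e]
    have h1 := multiplier_add k (hδ.sub (hγ.weyl w)) (hγ.weyl w) (weyl w v)
    rw [sub_add_cancel, weyl_multiplier, ← map_add] at h1
    rw [h1, mul_inv]
    field_simp [multiplier_ne_zero]
  · rw [periodise, periodise, dif_neg h, dif_neg, mul_zero]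
    rintro ⟨⟨w, δ⟩, hδ, hv⟩
    refine h ⟨(w, weyl w γ + δ), (hγ.weyl w).add hδ, ?_⟩
    rw [map_add, add_assoc] at hv
    exact hv

theorem periodise_weyl {n : ℕ} (k : ℕ) (F : Cover n → ℂ) (w : Equiv.Perm (Fin n))
    (v : Cover n) : periodise k F (weyl w v) = periodise k F v := by
  by_cases h : ∃ p : Equiv.Perm (Fin n) × Cover n, IsLattice p.2 ∧
      weyl p.1 v + p.2 ∈ Metric.ball (basePoint n) (1 / (2 * n))
  · obtain ⟨⟨u, δ⟩, hδ, hv⟩ := h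
    have e : weyl (w⁻¹ * u) (weyl w v) = weyl u v := by
      rw [weyl_weyl, mul_inv_cancel_left]
    rw [periodise_of_mem k F hδ hv, periodise_of_mem (w := w⁻¹ * u) k F hδ (by rw [e]; exact hv), e]
  · rw [periodise, periodise, dif_neg h, dif_neg]
    rintro ⟨⟨u, δ⟩, hδ, hv⟩
    exact h ⟨(w * u, δ), hδ, hv⟩

theorem contDiff_weyl {n : ℕ} (w : Equiv.Perm (Fin n)) : ContDiff ℝ ∞ (weyl (n := n) w) :=
  (weyl w).toContinuousLinearEquiv.contDiff

-- Near the orbit of the ball one formula applies. Elsewhere the function vanishes locally, since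
-- the translates of the support form a closed set.
open scoped Pointwise in
theorem contDiff_periodise {n : ℕ} (k : ℕ) {F : Cover n → ℂ} (hF : ContDiff ℝ ∞ F)
    (hc : HasCompactSupport F)
    (hs : tsupport F ⊆ Metric.ball (basePoint n) (1 / (2 * n))) :
    ContDiff ℝ ∞ (periodise k F) := by
  rw [contDiff_iff_contDiffAt]
  intro v
  by_cases h : ∃ p : Equiv.Perm (Fin n) × Cover n, IsLattice p.2 ∧
      weyl p.1 v + p.2 ∈ Metric.ball (basePoint n) (1 / (2 * n))
  · obtain ⟨⟨w, γ⟩, hγ, hv⟩ := h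
    have hcont : Continuous fun v : Cover n => weyl w v + γ :=
      (contDiff_weyl w).continuous.add continuous_const
    have h1 : periodise k F =ᶠ[nhds v]
        fun v => (multiplier k γ (weyl w v))⁻¹ * F (weyl w v + γ) := by
      filter_upwards [(Metric.isOpen_ball.preimage hcont).mem_nhds hv] with x hx
      exact periodise_of_mem k F hγ hx
    refine ContDiffAt.congr_of_eventuallyEq ?_ h1
    exact (((contDiff_multiplier k γ).comp (contDiff_weyl w)).contDiffAt.inv
      (multiplier_ne_zero _ _ _)).mul (hF.comp ((contDiff_weyl w).add contDiff_const)).contDiffAt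
  -- A closed set plus a compact set is closed, and there are only finitely many permutations.
  · have hC : IsClosed (⋃ w : Equiv.Perm (Fin n), (weyl (n := n) w) ⁻¹'
        ({γ : Cover n | IsLattice γ} + tsupport F)) :=
      isClosed_iUnion_of_finite fun w => ((isClosed_isLattice n).add_right_of_isCompact
        hc).preimage (contDiff_weyl w).continuous
    have hv : v ∈ (⋃ w : Equiv.Perm (Fin n), (weyl (n := n) w) ⁻¹'
        ({γ : Cover n | IsLattice γ} + tsupport F))ᶜ := by
      intro hv
      obtain ⟨w, hw⟩ := Set.mem_iUnion.1 hv
      obtain ⟨γ, hγ, x, hx, hγx⟩ := Set.mem_add.1 hw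
      refine h ⟨(w, -γ), IsLattice.neg hγ, hs ?_⟩
      rw [← hγx]
      simpa using hx
    have h1 : periodise k F =ᶠ[nhds v] fun _ => 0 := by
      filter_upwards [hC.isOpen_compl.mem_nhds hv] with x hx
      by_cases h' : ∃ p : Equiv.Perm (Fin n) × Cover n, IsLattice p.2 ∧
        weyl p.1 x + p.2 ∈ Metric.ball (basePoint n) (1 / (2 * n))
      · obtain ⟨⟨w, γ⟩, hγ, hp⟩ := h'
        rw [periodise_of_mem k F hγ hp, image_eq_zero_of_notMem_tsupport (f := F), mul_zero]
        intro ht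
        exact hx (Set.mem_iUnion.2 ⟨w, Set.mem_add.2 ⟨-γ, IsLattice.neg hγ, _, ht, by abel⟩⟩)
      · rw [periodise, dif_neg h']
    exact contDiffAt_const.congr_of_eventuallyEq h1

/-- Every smooth function is near the base point equal to a section. -/
theorem exists_section_eventuallyEq {n : ℕ} (hn : 1 ≤ n) (k : ℕ) {f : Cover n → ℂ}
    (hf : ContDiff ℝ ∞ f) : ∃ ψ : Sec n k, ψ.toFn.fn =ᶠ[nhds (basePoint n)] f := by
  have hn0 : (0 : ℝ) < n := by exact_mod_cast hn
  let χ : ContDiffBump (basePoint n) :=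
    { rIn := 1 / (8 * n)
      rOut := 1 / (4 * n)
      rIn_pos := by positivity
      rIn_lt_rOut := by
        apply one_div_lt_one_div_of_lt <;> linarith }
  let F : Cover n → ℂ := fun v => (χ v : ℂ) * f v
  have hχ : ContDiff ℝ ∞ fun v => (χ v : ℂ) := Complex.ofRealCLM.contDiff.comp χ.contDiff
  have hsub : tsupport F ⊆ tsupport χ := by
    refine closure_mono fun v hv => ?_
    rw [Function.mem_support] at hv ⊢
    intro h0
    exact hv (by simp [F, h0])
  have hc : HasCompactSupport F := χ.hasCompactSupport.mono' ((subset_tsupport F).trans hsub)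
  have hs : tsupport F ⊆ Metric.ball (basePoint n) (1 / (2 * n)) := by
    refine hsub.trans ?_
    rw [χ.tsupport_eq]
    refine Metric.closedBall_subset_ball ?_
    change 1 / (4 * (n : ℝ)) < 1 / (2 * n)
    apply one_div_lt_one_div_of_lt <;> linarith
  have hsm := contDiff_periodise k (hχ.mul hf) hc hs
  refine ⟨⟨SmoothFn.mk ((regular n).indicator (periodise k F))
    (hsm.contDiffOn.congr fun v hv => Set.indicator_of_mem hv _)
    fun v hv => Set.indicator_of_notMem hv _, ?_, ?_⟩, ?_⟩
  · intro γ hγ v hv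
    rw [SmoothFn.mk_fn, Set.indicator_of_mem hv, Set.indicator_of_mem (regular_add hγ hv),
      periodise_translate k F hγ]
  · intro w v hv
    rw [SmoothFn.mk_fn, Set.indicator_of_mem hv, Set.indicator_of_mem (weyl_regular w v hv),
      periodise_weyl]
  · filter_upwards [(isOpen_regular n).mem_nhds (basePoint_mem_regular n),
      Metric.ball_mem_nhds (basePoint n) (show (0 : ℝ) < 1 / (2 * n) by positivity),
      χ.eventuallyEq_one] with v hv hv' hv1
    change (regular n).indicator (periodise k F) v = f v
    rw [Set.indicator_of_mem hv,
      periodise_of_mem (w := 1) (γ := 0) k F isLattice_zero (by simpa [weyl_one] using hv'),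
      weyl_one, multiplier_zero_left, add_zero, inv_one, one_mul]
    simp only [F, hv1, Pi.one_apply, Complex.ofReal_one, one_mul]

end HitchinWitten

end


/-! ### Nonvanishing of powers of operators, and necessity of the recursion. -/

noncomputable section

namespace HitchinWitten

/-! ### Local eigenfunctions -/

/-- `x ↦ pair u x` as a continuous linear map. -/
def pairCLM {n : ℕ} (u : cartan n) : cartan n →L[ℝ] ℝ :=
  LinearMap.toContinuousLinearMap
    { toFun := fun x => pair u x
      map_add' := fun x y => by
        simp only [pair, ← Finset.sum_add_distrib]
        exact Finset.sum_congr rfl fun j _ => mul_add _ _ _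
      map_smul' := fun c x => by
        simp only [pair, RingHom.id_apply, smul_eq_mul, Finset.mul_sum]
        exact Finset.sum_congr rfl fun j _ => mul_left_comm _ _ _ }

theorem hasFDerivAt_pair_self {n : ℕ} (x : cartan n) :
    HasFDerivAt (fun x : cartan n => pair x x) ((2 : ℝ) • pairCLM x) x := by
  have h : ∀ j : Fin n, HasFDerivAt (fun x : cartan n => x.1 j)
      ((ContinuousLinearMap.proj (R := ℝ) (φ := fun _ : Fin n => ℝ) j).comp (cartan n).subtypeL) x :=
    fun j => ((ContinuousLinearMap.proj (R := ℝ) (φ := fun _ : Fin n => ℝ) j).comp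
      (cartan n).subtypeL).hasFDerivAt
  have h1 := HasFDerivAt.fun_sum (u := Finset.univ) fun j _ => (h j).mul (h j)
  refine h1.congr_fderiv (ContinuousLinearMap.ext fun u => ?_)
  rw [sum_apply]
  change ∑ j, (x.1 j * u.1 j + x.1 j * u.1 j) = 2 * ∑ j, x.1 j * u.1 j
  rw [Finset.mul_sum]
  exact Finset.sum_congr rfl fun j _ => by ring

/-- The exponent `A |x|²/2 + B |y|²/2 + α · x`. -/
def quadExp {n : ℕ} (A B : ℂ) (α : cartan n) (v : Cover n) : ℂ :=
  A / 2 * (pair v.1 v.1 : ℝ) + B / 2 * (pair v.2 v.2 : ℝ) + (pair α v.1 : ℝ)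

theorem hasFDerivAt_quadExp {n : ℕ} (A B : ℂ) (α : cartan n) (v : Cover n) :
    HasFDerivAt (quadExp A B α)
      ((A / 2) • Complex.ofRealCLM.comp (((2 : ℝ) • pairCLM v.1).comp
        (ContinuousLinearMap.fst ℝ (cartan n) (cartan n)))
      + (B / 2) • Complex.ofRealCLM.comp (((2 : ℝ) • pairCLM v.2).comp
        (ContinuousLinearMap.snd ℝ (cartan n) (cartan n)))
      + Complex.ofRealCLM.comp ((pairCLM α).comp
        (ContinuousLinearMap.fst ℝ (cartan n) (cartan n)))) v := by
  have h1 := Complex.ofRealCLM.hasFDerivAt.comp v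
    ((hasFDerivAt_pair_self v.1).comp v
      (ContinuousLinearMap.fst ℝ (cartan n) (cartan n)).hasFDerivAt)
  have h2 := Complex.ofRealCLM.hasFDerivAt.comp v
    ((hasFDerivAt_pair_self v.2).comp v
      (ContinuousLinearMap.snd ℝ (cartan n) (cartan n)).hasFDerivAt)
  have h3 := Complex.ofRealCLM.hasFDerivAt.comp v
    ((pairCLM α).hasFDerivAt.comp v (ContinuousLinearMap.fst ℝ (cartan n) (cartan n)).hasFDerivAt)
  exact ((h1.const_mul (A / 2)).add (h2.const_mul (B / 2))).add h3

theorem fderiv_exp_quadExp {n : ℕ} (A B c : ℂ) (α : cartan n) (v u : Cover n) :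
    fderiv ℝ (fun v => c * Complex.exp (quadExp A B α v)) v u =
      (A * (pair v.1 u.1 : ℝ) + B * (pair v.2 u.2 : ℝ) + (pair α u.1 : ℝ)) *
        (c * Complex.exp (quadExp A B α v)) := by
  rw [((hasFDerivAt_quadExp A B α v).cexp.const_mul c).fderiv]
  have e : ∀ x y : cartan n, pairCLM x y = pair x y := fun _ _ => rfl
  simp only [smul_apply, add_apply, ContinuousLinearMap.comp_apply, smul_eq_mul,
    ContinuousLinearMap.coe_fst', ContinuousLinearMap.coe_snd', Complex.ofRealCLM_apply, e]
  push_cast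
  ring

theorem contDiff_quadExp {n : ℕ} (A B : ℂ) (α : cartan n) : ContDiff ℝ ∞ (quadExp A B α) := by
  unfold quadExp pair
  have h1 : ContDiff ℝ ∞ fun v : Cover n => ∑ j, v.1.1 j * v.1.1 j :=
    ContDiff.sum fun j _ => (contDiff_fst_coord j).mul (contDiff_fst_coord j)
  have h2 : ContDiff ℝ ∞ fun v : Cover n => ∑ j, v.2.1 j * v.2.1 j :=
    ContDiff.sum fun j _ => (contDiff_snd_coord j).mul (contDiff_snd_coord j)
  have h3 : ContDiff ℝ ∞ fun v : Cover n => ∑ j, α.1 j * v.1.1 j :=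
    ContDiff.sum fun j _ => contDiff_const.mul (contDiff_fst_coord j)
  exact ((contDiff_const.mul (Complex.ofRealCLM.contDiff.comp h1)).add
    (contDiff_const.mul (Complex.ofRealCLM.contDiff.comp h2))).add
    (Complex.ofRealCLM.contDiff.comp h3)

/-- The covariant derivative in the complex direction `z ⊗ u`. -/
def covDir {n : ℕ} (k : ℕ) (z : Fin 2 → ℂ) (u : cartan n) : Module.End ℂ (SmoothFn n) :=
  ∑ a, z a • cov k (dir a u)

theorem hessFn_vecMulVec {n : ℕ} (k : ℕ) (z : Fin 2 → ℂ) :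
    hessFn k (Matrix.vecMulVec z z) = ∑ j : Fin n, covDir k z (frame j) * covDir k z (frame j) := by
  simp only [hessFn, covDir, Finset.sum_mul_sum, smul_mul_smul_comm, Matrix.vecMulVec_apply,
    Finset.smul_sum]
  simp only [Fin.sum_univ_two, Finset.sum_add_distrib]

/-- The two quadratic coefficients are chosen so that the Gaussian cancels the potential in the
direction z. Only the linear exponent α · x contributes, with eigenvalue z₀ ⟨α, u⟩. -/
theorem covDir_exp {n k : ℕ} {z : Fin 2 → ℂ} (h0 : z 0 ≠ 0) (h1 : z 1 ≠ 0) (α u : cartan n)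
    {ψ : SmoothFn n} {c : ℂ} {v₀ : Cover n} (hv₀ : v₀ ∈ regular n)
    (hψ : ψ.fn =ᶠ[nhds v₀] fun v => c * Complex.exp (quadExp (Complex.I * Real.pi * k * z 1 / z 0)
      (-(Complex.I * Real.pi * k * z 0 / z 1)) α v)) :
    (covDir k z u ψ).fn =ᶠ[nhds v₀] fun v => (z 0 * (pair α u : ℝ) * c) *
      Complex.exp (quadExp (Complex.I * Real.pi * k * z 1 / z 0)
        (-(Complex.I * Real.pi * k * z 0 / z 1)) α v) := by
  filter_upwards [hψ.eventuallyEq_nhds, (isOpen_regular n).mem_nhds hv₀] with v hv hvr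
  have e : (covDir k z u ψ).fn v =
      z 0 * (cov k (dir 0 u) ψ).fn v + z 1 * (cov k (dir 1 u) ψ).fn v := by
    rw [covDir, Fin.sum_univ_two]
    rfl
  have hz : ∀ x : cartan n, pair x 0 = 0 := fun x => by simp [pair]
  rw [e, cov_apply k _ _ hvr, cov_apply k _ _ hvr, hv.fderiv_eq, hv.eq_of_nhds,
    fderiv_exp_quadExp, fderiv_exp_quadExp]
  simp only [omega, dir, if_true, if_false, one_ne_zero, hz]
  push_cast
  field_simp
  ring

theorem sum_pair_frame_sq {n : ℕ} (α : cartan n) :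
    ∑ j, ((pair α (frame j) : ℝ) : ℂ) ^ 2 = (pair α α : ℝ) := by
  rw [← sum_frame α α]
  push_cast
  exact Finset.sum_congr rfl fun j _ => by rw [pair_comm, sq]

theorem hessFn_exp {n k : ℕ} {z : Fin 2 → ℂ} (h0 : z 0 ≠ 0) (h1 : z 1 ≠ 0) (α : cartan n)
    {ψ : SmoothFn n} {c : ℂ} {v₀ : Cover n} (hv₀ : v₀ ∈ regular n)
    (hψ : ψ.fn =ᶠ[nhds v₀] fun v => c * Complex.exp (quadExp (Complex.I * Real.pi * k * z 1 / z 0)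
      (-(Complex.I * Real.pi * k * z 0 / z 1)) α v)) :
    (hessFn k (Matrix.vecMulVec z z) ψ).fn =ᶠ[nhds v₀] fun v => (z 0 ^ 2 * (pair α α : ℝ) * c) *
      Complex.exp (quadExp (Complex.I * Real.pi * k * z 1 / z 0)
        (-(Complex.I * Real.pi * k * z 0 / z 1)) α v) := by
  have h : ∀ᶠ v in nhds v₀, ∀ j : Fin n, (covDir k z (frame j) (covDir k z (frame j) ψ)).fn v =
      (z 0 * (pair α (frame j) : ℝ) * (z 0 * (pair α (frame j) : ℝ) * c)) *
      Complex.exp (quadExp (Complex.I * Real.pi * k * z 1 / z 0)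
        (-(Complex.I * Real.pi * k * z 0 / z 1)) α v) :=
    Filter.eventually_all.2 fun j => covDir_exp h0 h1 α _ hv₀ (covDir_exp h0 h1 α _ hv₀ hψ)
  filter_upwards [h] with v hv
  have e : (hessFn k (Matrix.vecMulVec z z) ψ).fn v =
      ∑ j, (covDir k z (frame j) (covDir k z (frame j) ψ)).fn v := by
    rw [hessFn_vecMulVec, LinearMap.sum_apply, SmoothFn.sum_fn, Finset.sum_apply]
    rfl
  rw [e, Finset.sum_congr rfl fun j _ => hv j, ← sum_pair_frame_sq, Finset.mul_sum,
    Finset.sum_mul, Finset.sum_mul]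
  exact Finset.sum_congr rfl fun j _ => by ring

theorem pair_frame_self_ne_zero {n : ℕ} (hn : 2 ≤ n) (j : Fin n) : pair (frame j) (frame j) ≠ 0 := by
  have hn' : (2 : ℝ) ≤ n := by exact_mod_cast hn
  rw [pair_frame_left]
  simp only [frame, if_true]
  have : (1 : ℝ) / n < 1 := by
    rw [div_lt_one (by linarith)]
    linarith
  linarith

/-- Near the base point some section is an eigenfunction with eigenvalue z₀²|α|², and differential
operators act on germs. A nonzero trace-free α exists because n ≥ 2. -/
theorem hess_vecMulVec_pow_ne_zero {n : ℕ} (hn : 2 ≤ n) (k : ℕ) {z : Fin 2 → ℂ} (h0 : z 0 ≠ 0)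
    (h1 : z 1 ≠ 0) (q : ℕ) : hess n k (Matrix.vecMulVec z z) ^ q ≠ 0 := by
  intro hq
  let α : cartan n := frame ⟨0, by omega⟩
  have hα : ((pair α α : ℝ) : ℂ) ≠ 0 := by exact_mod_cast pair_frame_self_ne_zero hn _
  obtain ⟨ψ, hψ⟩ := exists_section_eventuallyEq (by omega : 1 ≤ n) k
    (contDiff_quadExp (Complex.I * Real.pi * k * z 1 / z 0)
      (-(Complex.I * Real.pi * k * z 0 / z 1)) α).cexp
  have h : ∀ q : ℕ, (((hess n k (Matrix.vecMulVec z z) ^ q).1 ψ).toFn).fn =ᶠ[nhds (basePoint n)]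
      fun v => (z 0 ^ 2 * (pair α α : ℝ)) ^ q *
        Complex.exp (quadExp (Complex.I * Real.pi * k * z 1 / z 0)
          (-(Complex.I * Real.pi * k * z 0 / z 1)) α v) := by
    intro q
    induction q with
    | zero => simpa using hψ
    | succ q ih =>
      have := hessFn_exp h0 h1 α (basePoint_mem_regular n) ih
      rw [pow_succ', pow_succ']
      exact this
  have h2 := (h q).eq_of_nhds
  rw [hq] at h2
  have h3 : (0 : ℂ) = (z 0 ^ 2 * (pair α α : ℝ)) ^ q *
        Complex.exp (quadExp (Complex.I * Real.pi * k * z 1 / z 0)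
          (-(Complex.I * Real.pi * k * z 0 / z 1)) α (basePoint n)) := h2
  exact mul_ne_zero (pow_ne_zero _ (mul_ne_zero (pow_ne_zero _ h0) hα)) (Complex.exp_ne_zero _)
    h3.symm

/-! ### The numeric recursion is necessary -/

section

variable {n k : ℕ}

theorem commOp_pow_eq {a E : DiffOp n k} {c : ℂ} (h : commOp a E = c • E) (q : ℕ) :
    commOp a (E ^ q) = (q * c) • E ^ q := by
  induction q with
  | zero => simp [commOp_apply]
  | succ q ih =>
    have e : commOp a (E ^ (q + 1)) = commOp a (E ^ q) * E + E ^ q * commOp a E := by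
      simp only [commOp_apply, sub_mul, mul_sub, pow_succ, mul_assoc]
      abel
    rw [e, ih, h, smul_mul_assoc, mul_smul_comm, ← pow_succ, ← add_smul]
    congr 1
    push_cast
    ring

theorem commOp_pow_apply {a D : DiffOp n k} {c : ℂ} (h : commOp a D = c • D) (j : ℕ) :
    (commOp a ^ j) D = c ^ j • D := by
  induction j with
  | zero => simp
  | succ j ih => rw [pow_succ', Module.End.mul_apply, ih, map_smul, h, smul_smul, pow_succ]

/-- If F commuted with E^q, the Jacobi identity for F, E, E^q would make [F, E] = ρa commute with
E^q. But E^q is an eigenvector of ad_a with eigenvalue qc ≠ 0. -/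
theorem commOp_pow_ne_zero {a E F : DiffOp n k} {c ρ : ℂ} (hc : c ≠ 0) (hρ : ρ ≠ 0)
    (h : commOp a E = c • E) (hFE : commOp F E = ρ • a) (hE : ∀ q, E ^ q ≠ 0) {q : ℕ}
    (hq : 1 ≤ q) : commOp F (E ^ q) ≠ 0 := by
  intro h0
  have h1 := commOp_leibniz F E (E ^ q)
  have h2 : commOp E (E ^ q) = 0 := by
    rw [commOp_apply, ← pow_succ, ← pow_succ', sub_self]
  rw [h2, h0, map_zero, map_zero, add_zero, hFE, commOp_smul, LinearMap.smul_apply,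
    commOp_pow_eq h] at h1
  have hq' : (q : ℂ) ≠ 0 := by exact_mod_cast (by omega : q ≠ 0)
  rcases smul_eq_zero.1 h1.symm with h3 | h3
  · exact hρ h3
  · rcases smul_eq_zero.1 h3 with h4 | h4
    · exact mul_ne_zero hq' hc h4
    · exact hE q h4

theorem eq_zero_of_sum_pow_eq_zero {c : ℂ} (hc : c ≠ 0) (l : ℕ) (e : ℕ → ℂ)
    (h : ∀ q : ℕ, 1 ≤ q → ∑ j ∈ Finset.range (l + 1), e j * (q * c) ^ j = 0) :
    ∀ j ≤ l, e j = 0 := by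
  let p : Polynomial ℂ := ∑ j ∈ Finset.range (l + 1), Polynomial.monomial j (e j)
  have hp : p = 0 := by
    refine Polynomial.eq_zero_of_infinite_isRoot p (Set.infinite_of_injective_forall_mem
      (f := fun q : ℕ => ((q + 1 : ℕ) : ℂ) * c) (fun q q' hqq => ?_) fun q => ?_)
    · have := mul_right_cancel₀ hc hqq
      have : q + 1 = q' + 1 := by exact_mod_cast this
      omega
    · change p.IsRoot _
      rw [Polynomial.IsRoot.def, Polynomial.eval_finsetSum]
      simp only [Polynomial.eval_monomial]
      exact h (q + 1) (by omega)
  intro j hj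
  have h1 : p.coeff j = e j := by
    simp only [p, Polynomial.finsetSum_coeff, Polynomial.coeff_monomial]
    rw [Finset.sum_ite_eq' (Finset.range (l + 1)) j e, if_pos (by simpa [Nat.lt_succ_iff] using hj)]
  rw [← h1, hp, Polynomial.coeff_zero]

/-- On E^q the operator P⁽ʲ⁾ is the scalar (qc)ʲ/j!, so the sum is a polynomial in qc times the
nonzero operator [F, E^q]. It vanishes for all q ≥ 1, and so do its coefficients. -/
theorem eq_zero_of_sum_commOp {τ : UpperHalfPlane} {E F : DiffOp n k} {c ρ : ℂ} (hc : c ≠ 0)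
    (hρ : ρ ≠ 0) (h : commOp (aOp n k τ) E = c • E) (hFE : commOp F E = ρ • aOp n k τ)
    (hE : ∀ q, E ^ q ≠ 0) (l : ℕ) (e : ℕ → ℂ)
    (hs : ∀ q, ∑ j ∈ Finset.range (l + 1), e j • commOp F (adPow n k j τ (E ^ q)) = 0) :
    ∀ j ≤ l, e j = 0 := by
  have h1 := eq_zero_of_sum_pow_eq_zero hc l (fun j => e j * (j.factorial : ℂ)⁻¹) fun q hq => by
    have h2 := hs q
    simp only [adPow, LinearMap.smul_apply, commOp_pow_apply (commOp_pow_eq h q), map_smul,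
      smul_smul, ← Finset.sum_smul] at h2
    rcases smul_eq_zero.1 h2 with h3 | h3
    · rw [← h3]
      exact Finset.sum_congr rfl fun j _ => by ring
    · exact absurd h3 (commOp_pow_ne_zero hc hρ h hFE hE hq)
  intro j hj
  have h3 : (j.factorial : ℂ)⁻¹ ≠ 0 := inv_ne_zero (by exact_mod_cast j.factorial_ne_zero)
  exact (mul_eq_zero.1 (h1 j hj)).resolve_right h3

theorem commOp_self_pow (c : ℂ) (E : DiffOp n k) (q : ℕ) : commOp (c • E) (E ^ q) = 0 := by
  rw [commOp_smul, LinearMap.smul_apply, commOp_apply, ← pow_succ, ← pow_succ', sub_self, smul_zero]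

theorem lap_eq_smul_aOp (τ : UpperHalfPlane) : lap n k τ = (2 * Complex.I) • aOp n k τ := by
  rw [aOp, smul_smul, show 2 * Complex.I * -(Complex.I / 2) = 1 by
    linear_combination -Complex.I_sq, one_smul]

theorem commOp_vecZbar_vecZ (τ : UpperHalfPlane) :
    commOp (hess n k (Matrix.vecMulVec (vecZbar τ) (vecZbar τ)))
      (hess n k (Matrix.vecMulVec (vecZ τ) (vecZ τ))) =
      (-(64 * Real.pi ^ 2 * Complex.I * k * (τ : ℂ).im ^ 2) : ℂ) • aOp n k τ := by
  rw [commOp_apply, hess_commutator _ _ _ _ (by rw [vecMulVec_vecZbar]; simp),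
    vecZbar_omega_vecZ _ τ.im_pos.ne', ← hessLin_apply, map_smul, hessLin_apply]
  change _ • _ • lap n k τ = _
  rw [lap_eq_smul_aOp, smul_smul, smul_smul]
  congr 1
  linear_combination (64 * Real.pi ^ 2 * Complex.I * k * (τ : ℂ).im ^ 2 : ℂ) * Complex.I_sq

/-- One point and one tangent vector suffice. Powers of F commute with b̄ and isolate the upper
sign; powers of E commute with b and isolate the lower one. -/
theorem numRec_of_isTrivialisation (hn : 2 ≤ n) (hk : 1 ≤ k) {c : ℕ → ℕ → ℂ}
    (h : IsTrivialisation (ansatz n k c)) : NumRec k c := by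
  have hk' : (k : ℂ) ≠ 0 := by exact_mod_cast (by omega : k ≠ 0)
  have hp : (Real.pi : ℂ) ≠ 0 := by exact_mod_cast Real.pi_ne_zero
  let τ : UpperHalfPlane := UpperHalfPlane.I
  have hτ : (τ : ℂ) = Complex.I := rfl
  let E := hess n k (Matrix.vecMulVec (vecZ τ) (vecZ τ))
  let F := hess n k (Matrix.vecMulVec (vecZbar τ) (vecZbar τ))
  have hE : ∀ q, E ^ q ≠ 0 := fun q =>
    hess_vecMulVec_pow_ne_zero hn k (by simp [vecZ]) (by simp [vecZ, hτ]) q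
  have hF : ∀ q, F ^ q ≠ 0 := fun q =>
    hess_vecMulVec_pow_ne_zero hn k (by simp [vecZbar]) (by simp [vecZbar, hτ]) q
  have hb : bForm n k τ 1 = coefB τ 1 • E := bForm_eq n k τ 1
  have hb' : bbarForm n k τ 1 = coefBbar τ 1 • F := bbarForm_eq n k τ 1
  have hc : coefB τ 1 ≠ 0 := by simp [coefB, hτ]
  have hc' : coefBbar τ 1 ≠ 0 := by simp [coefBbar, hτ]
  have hFE : commOp F E = (-(64 * Real.pi ^ 2 * Complex.I * k) : ℂ) • aOp n k τ := by
    rw [commOp_vecZbar_vecZ, hτ]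
    simp
  have hEF : commOp E F = (64 * Real.pi ^ 2 * Complex.I * k : ℂ) • aOp n k τ := by
    have : commOp E F = (-1 : ℂ) • commOp F E := by
      rw [commOp_apply, commOp_apply]
      module
    rw [this, hFE, smul_smul]
    congr 1
    ring
  have haE : commOp (aOp n k τ) E = (2 * Complex.I * k) • E := by
    rw [aOp, commOp_smul, LinearMap.smul_apply, commOp_apply, lap_commutator_vecZ, smul_smul]
    congr 1
    ring
  have haF : commOp (aOp n k τ) F = (-(2 * Complex.I * k)) • F := by
    rw [aOp, commOp_smul, LinearMap.smul_apply, commOp_apply, lap_commutator_vecZbar, smul_smul]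
    congr 1
    ring
  have h2k : (2 * Complex.I * k : ℂ) ≠ 0 := by simp [hk']
  have hρ : (64 * Real.pi ^ 2 * Complex.I * k : ℂ) ≠ 0 := by simp [hk', hp]
  intro m l hm hml
  have hsum := fun D => sum_numE_eq_zero hk h l D τ 1
  have hplus : ∀ j ≤ l, numE k 1 c (l - j) l = 0 := by
    refine eq_zero_of_sum_commOp (neg_ne_zero.2 h2k) hρ haF hEF hF l
      (fun j => numE k 1 c (l - j) l) fun q => ?_
    have h1 := hsum (F ^ q)
    have h2 : ∀ j, commOp (bbarForm n k τ 1) (adPow n k j τ (F ^ q)) = 0 := fun j => by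
      rw [adPow, LinearMap.smul_apply, commOp_pow_apply (commOp_pow_eq haF q), map_smul, map_smul,
        hb', commOp_self_pow, smul_zero, smul_zero]
    simp only [h2, smul_zero, Finset.sum_const_zero, hb, commOp_smul, LinearMap.smul_apply] at h1
    simp only [smul_comm _ (coefB τ 1), ← Finset.smul_sum] at h1
    exact (smul_eq_zero.1 h1).resolve_left hc
  have hminus : ∀ j ≤ l, numE k (-1) c (l - j) l = 0 := by
    refine eq_zero_of_sum_commOp h2k (neg_ne_zero.2 hρ) haE hFE hE l
      (fun j => numE k (-1) c (l - j) l) fun q => ?_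
    have h1 := hsum (E ^ q)
    have h2 : ∀ j, commOp (bForm n k τ 1) (adPow n k j τ (E ^ q)) = 0 := fun j => by
      rw [adPow, LinearMap.smul_apply, commOp_pow_apply (commOp_pow_eq haE q), map_smul, map_smul,
        hb, commOp_self_pow, smul_zero, smul_zero]
    simp only [h2, smul_zero, Finset.sum_const_zero, hb', commOp_smul, LinearMap.smul_apply] at h1
    simp only [smul_comm _ (coefBbar τ 1), ← Finset.smul_sum] at h1
    exact (smul_eq_zero.1 h1.symm).resolve_left hc'
  have h1 := hplus (l - m) (Nat.sub_le _ _)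
  have h2 := hminus (l - m) (Nat.sub_le _ _)
  rw [Nat.sub_sub_self hml] at h1 h2
  exact ⟨h1, h2⟩

theorem one_ne_zero_diffOp (hn : 2 ≤ n) : (1 : DiffOp n k) ≠ 0 := by
  have h := hess_vecMulVec_pow_ne_zero hn k (z := fun _ => 1) one_ne_zero one_ne_zero 0
  rwa [pow_zero] at h

/-- The identity commutes with a, so only P⁽⁰⁾ contributes. Its image reads off the diagonal
coefficients, hence c_{0,0} = 1 and the distinctness of trivialisations. -/
theorem ansatz_one (c : ℕ → ℕ → ℂ) (l : ℕ) (τ : UpperHalfPlane) :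
    ansatz n k c l τ 1 = c l l • (1 : DiffOp n k) := by
  rw [ansatz, LinearMap.sum_apply, Finset.sum_range_succ, Finset.sum_eq_zero, zero_add, Nat.sub_self]
  · simp [adPow]
  · intro r hr
    obtain ⟨p, hp⟩ : ∃ p, l - r = p + 1 := ⟨l - r - 1, by have := Finset.mem_range.1 hr; omega⟩
    have h : commOp (aOp n k τ) 1 = 0 := by rw [commOp_apply, mul_one, one_mul, sub_self]
    rw [LinearMap.smul_apply, hp, adPow, LinearMap.smul_apply, pow_succ, Module.End.mul_apply, h,
      map_zero, smul_zero, smul_zero]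

theorem ansatz_isTrivialisation_iff (hn : 2 ≤ n) (hk : 1 ≤ k) (c : ℕ → ℕ → ℂ) :
    IsTrivialisation (ansatz n k c) ↔ c 0 0 = 1 ∧ NumRec k c := by
  refine ⟨fun h => ⟨?_, numRec_of_isTrivialisation hn hk h⟩,
    fun h => ansatz_isTrivialisation hk h.1 h.2⟩
  have h1 := h.zero UpperHalfPlane.I 1
  rw [ansatz_one, ← sub_eq_zero] at h1
  have h2 : (c 0 0 - 1) • (1 : DiffOp n k) = 0 := by
    rw [sub_smul, one_smul]
    exact h1
  exact sub_eq_zero.1 ((smul_eq_zero.1 h2).resolve_right (one_ne_zero_diffOp hn))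

end

end HitchinWitten

end


/-! ### Convergence of r, and the comparison of trivialisations. -/

noncomputable section

namespace HitchinWitten

open PowerSeries

/-! ### The value of the series `r` -/

theorem witten_quotient_eq (k : ℕ) {s : ℝ} (hs : s ≠ 0) :
    -((k - Complex.I * s) / (k + Complex.I * s)) =
      (1 + (k / s : ℂ) * Complex.I) / (1 - (k / s : ℂ) * Complex.I) := by
  have hs' : (s : ℂ) ≠ 0 := by exact_mod_cast hs
  have h1 : (k + Complex.I * s : ℂ) ≠ 0 := fun h => by
    have := congrArg Complex.im h
    simp [hs] at this
  have h2 : (1 - (k / s : ℂ) * Complex.I) = -Complex.I * (k + Complex.I * s) / s := by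
    field_simp
    linear_combination (s : ℂ) * Complex.I_sq
  have h3 : (1 + (k / s : ℂ) * Complex.I) = Complex.I * (k - Complex.I * s) / s := by
    field_simp
    linear_combination (s : ℂ) * Complex.I_sq
  rw [h2, h3]
  have hI := Complex.I_ne_zero
  field_simp

/-- The logarithm in `wittenR` is the one defining the complex arctangent: r = (i/2k) arctan(k/s).
The arctangent series converges for |k/s| < 1. -/
theorem hasSum_rSeries (k : ℕ) (hk : 1 ≤ k) {s : ℝ} (hs : (k : ℝ) < |s|) :
    HasSum (fun l => coeff l (rSeries k) * ((s : ℂ)⁻¹) ^ l) (wittenR k s) := by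
  have hk' : (k : ℂ) ≠ 0 := by exact_mod_cast (by omega : k ≠ 0)
  have hs0 : 0 < |s| := (Nat.cast_nonneg k).trans_lt hs
  have hs1 : s ≠ 0 := abs_pos.1 hs0
  have hs' : (s : ℂ) ≠ 0 := by exact_mod_cast hs1
  have hz : ‖(k / s : ℂ)‖ < 1 := by
    rw [norm_div, Complex.norm_natCast, Complex.norm_real, Real.norm_eq_abs, div_lt_one hs0]
    exact hs
  have h1 := (Complex.hasSum_arctan hz).mul_left (Complex.I / (2 * k))
  have e : Complex.I / (2 * k) * Complex.arctan (k / s) = wittenR k s := by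
    rw [wittenR, witten_quotient_eq k hs1, Complex.arctan]
    generalize Complex.log _ = L
    field_simp
    linear_combination -4 * L * Complex.I_sq
  rw [e] at h1
  have hinj : Function.Injective fun m : ℕ => 2 * m + 1 := fun a b h => by
    have : 2 * a + 1 = 2 * b + 1 := h
    omega
  refine (hinj.hasSum_iff fun l hl => ?_).1 ?_
  · rw [rSeries, coeff_mk, if_neg, zero_mul]
    rintro ⟨m, hm⟩
    exact hl ⟨m, hm.symm⟩
  · refine (congrArg (fun F => HasSum F (wittenR k s)) (funext fun m => ?_)).mpr h1
    have hm : ((2 * m + 1 : ℕ) : ℂ) ≠ 0 := by exact_mod_cast (2 * m).succ_ne_zero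
    rw [Function.comp_apply, rSeries, coeff_mk, if_pos ⟨m, rfl⟩, mul_pow, div_pow, inv_pow,
      pow_succ Complex.I, pow_mul, Complex.I_sq]
    field_simp

theorem exp_wittenR (k : ℕ) (hk : 1 ≤ k) {s : ℝ} (hs : (k : ℝ) < |s|) :
    Complex.exp (4 * wittenR k s * k) = -((k - Complex.I * s) / (k + Complex.I * s)) := by
  have hk' : (k : ℂ) ≠ 0 := by exact_mod_cast (by omega : k ≠ 0)
  have hs1 : s ≠ 0 := abs_pos.1 ((Nat.cast_nonneg k).trans_lt hs)
  have h1 : (k + Complex.I * s : ℂ) ≠ 0 := fun h => by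
    have := congrArg Complex.im h
    simp [hs1] at this
  have h2 : (k - Complex.I * s : ℂ) ≠ 0 := fun h => by
    have := congrArg Complex.im h
    simp [hs1] at this
  have e : 4 * wittenR k s * k = Complex.log (-((k - Complex.I * s) / (k + Complex.I * s))) := by
    rw [wittenR]
    field_simp
  rw [e, Complex.exp_log (neg_ne_zero.2 (div_ne_zero h2 h1))]

/-! ### Infinitely many invariant trivialisations -/

/-- The diagonal series 1 + tX, for t ∈ ℂ, give trivialisations that are told apart by S⁽¹⁾(1) = t.
-/
theorem infinite_trivialisations {n k : ℕ} (hn : 2 ≤ n) (hk : 1 ≤ k) :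
    {S | (∃ c, S = ansatz n k c) ∧ IsTrivialisation S ∧ IsMCGInvariant S}.Infinite := by
  refine Set.infinite_of_injective_forall_mem
    (f := fun t : ℂ => ansatz n k (solution k (1 + C t * X))) (fun t t' h => ?_)
    fun t => ⟨⟨_, rfl⟩, ?_, ansatz_isMCGInvariant _⟩
  · have h1 : ansatz n k (solution k (1 + C t * X)) 1 UpperHalfPlane.I 1 =
        ansatz n k (solution k (1 + C t' * X)) 1 UpperHalfPlane.I 1 :=
      congrArg (fun S => S 1 UpperHalfPlane.I 1) h
    rw [ansatz_one, ansatz_one, solution_diag, solution_diag] at h1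
    have h2 := smul_left_injective ℂ (one_ne_zero_diffOp (k := k) hn) h1
    simpa [coeff_one, coeff_X] using h2
  · refine ansatz_isTrivialisation hk ?_ (solution_numRec k hk _)
    rw [solution_diag]
    simp

/-! ### Comparison of two trivialisations -/

/-- The series p is the quotient of the two diagonal series, both of constant term 1. -/
theorem exists_scalarSeries {n k : ℕ} (hk : 1 ≤ k) {c c' : ℕ → ℕ → ℂ} (h0 : c 0 0 = 1)
    (h : NumRec k c) (h0' : c' 0 0 = 1) (h' : NumRec k c') :
    ∃ p : PowerSeries ℂ, constantCoeff p = 1 ∧ ∀ τ D,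
      formalSeries (ansatz n k c) τ D = scalarSeries n k p * formalSeries (ansatz n k c') τ D := by
  have e : constantCoeff (PowerSeries.mk fun l => c' l l) = 1 := by
    rw [← coeff_zero_eq_constantCoeff_apply, coeff_mk, h0']
  have e' : constantCoeff (PowerSeries.mk fun l => c l l) = 1 := by
    rw [← coeff_zero_eq_constantCoeff_apply, coeff_mk, h0]
  refine ⟨(PowerSeries.mk fun l => c l l) * (PowerSeries.mk fun l => c' l l)⁻¹, ?_, fun τ D =>
    scalarSeries_mul_formalSeries hk h h' _ ?_ τ D⟩
  · rw [map_mul, constantCoeff_inv, e, e', inv_one, mul_one]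
  · rw [mul_assoc, PowerSeries.inv_mul_cancel _ (by rw [e]; exact one_ne_zero), mul_one]

end HitchinWitten

end

open HitchinWitten

theorem theorem4 (n k : ℕ) (hn : 2 ≤ n) (hk : 1 ≤ k) :
    -- every choice of diagonal coefficients extends uniquely to a solution
    (∀ d : ℕ → ℂ, ∃! c : ℕ → ℕ → ℂ, IsTriangular c ∧ NumRec k c ∧ ∀ l, c l l = d l) ∧
    -- the solutions through lower-triangular matrices in the nilpotent matrix `N`
    (∀ l, IsUnit (tanhMat k l) ∧ ∀ i j, i < j → tanhMat k l i j = 0) ∧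
    (∀ c : ℕ → ℕ → ℂ, NumRec k c ↔ ∀ l, (fun ρ : Fin (l + 1) => c ρ (l + 1)) =
      Matrix.mulVec (tanhMat k (l + 1))⁻¹ fun ρ : Fin (l + 1) => c ρ l) ∧
    -- the ansatz solves the recursion of operators iff the coefficients solve the numeric one
    (∀ c : ℕ → ℕ → ℂ, IsTrivialisation (ansatz n k c) ↔ c 0 0 = 1 ∧ NumRec k c) ∧
    -- it is always invariant under the mapping class group
    (∀ c : ℕ → ℕ → ℂ, IsMCGInvariant (ansatz n k c)) ∧
    -- there are infinitely many invariant trivialisations of this form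
    {S | (∃ c, S = ansatz n k c) ∧ IsTrivialisation S ∧ IsMCGInvariant S}.Infinite ∧
    -- any two differ by an (invertible) power series in `1/s` with constant coefficients
    (∀ c c' : ℕ → ℕ → ℂ, IsTrivialisation (ansatz n k c) → IsTrivialisation (ansatz n k c') →
      ∃ p : PowerSeries ℂ, PowerSeries.constantCoeff p = 1 ∧ ∀ τ D,
        formalSeries (ansatz n k c) τ D = scalarSeries n k p * formalSeries (ansatz n k c') τ D) ∧
    -- the solution with vanishing diagonal coefficients for `l > 0`
    (∀ c₀ : ℕ → ℕ → ℂ, IsTrivialisation (ansatz n k c₀) → (∀ l, 0 < l → c₀ l l = 0) →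
      (∀ c : ℕ → ℕ → ℂ, IsTrivialisation (ansatz n k c) → ∀ τ D,
        formalSeries (ansatz n k c) τ D =
          scalarSeries n k (PowerSeries.mk fun l => c l l) * formalSeries (ansatz n k c₀) τ D) ∧
      ∀ τ D, formalSeries (ansatz n k c₀) τ D = expNegLap n k τ * PowerSeries.C D * expLap n k τ) ∧
    -- `exp(r Δ)` is the formal expansion of the explicit gauge equivalence of the Hitchin–Witten
    -- connection with the trivial one
    (∀ s : ℝ, (k : ℝ) < |s| →
      HasSum (fun l => PowerSeries.coeff l (rSeries k) * ((s : ℂ)⁻¹) ^ l) (wittenR k s) ∧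
      Complex.exp (4 * wittenR k s * k) = -((k - Complex.I * s) / (k + Complex.I * s))) ∧
    (∀ τ V l, HasOpDeriv (fun τ => PowerSeries.coeff l (expLap n k τ)) τ V
      (PowerSeries.coeff l (expLap n k τ * connForm n k τ V))) := by
  refine ⟨existsUnique_solution k hk, fun l => ⟨tanhMat_isUnit k l, fun i j hij => ?_⟩,
    numRec_iff_matrix k hk, ansatz_isTrivialisation_iff hn hk, ansatz_isMCGInvariant,
    infinite_trivialisations hn hk, fun c c' h h' => ?_, fun c₀ h₀ hd => ⟨fun c h τ D => ?_, ?_⟩,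
    fun s hs => ⟨hasSum_rSeries k hk hs, exp_wittenR k hk hs⟩, expLap_hasOpDeriv hk⟩
  · rw [tanhMat_apply, if_neg (not_le.2 hij)]
  · rw [ansatz_isTrivialisation_iff hn hk] at h h'
    exact exists_scalarSeries hk h.1 h.2 h'.1 h'.2
  · rw [ansatz_isTrivialisation_iff hn hk] at h h₀
    refine scalarSeries_mul_formalSeries hk h.2 h₀.2 _ ?_ τ D
    have e : (PowerSeries.mk fun l => c₀ l l) = (1 : PowerSeries ℂ) := by
      ext l
      rw [PowerSeries.coeff_mk, PowerSeries.coeff_one]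
      split_ifs with hl
      · rw [hl, h₀.1]
      · exact hd l (by omega)
    rw [e, mul_one]
  · rw [ansatz_isTrivialisation_iff hn hk] at h₀
    exact formalSeries_eq_conj hk h₀.2 h₀.1 hd
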